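/- A map is a cellular embedding of a finite connected graph $K$ in a closed oriented surface, given by its rotation system: a permutation $R$ of the darts (directed edges) of $K$ whose cycles are exactly the sets of darts with a common initial vertex. An isomorphism of maps is a graph isomorphism commuting with the rotations (that is, orientation-preserving), and the map is (orientably) regular if its automorphism group $\mathrm{Aut}(\mathcal M)$ acts regularly on the darts. For a map $\mathcal M$ on $K_{n,n}$ let $\mathrm{Aut}_0(\mathcal M)\le \mathrm{Aut}(\mathcal M)$ be the subgroup of automorphisms that leave each of the two parts of $K_{n,n}$ invariant. A group is metacyclic if it has a cyclic normal subgroup with cyclic quotient. An $n$-isobicyclic triple $(G,a,b)$ is a group $G=\langle a\rangle\langle b\rangle$ with $a,b$ of order $n$, $\langle a\rangle\cap\langle b\rangle=1$, and an automorphism of $G$ transposing $a$ and $b$. A regular map $\mathcal M$ on $K_{n,n}$ corresponds to $(G,a,b)$ if, for an edge $uv$, there is an isomorphism $G\to\mathrm{Aut}_0(\mathcal M)$ taking $a$ and $b$ to the automorphisms that rotate $uv$ around $u$ and around $v$, respectively, to the next edge. For $n=2^e\ge 4$ and $k,l\in\{0,1\}$ let $$G_2(e;k,l)=\langle a,b\mid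 a^n=b^n=[b^2,a^2]=1,\ [b,a]=a^2b^{-2}z^k,\ (b^2)^a=b^{-2}z^l,\ (a^2)^b=a^{-2}z^l\rangle,\quad z=a^{n/2}b^{n/2},$$ where $[x,y]=x^{-1}y^{-1}xy$ and $x^y=y^{-1}xy$. **Theorem 5.1.** For each $n=2^e\ge 8$ there are, up to isomorphism, exactly four regular embeddings $\mathcal M$ of $K_{n,n}$ for which $\mathrm{Aut}_0(\mathcal M)$ is non-metacyclic. They are in bijection with the four $n$-isobicyclic triples $(G_2(e;k,l),a,b)$, $k,l\in\{0,1\}$: each of these is an $n$-isobicyclic triple, and there are pairwise non-isomorphic such maps $\mathcal M_{k,l}$, representing all four isomorphism classes, such that for every choice of the edge $uv$ a regular embedding of $K_{n,n}$ corresponds to $(G_2(e;k,l),a,b)$ if and only if it is isomorphic to $\mathcal M_{k,l}$. For $K_{4,4}$ there is, up to isomorphism, exactly one regular embedding $\mathcal M$ for which $\mathrm{Aut}_0(\mathcal M)$ is non-metacyclic; for every choice of the edge, a regular embedding of $K_{4,4}$ corresponds to the $4$-isobicyclic triple $(G_2(2;0,0),a,b)$ if and only if it is isomorphic to this $\mathcal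 M$. -/

import Mathlib

/-! ### Metacyclic groups, isobicyclic triples, the groups `G₂(e; k, l)` -/

/-- A group is metacyclic if it has a cyclic normal subgroup with cyclic quotient. -/
def IsMetacyclic (G : Type*) [Group G] : Prop :=
  ∃ N : Subgroup G, ∃ _ : N.Normal, IsCyclic N ∧ IsCyclic (G ⧸ N)

/-- `(G, a, b)` is an `n`-isobicyclic triple: `G = ⟨a⟩⟨b⟩` with `a`, `b` of order `n`,
`⟨a⟩ ∩ ⟨b⟩ = 1`, and some automorphism of `G` transposes `a` and `b`. -/
structure IsIsobicyclicTriple (n : ℕ) {G : Type*} [Group G] (a b : G) : Prop where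
  orderOf_left : orderOf a = n
  orderOf_right : orderOf b = n
  factorises : ∀ g : G, ∃ x ∈ Subgroup.zpowers a, ∃ y ∈ Subgroup.zpowers b, g = x * y
  disjoint : Subgroup.zpowers a ⊓ Subgroup.zpowers b = ⊥
  transposes : ∃ α : G ≃* G, α a = b ∧ α b = a

/-- The commutator `[x, y] = x⁻¹ y⁻¹ x y` (Mathlib's `⁅x, y⁆` is `x y x⁻¹ y⁻¹`). -/
def comm' {G : Type*} [Group G] (x y : G) : G := x⁻¹ * y⁻¹ * x * y

/-- The conjugate `x ^ y = y⁻¹ x y`. -/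
def conj' {G : Type*} [Group G] (x y : G) : G := y⁻¹ * x * y

/-- The relators of `G₂(e; k, l)` on the free generators `a = of 0`, `b = of 1`, where `n = 2 ^ e`
and `z = a ^ (n / 2) * b ^ (n / 2)`; a relation `u = v` is the relator `u * v⁻¹`. -/
def G2Rels (e k l : ℕ) : Set (FreeGroup (Fin 2)) :=
  let a : FreeGroup (Fin 2) := FreeGroup.of 0
  let b : FreeGroup (Fin 2) := FreeGroup.of 1
  let n : ℕ := 2 ^ e
  let z : FreeGroup (Fin 2) := a ^ (n / 2) * b ^ (n / 2)
  {a ^ n,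
   b ^ n,
   comm' (b ^ 2) (a ^ 2),
   comm' b a * (a ^ 2 * (b ^ 2)⁻¹ * z ^ k)⁻¹,
   conj' (b ^ 2) a * ((b ^ 2)⁻¹ * z ^ l)⁻¹,
   conj' (a ^ 2) b * ((a ^ 2)⁻¹ * z ^ l)⁻¹}

/-- The group `G₂(e; k, l)`, given by generators and relations. -/
abbrev G2 (e k l : ℕ) : Type := PresentedGroup (G2Rels e k l)

/-- The generator `a` of `G₂(e; k, l)`. -/
def G2.a (e k l : ℕ) : G2 e k l := PresentedGroup.of 0

/-- The generator `b` of `G₂(e; k, l)`. -/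
def G2.b (e k l : ℕ) : G2 e k l := PresentedGroup.of 1

/-! ### Oriented maps -/

/-- An oriented map with (finite connected) underlying graph `K`, that is, a cellular embedding of
`K` in a closed oriented surface, given by its rotation system: `rot` sends each dart (edge directed
away from its initial vertex) to the next dart around the same initial vertex, following the
orientation, and the darts at a vertex form a single cycle of `rot`. -/
@[ext]
structure OrientedMap {V : Type*} (K : SimpleGraph V) where
  rot : Equiv.Perm K.Dart
  fst_rot : ∀ d, (rot d).fst = d.fst
  sameCycle : ∀ d d' : K.Dart, d.fst = d'.fst → rot.SameCycle d d'

namespace OrientedMap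

variable {V : Type*} {K : SimpleGraph V}

/-- A graph automorphism `φ` is an orientation-preserving isomorphism from `M` to `M'` if it
carries the rotation of `M` to that of `M'`. -/
def IsIso (M M' : OrientedMap K) (φ : K ≃g K) : Prop :=
  ∀ d : K.Dart, φ.toHom.mapDart (M.rot d) = M'.rot (φ.toHom.mapDart d)

theorem IsIso.refl (M : OrientedMap K) : M.IsIso M 1 := fun _ => rfl

theorem IsIso.mul {M₁ M₂ M₃ : OrientedMap K} {φ ψ : K ≃g K}
    (hψ : M₂.IsIso M₃ ψ) (hφ : M₁.IsIso M₂ φ) : M₁.IsIso M₃ (ψ * φ) := fun d => by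
  have h := congrArg ψ.toHom.mapDart (hφ d)
  rw [hψ] at h
  exact h

theorem mapDart_inv (φ : K ≃g K) (d : K.Dart) :
    φ.toHom.mapDart ((φ⁻¹).toHom.mapDart d) = d := by
  ext
  · exact φ.apply_symm_apply d.fst
  · exact φ.apply_symm_apply d.snd

theorem mapDart_inv' (φ : K ≃g K) (d : K.Dart) :
    (φ⁻¹).toHom.mapDart (φ.toHom.mapDart d) = d := by
  ext
  · exact φ.symm_apply_apply d.fst
  · exact φ.symm_apply_apply d.snd

theorem IsIso.inv {M₁ M₂ : OrientedMap K} {φ : K ≃g K} (hφ : M₁.IsIso M₂ φ) :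
    M₂.IsIso M₁ φ⁻¹ := fun d => by
  have h := hφ ((φ⁻¹).toHom.mapDart d)
  rw [mapDart_inv] at h
  rw [← h, mapDart_inv']

/-- Isomorphism of oriented maps on the graph `K`. -/
def Isomorphic (M M' : OrientedMap K) : Prop := ∃ φ : K ≃g K, M.IsIso M' φ

/-- Isomorphism of oriented maps is an equivalence relation. -/
def isoSetoid (K : SimpleGraph V) : Setoid (OrientedMap K) where
  r := Isomorphic
  iseqv := ⟨fun M => ⟨1, IsIso.refl M⟩, fun ⟨φ, h⟩ => ⟨φ⁻¹, h.inv⟩,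
    fun ⟨φ, h⟩ ⟨ψ, h'⟩ => ⟨ψ * φ, h'.mul h⟩⟩

/-- The group `Aut(M)` of orientation-preserving automorphisms of `M`. -/
def Aut (M : OrientedMap K) : Subgroup (K ≃g K) where
  carrier := {φ | M.IsIso M φ}
  one_mem' := IsIso.refl M
  mul_mem' := IsIso.mul
  inv_mem' := IsIso.inv

/-- `M` is (orientably) regular: `Aut(M)` acts regularly on the darts. -/
def IsRegular (M : OrientedMap K) : Prop :=
  ∀ d d' : K.Dart, ∃! φ : M.Aut, φ.1.toHom.mapDart d = d'

end OrientedMap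

/-- The complete bipartite graph `K_{n,n}`. -/
abbrev KK (n : ℕ) : SimpleGraph (Fin n ⊕ Fin n) := completeBipartiteGraph (Fin n) (Fin n)

namespace OrientedMap

variable {n : ℕ}

/-- The group `Aut₀(M)` of those automorphisms of `M` that leave each of the two parts of the
bipartition of `K_{n,n}` invariant. -/
def Aut₀ (M : OrientedMap (KK n)) : Subgroup (KK n ≃g KK n) where
  carrier := {φ | φ ∈ M.Aut ∧ ∀ v, (φ v).isLeft = v.isLeft}
  one_mem' := ⟨M.Aut.one_mem, fun _ => rfl⟩
  mul_mem' := fun {φ ψ} h h' =>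
    ⟨M.Aut.mul_mem h.1 h'.1, fun v => (h.2 (ψ v)).trans (h'.2 v)⟩
  inv_mem' := fun {φ} h => ⟨M.Aut.inv_mem h.1, fun v => by
    have := h.2 (φ⁻¹ v)
    rw [show φ (φ⁻¹ v) = v from φ.apply_symm_apply v] at this
    exact this.symm⟩

/-- The map `M` corresponds to the triple `(G, a, b)` through its edge `uv`, where `d` is the dart
from `u` to `v`: some isomorphism `G ≃* Aut₀(M)` sends `a` and `b` to the automorphisms that rotate
this edge around `u` and around `v`, respectively, to the next edge. -/
def CorrespondsAt (M : OrientedMap (KK n)) (d : (KK n).Dart) {G : Type*} [Group G] (a b : G) :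
    Prop :=
  ∃ φ : G ≃* M.Aut₀,
    (φ a).1.toHom.mapDart d = M.rot d ∧ (φ b).1.toHom.mapDart d.symm = M.rot d.symm

end OrientedMap

/-! ### Automorphisms of maps on `K_{n,n}` -/

/-! The problem reduces to group theory. An automorphism of a map on `K_{n,n}` is determined by the
image of one dart (`IsIso.eq_of_dart`). Hence in a regular map the rotations `a`, `b` about the two
ends of an edge factorise `Aut₀`, and the automorphism reversing the edge transposes them
(`IsRegular.exists_triple`). Conversely, the cosets of `⟨a⟩` and `⟨b⟩`, with right multiplication as
rotation, realise every isobicyclic triple by a regular map (`exists_correspondsAt`). Map and triple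
determine each other (`CorrespondsAt.isomorphic`, `CorrespondsAt.exists_mulEquiv`), so it remains to
find the triples with `n = 2 ^ e` and `G` non-metacyclic.

In such a group the involutions of `⟨a⟩` and `⟨b⟩` are central (`pow_mem_center`). Dividing by them
halves `n`, and iterating gives the central series `N j = ⟨a ^ 2 ^ j⟩⟨b ^ 2 ^ j⟩`. If `⁅a, b⁆ ∈ N
2`, taking `2 ^ i`-th powers is almost multiplicative and roots can be extracted: a nontrivial `⁅a,
b⁆` of depth `j` equals `x ^ 2 ^ j` with `x ∉ N 1`. Then `⟨x⟩` contains all commutators and has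
cyclic quotient, so `G` is metacyclic (`IsIsobicyclicTriple.isMetacyclic`).

Otherwise the relations of some `G₂(e; k, l)` hold, by induction from `n = 4`
(`commute_or_satisfiesG2`). A quotient with `l = 1` does not lift, since the two central involutions
upstairs would coincide (`twist_eq_one`). With `l = 0`, `a ^ 2` and `b ^ 2` commute upstairs, and
comparing exponents modulo 2 forces `k = 0` downstairs as well. What stays free upstairs is exactly
two bits, the new `k` and `l`.

Conversely, the relations of `G₂(e; k, l)` give normal forms `a ^ i * b ^ j`, and a permutation
representation on pairs of exponents shows that these do not collapse (`G2.isIsobicyclicTriple`).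
Each group maps onto `G₂(2; 0, 0)`, which contains an elementary abelian subgroup of order 8 and so
is not metacyclic. As `z ≠ 1`, the relations determine `k` and `l`. -/

theorem KK.adj_iff {n : ℕ} (u v : Fin n ⊕ Fin n) : (KK n).Adj u v ↔ u.isLeft ≠ v.isLeft := by
  rcases u with u | u <;> rcases v with v | v <;> simp

theorem KK.exists_adj {n : ℕ} (u : Fin n ⊕ Fin n) : ∃ v, (KK n).Adj u v := by
  rcases u with u | u
  · exact ⟨Sum.inr u, by simp⟩
  · exact ⟨Sum.inl u, by simp⟩

theorem KK.dart_snd_isLeft {n : ℕ} (d : (KK n).Dart) : d.snd.isLeft = !d.fst.isLeft := by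
  have h := (KK.adj_iff _ _).1 d.adj
  revert h
  cases d.fst.isLeft <;> cases d.snd.isLeft <;> simp

/-- Adjacency means lying in different parts, so preservation of the part passes along edges; a
vertex in the part of `u` is reached through a common neighbour. -/
theorem KK.isLeft_of_isLeft {n : ℕ} (φ : KK n ≃g KK n) {u : Fin n ⊕ Fin n}
    (hu : (φ u).isLeft = u.isLeft) (v : Fin n ⊕ Fin n) : (φ v).isLeft = v.isLeft := by
  have key : ∀ x y, (KK n).Adj x y → (φ x).isLeft = x.isLeft → (φ y).isLeft = y.isLeft := by
    intro x y hxy hx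
    have h1 := (KK.adj_iff _ _).1 hxy
    have h2 := (KK.adj_iff _ _).1 (φ.map_adj_iff.2 hxy)
    revert h1 h2 hx
    cases (φ x).isLeft <;> cases (φ y).isLeft <;> cases x.isLeft <;> cases y.isLeft <;> simp
  by_cases huv : (KK n).Adj u v
  · exact key u v huv hu
  · obtain ⟨w, hw⟩ := KK.exists_adj u
    refine key w v ?_ (key u w hw hu)
    rw [KK.adj_iff] at *
    revert huv hw
    cases u.isLeft <;> cases v.isLeft <;> cases w.isLeft <;> simp

theorem KK.card_part {n : ℕ} (c : Bool) :
    Nat.card {w : Fin n ⊕ Fin n // w.isLeft = c} = n := by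
  cases c
  · rw [Nat.card_congr (β := Fin n) ⟨fun w => w.1.getRight (by simpa using w.2),
      fun i => ⟨Sum.inr i, rfl⟩, ?_, ?_⟩, Nat.card_fin]
    · rintro ⟨w | w, hw⟩
      · simp at hw
      · rfl
    · intro i; rfl
  · rw [Nat.card_congr (β := Fin n) ⟨fun w => w.1.getLeft w.2,
      fun i => ⟨Sum.inl i, rfl⟩, ?_, ?_⟩, Nat.card_fin]
    · rintro ⟨w | w, hw⟩
      · rfl
      · simp at hw
    · intro i; rfl

namespace OrientedMap

section General

variable {V : Type*} {K : SimpleGraph V}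

/-- The permutation of the darts induced by a graph automorphism. -/
def dartPerm : (K ≃g K) →* Equiv.Perm K.Dart where
  toFun φ := ⟨φ.toHom.mapDart, (φ⁻¹).toHom.mapDart, mapDart_inv' φ, mapDart_inv φ⟩
  map_one' := rfl
  map_mul' _ _ := rfl

theorem dartPerm_apply (φ : K ≃g K) (d : K.Dart) : dartPerm φ d = φ.toHom.mapDart d := rfl

@[simp] theorem dartPerm_fst (φ : K ≃g K) (d : K.Dart) : (dartPerm φ d).fst = φ d.fst := rfl

@[simp] theorem dartPerm_snd (φ : K ≃g K) (d : K.Dart) : (dartPerm φ d).snd = φ d.snd := rfl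

theorem dartPerm_symm (φ : K ≃g K) (d : K.Dart) : dartPerm φ d.symm = (dartPerm φ d).symm := rfl

theorem dart_ext {d d' : K.Dart} (h₁ : d.fst = d'.fst) (h₂ : d.snd = d'.snd) : d = d' := by
  ext
  · exact h₁
  · exact h₂

theorem IsIso.semiconjBy {M M' : OrientedMap K} {φ : K ≃g K} (h : M.IsIso M' φ) :
    SemiconjBy (dartPerm φ) M.rot M'.rot :=
  Equiv.ext h

theorem IsIso.apply_zpow {M M' : OrientedMap K} {φ : K ≃g K} (h : M.IsIso M' φ) (i : ℤ)
    (d : K.Dart) : dartPerm φ ((M.rot ^ i) d) = (M'.rot ^ i) (dartPerm φ d) :=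
  congrArg (fun p : Equiv.Perm K.Dart => p d) (h.semiconjBy.zpow_right i)

/-- The automorphism rotating a dart to the next one rotates it as often as it is applied. -/
theorem zpow_apply_eq {M : OrientedMap K} {a : K ≃g K} (ha : a ∈ M.Aut) {d : K.Dart}
    (had : dartPerm a d = M.rot d) (i : ℤ) : dartPerm (a ^ i) d = (M.rot ^ i) d := by
  have hc : Commute (dartPerm a) M.rot := IsIso.semiconjBy ha
  have h1 : ((M.rot)⁻¹ * dartPerm a) d = d := by simp [had]
  have h2 : ((M.rot)⁻¹ * dartPerm a) ^ i ∈ MulAction.stabilizer (Equiv.Perm (K.Dart)) d :=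
    Subgroup.zpow_mem _ h1 i
  rw [(hc.symm.inv_left).mul_zpow, MulAction.mem_stabilizer_iff, mul_smul, inv_zpow,
    inv_smul_eq_iff] at h2
  rw [map_zpow]
  exact h2

theorem fst_rot_zpow (M : OrientedMap K) (i : ℤ) (d : K.Dart) : ((M.rot ^ i) d).fst = d.fst := by
  induction i using Int.induction_on generalizing d with
  | zero => rfl
  | succ i ih => rw [zpow_add_one, Equiv.Perm.mul_apply, ih, M.fst_rot]
  | pred i ih =>
    rw [zpow_sub_one, Equiv.Perm.mul_apply, ih]
    have := M.fst_rot (M.rot⁻¹ d)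
    rw [← this]; simp

end General

variable {n : ℕ} {M M' : OrientedMap (KK n)}

/-- An isomorphism of maps on `K_{n,n}` is determined by the image of one dart. -/
theorem IsIso.eq_of_dart {φ ψ : KK n ≃g KK n} (hφ : M.IsIso M' φ) (hψ : M.IsIso M' ψ)
    {d : (KK n).Dart} (h : dartPerm φ d = dartPerm ψ d) : φ = ψ := by
  -- Agreement at one dart spreads around its initial vertex by the rotation. Applied to `d` and
  -- `d.symm` this covers all vertices, each being adjacent to one end of `d`.
  have key : ∀ d d' : (KK n).Dart, d.fst = d'.fst → dartPerm φ d = dartPerm ψ d →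
      dartPerm φ d' = dartPerm ψ d' := by
    intro d d' hd h
    obtain ⟨i, rfl⟩ := M.sameCycle d d' hd
    rw [hφ.apply_zpow, hψ.apply_zpow, h]
  have hs : dartPerm φ d.symm = dartPerm ψ d.symm := by
    rw [dartPerm_symm, dartPerm_symm, h]
  refine RelIso.ext fun w => ?_
  by_cases hw : (KK n).Adj d.fst w
  · exact congrArg (fun e : (KK n).Dart => e.snd) (key d ⟨(d.fst, w), hw⟩ rfl h)
  · have hw' : (KK n).Adj d.snd w := by
      have := KK.dart_snd_isLeft d
      rw [KK.adj_iff] at *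
      revert hw this
      cases d.fst.isLeft <;> cases w.isLeft <;> cases d.snd.isLeft <;> simp
    exact congrArg (fun e : (KK n).Dart => e.snd) (key d.symm ⟨(d.snd, w), hw'⟩ rfl hs)

/-- Uniqueness is automatic by `IsIso.eq_of_dart`, so only transitivity from a base dart has to be
checked. -/
theorem isRegular_of_transitive (d : (KK n).Dart)
    (h : ∀ d', ∃ φ ∈ M.Aut, dartPerm φ d = d') : M.IsRegular := by
  intro d₁ d₂
  obtain ⟨φ₁, h₁, rfl⟩ := h d₁
  obtain ⟨φ₂, h₂, rfl⟩ := h d₂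
  have hm : φ₂ * φ₁⁻¹ ∈ M.Aut := M.Aut.mul_mem h₂ (M.Aut.inv_mem h₁)
  have he : dartPerm (φ₂ * φ₁⁻¹) (dartPerm φ₁ d) = dartPerm φ₂ d := by
    rw [← Equiv.Perm.mul_apply, ← map_mul]; simp
  refine ⟨⟨_, hm⟩, he, fun χ hχ => Subtype.ext ?_⟩
  exact IsIso.eq_of_dart χ.2 hm (hχ.trans he.symm)

theorem IsRegular.exists_apply (hM : M.IsRegular) (d d' : (KK n).Dart) :
    ∃ φ ∈ M.Aut, dartPerm φ d = d' := by
  obtain ⟨φ, h, -⟩ := hM d d'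
  exact ⟨φ.1, φ.2, h⟩

theorem mem_Aut₀_of_isLeft {φ : KK n ≃g KK n} (hφ : φ ∈ M.Aut) {u : Fin n ⊕ Fin n}
    (hu : (φ u).isLeft = u.isLeft) : φ ∈ M.Aut₀ :=
  ⟨hφ, KK.isLeft_of_isLeft φ hu⟩

/-- The automorphisms fixing the initial vertex of a dart are the powers of the one rotating it. -/
theorem exists_zpow_eq {a : KK n ≃g KK n} (ha : a ∈ M.Aut) {d : (KK n).Dart}
    (had : dartPerm a d = M.rot d) {g : KK n ≃g KK n} (hg : g ∈ M.Aut) (hgd : g d.fst = d.fst) :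
    ∃ i : ℤ, a ^ i = g := by
  obtain ⟨i, hi⟩ := M.sameCycle d (dartPerm g d) hgd.symm
  refine ⟨i, IsIso.eq_of_dart (M.Aut.zpow_mem ha i) hg (d := d) ?_⟩
  rw [zpow_apply_eq ha had, hi]

theorem zpow_fst {a : KK n ≃g KK n} (ha : a ∈ M.Aut) {d : (KK n).Dart}
    (had : dartPerm a d = M.rot d) (i : ℤ) : (a ^ i) d.fst = d.fst := by
  have := congrArg (fun e : (KK n).Dart => e.fst) (zpow_apply_eq ha had i)
  exact this.trans (M.fst_rot_zpow i d)

/-- The powers of `a` correspond to the neighbours of the fixed vertex, through the image of the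
other end of the dart; there are `n` of these. -/
theorem orderOf_eq {a : KK n ≃g KK n} (ha : a ∈ M.Aut) {d : (KK n).Dart}
    (had : dartPerm a d = M.rot d) : orderOf a = n := by
  rw [← Nat.card_zpowers]
  refine Eq.trans ?_ (KK.card_part (n := n) d.snd.isLeft)
  have hl : ∀ g : Subgroup.zpowers a, (g.1 d.fst) = d.fst := by
    rintro ⟨_, i, rfl⟩
    exact zpow_fst ha had i
  refine Nat.card_congr (Equiv.ofBijective
    (fun g => ⟨g.1 d.snd, KK.isLeft_of_isLeft g.1 (u := d.fst) (by rw [hl g]) _⟩) ⟨?_, ?_⟩)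
  · intro g h hgh
    have hmem : ∀ g : Subgroup.zpowers a, g.1 ∈ M.Aut := fun g =>
      (Subgroup.zpowers_le.2 ha) g.2
    refine Subtype.ext (IsIso.eq_of_dart (hmem g) (hmem h) (d := d) (dart_ext ?_ ?_))
    · simp [hl]
    · exact congrArg Subtype.val hgh
  · rintro ⟨w, hw⟩
    have hadj : (KK n).Adj d.fst w := by
      rw [KK.adj_iff, hw, ← KK.adj_iff]; exact d.adj
    obtain ⟨i, hi⟩ := M.sameCycle d ⟨(d.fst, w), hadj⟩ rfl
    refine ⟨⟨a ^ i, i, rfl⟩, Subtype.ext ?_⟩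
    have := congrArg (fun e : (KK n).Dart => e.snd) ((zpow_apply_eq ha had i).trans hi)
    exact this

/-- The automorphisms rotating an edge of a regular map around its two ends form an isobicyclic
triple. -/
theorem IsRegular.exists_triple (hM : M.IsRegular) (d : (KK n).Dart) :
    ∃ a b : M.Aut₀, IsIsobicyclicTriple n a b ∧ M.CorrespondsAt d a b := by
  obtain ⟨a, ha, had⟩ := hM.exists_apply d (M.rot d)
  obtain ⟨b, hb, hbd⟩ := hM.exists_apply d.symm (M.rot d.symm)
  -- Conjugation by the edge reversal `ρ` supplies the automorphism transposing the two rotations.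
  obtain ⟨ρ, hρ, hρd⟩ := hM.exists_apply d d.symm
  have hau : a d.fst = d.fst := by simpa using zpow_fst ha had 1
  have hbv : b d.snd = d.snd := by simpa using zpow_fst hb hbd 1
  have ha0 : a ∈ M.Aut₀ := mem_Aut₀_of_isLeft ha (by rw [hau])
  have hb0 : b ∈ M.Aut₀ := mem_Aut₀_of_isLeft hb (by rw [hbv])
  have hρd' : dartPerm ρ d.symm = d := by rw [dartPerm_symm, hρd, SimpleGraph.Dart.symm_symm]
  have hconj : ∀ x ∈ M.Aut, ρ * x * ρ⁻¹ ∈ M.Aut := fun x hx =>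
    M.Aut.mul_mem (M.Aut.mul_mem hρ hx) (M.Aut.inv_mem hρ)
  have hρi : dartPerm ρ⁻¹ d.symm = d := by
    rw [map_inv, Equiv.Perm.inv_eq_iff_eq, hρd]
  have hρi' : dartPerm ρ⁻¹ d = d.symm := by
    rw [map_inv, Equiv.Perm.inv_eq_iff_eq, hρd']
  have hab : ρ * a * ρ⁻¹ = b := by
    refine IsIso.eq_of_dart (hconj a ha) hb (d := d.symm) ?_
    rw [map_mul, map_mul, Equiv.Perm.mul_apply, Equiv.Perm.mul_apply, hρi, had, hbd, ← hρd]
    exact hρ d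
  have hba : ρ * b * ρ⁻¹ = a := by
    refine IsIso.eq_of_dart (hconj b hb) ha (d := d) ?_
    rw [map_mul, map_mul, Equiv.Perm.mul_apply, Equiv.Perm.mul_apply, hρi', hbd, had]
    refine (hρ d.symm).trans ?_
    rw [← dartPerm_apply, hρd']
  have hnorm : ∀ x ∈ M.Aut₀, ρ * x * ρ⁻¹ ∈ M.Aut₀ := by
    intro x hx
    refine ⟨hconj x hx.1, fun v => ?_⟩
    have h1 := hx.2 (ρ⁻¹ v)
    have key : ∀ y z : Fin n ⊕ Fin n, y.isLeft = z.isLeft → (ρ y).isLeft = (ρ z).isLeft := by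
      intro y z hyz
      by_contra h
      rw [← ne_eq, ← KK.adj_iff, ρ.map_adj_iff, KK.adj_iff] at h
      exact h hyz
    have h2 := key _ _ h1
    rw [show ρ (ρ⁻¹ v) = v from ρ.apply_symm_apply v] at h2
    exact h2
  have hnorm' : ∀ x ∈ M.Aut₀, ρ⁻¹ * x * ρ ∈ M.Aut₀ := by
    have h1 : ρ * ρ ∈ M.Aut₀ := by
      have : ρ * ρ = 1 := IsIso.eq_of_dart (M.Aut.mul_mem hρ hρ) M.Aut.one_mem (d := d) (by
        rw [map_mul, Equiv.Perm.mul_apply, hρd, hρd']; rfl)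
      rw [this]; exact M.Aut₀.one_mem
    intro x hx
    have := M.Aut₀.mul_mem (M.Aut₀.mul_mem (M.Aut₀.inv_mem h1) (hnorm x hx)) h1
    convert this using 1
    group
  refine ⟨⟨a, ha0⟩, ⟨b, hb0⟩, ⟨?_, ?_, ?_, ?_, ?_⟩, MulEquiv.refl _, had, hbd⟩
  · rw [Subgroup.orderOf_mk]; exact orderOf_eq ha had
  · rw [Subgroup.orderOf_mk]; exact orderOf_eq hb hbd
  · rintro ⟨g, hg⟩
    have hg' := M.Aut₀.inv_mem hg
    have hadj : (KK n).Adj d.snd (g⁻¹ d.fst) := by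
      rw [KK.adj_iff, hg'.2, ← KK.adj_iff]; exact d.adj.symm
    -- Some power of `b` moves `u` to `g⁻¹ u`; then `g * b ^ j` fixes `u` and is a power of `a`.
    obtain ⟨j, hj⟩ := M.sameCycle d.symm ⟨(d.snd, g⁻¹ d.fst), hadj⟩ rfl
    have hj' : (b ^ j) d.fst = g⁻¹ d.fst :=
      congrArg (fun e : (KK n).Dart => e.snd) ((zpow_apply_eq hb hbd j).trans hj)
    obtain ⟨i, hi⟩ := exists_zpow_eq ha had (M.Aut.mul_mem hg.1 (M.Aut.zpow_mem hb j)) (by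
      change g ((b ^ j) d.fst) = d.fst
      rw [hj']; exact g.apply_symm_apply _)
    refine ⟨_, ⟨i, rfl⟩, _, ⟨-j, rfl⟩, Subtype.ext ?_⟩
    change g = a ^ i * b ^ (-j)
    rw [hi]; group
  · rw [eq_bot_iff]
    rintro _ ⟨⟨i, rfl⟩, ⟨j, hj⟩⟩
    have hj' : b ^ j = a ^ i := congrArg Subtype.val hj
    refine Subtype.ext (IsIso.eq_of_dart (M.Aut.zpow_mem ha i) M.Aut.one_mem (d := d)
      (dart_ext ?_ ?_))
    · exact zpow_fst ha had i
    · exact (congrArg (fun f : KK n ≃g KK n => f d.snd) hj').symm.trans (zpow_fst hb hbd j)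
  · let α : M.Aut₀ ≃* M.Aut₀ :=
      { toFun := fun x => ⟨ρ * x.1 * ρ⁻¹, hnorm x.1 x.2⟩
        invFun := fun x => ⟨ρ⁻¹ * x.1 * ρ, hnorm' x.1 x.2⟩
        left_inv := fun x => Subtype.ext (by simp [mul_assoc])
        right_inv := fun x => Subtype.ext (by simp [mul_assoc])
        map_mul' := fun x y => Subtype.ext (by simp [mul_assoc]) }
    exact ⟨α, Subtype.ext hab, Subtype.ext hba⟩

/-- Since `ψ` may interchange the parts, the argument uses only that lying in the same part means
being non-adjacent, which `ψ` respects. -/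
theorem IsIso.conj_mem_Aut₀ {ψ : KK n ≃g KK n} (hψ : M.IsIso M' ψ) {φ : KK n ≃g KK n}
    (hφ : φ ∈ M.Aut₀) : ψ * φ * ψ⁻¹ ∈ M'.Aut₀ := by
  refine ⟨(hψ.mul hφ.1).mul hψ.inv, fun v => ?_⟩
  have h1 := hφ.2 (ψ⁻¹ v)
  by_contra h
  rw [← ne_eq, ← KK.adj_iff] at h
  have h2 : (KK n).Adj (ψ (φ (ψ⁻¹ v))) (ψ (ψ⁻¹ v)) := by
    rw [show ψ (ψ⁻¹ v) = v from ψ.apply_symm_apply v]; exact h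
  rw [ψ.map_adj_iff, KK.adj_iff] at h2
  exact h2 h1

/-- An isomorphism of maps transports the correspondence with a triple. -/
theorem CorrespondsAt.of_isIso {G : Type*} [Group G] {a b : G} {d : (KK n).Dart}
    {ψ : KK n ≃g KK n} (hψ : M.IsIso M' ψ) (h : M.CorrespondsAt d a b) :
    M'.CorrespondsAt (dartPerm ψ d) a b := by
  obtain ⟨φ, h₁, h₂⟩ := h
  let α : M.Aut₀ ≃* M'.Aut₀ :=
    { toFun := fun x => ⟨ψ * x.1 * ψ⁻¹, hψ.conj_mem_Aut₀ x.2⟩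
      invFun := fun x => ⟨ψ⁻¹ * x.1 * ψ, by simpa using hψ.inv.conj_mem_Aut₀ x.2⟩
      left_inv := fun x => Subtype.ext (by simp [mul_assoc])
      right_inv := fun x => Subtype.ext (by simp [mul_assoc])
      map_mul' := fun x y => Subtype.ext (by simp [mul_assoc]) }
  have key : ∀ (x : M.Aut₀) (d : (KK n).Dart), dartPerm x.1 d = M.rot d →
      dartPerm (α x).1 (dartPerm ψ d) = M'.rot (dartPerm ψ d) := by
    intro x d hx
    change dartPerm (ψ * x.1 * ψ⁻¹) (dartPerm ψ d) = _
    rw [← Equiv.Perm.mul_apply, ← map_mul, inv_mul_cancel_right, map_mul, Equiv.Perm.mul_apply, hx]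
    exact hψ d
  exact ⟨φ.trans α, key _ _ h₁, key _ d.symm h₂⟩

theorem CorrespondsAt.all_darts (hM : M.IsRegular) {G : Type*} [Group G] {a b : G}
    {d : (KK n).Dart} (h : M.CorrespondsAt d a b) (d' : (KK n).Dart) :
    M.CorrespondsAt d' a b := by
  obtain ⟨ψ, hψ, rfl⟩ := hM.exists_apply d d'
  exact h.of_isIso hψ

end OrientedMap

/-! ### Maps on `K_{n,n}` from isobicyclic triples -/

namespace OrientedMap

/-- A labelling of the vertices of `K_{n,n}` by the cosets of `⟨a⟩` (the pairs `(g, true)`) and of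
`⟨b⟩` (the pairs `(g, false)`) in a group `G`. -/
structure Labelling {n : ℕ} {G : Type*} [Group G] (a b : G) (F : G × Bool → Fin n ⊕ Fin n) :
    Prop where
  surj : Function.Surjective F
  eq_iff : ∀ p q, F p = F q ↔
    p.2 = q.2 ∧ p.1⁻¹ * q.1 ∈ Subgroup.zpowers (bif p.2 then a else b)
  adj_iff : ∀ p q, (KK n).Adj (F p) (F q) ↔ p.2 ≠ q.2

namespace Labelling

variable {n : ℕ} {G : Type*} [Group G] {a b : G} {F F' : G × Bool → Fin n ⊕ Fin n}

/-- The dart labelled by `(g, c)`, from the vertex `(g, c)` to the vertex `(g, !c)`. -/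
def dart (hF : Labelling a b F) (p : G × Bool) : (KK n).Dart :=
  ⟨(F p, F (p.1, !p.2)), (hF.adj_iff _ _).2 (by simp)⟩

/-- `M` is the map whose rotation is multiplication by `a` or `b` on the labels of the darts. -/
def IsMap (hF : Labelling a b F) (M : OrientedMap (KK n)) : Prop :=
  ∀ p, M.rot (hF.dart p) = hF.dart (p.1 * (bif p.2 then a else b), p.2)

theorem dart_symm (hF : Labelling a b F) (p : G × Bool) :
    (hF.dart p).symm = hF.dart (p.1, !p.2) := by
  refine dart_ext rfl ?_
  change F p = F (p.1, !!p.2)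
  rw [Bool.not_not]

/-- The factorisation `G = ⟨a⟩⟨b⟩` says that every coset of `⟨a⟩` meets every coset of `⟨b⟩`; a
common element labels the dart. -/
theorem dart_surjective (hF : Labelling a b F) (h : IsIsobicyclicTriple n a b) :
    Function.Surjective hF.dart := by
  have key : ∀ g g' : G, ∃ k, F (k, true) = F (g, true) ∧ F (k, false) = F (g', false) := by
    intro g g'
    obtain ⟨x, hx, y, hy, hxy⟩ := h.factorises (g⁻¹ * g')
    refine ⟨g * x, (hF.eq_iff _ _).2 ⟨rfl, ?_⟩, (hF.eq_iff _ _).2 ⟨rfl, ?_⟩⟩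
    · simpa using hx
    · have : (g * x)⁻¹ * g' = y := by
        rw [mul_inv_rev, mul_assoc, hxy]; group
      change (g * x)⁻¹ * g' ∈ Subgroup.zpowers b
      rwa [this]
  intro d
  obtain ⟨⟨g, x⟩, hp⟩ := hF.surj d.fst
  obtain ⟨⟨g', y⟩, hq⟩ := hF.surj d.snd
  have hxy : x ≠ y := by
    have := d.adj
    rw [← hp, ← hq, hF.adj_iff] at this
    exact this
  cases x <;> cases y <;> simp at hxy
  · obtain ⟨k, h1, h2⟩ := key g' g
    exact ⟨(k, false), dart_ext (h2.trans hp) (h1.trans hq)⟩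
  · obtain ⟨k, h1, h2⟩ := key g g'
    exact ⟨(k, true), dart_ext (h1.trans hp) (h2.trans hq)⟩

/-- Two labels of one dart differ by an element of `⟨a⟩ ∩ ⟨b⟩ = 1`. -/
theorem dart_injective (hF : Labelling a b F) (h : IsIsobicyclicTriple n a b) :
    Function.Injective hF.dart := by
  rintro ⟨g, x⟩ ⟨g', y⟩ hpq
  have h1 := (hF.eq_iff _ _).1 (congrArg (fun d : (KK n).Dart => d.fst) hpq)
  have h2 := (hF.eq_iff _ _).1 (congrArg (fun d : (KK n).Dart => d.snd) hpq)
  obtain ⟨rfl, h1⟩ := h1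
  have h3 : g⁻¹ * g' ∈ Subgroup.zpowers a ⊓ Subgroup.zpowers b := by
    cases x
    · exact ⟨h2.2, h1⟩
    · exact ⟨h1, h2.2⟩
  rw [h.disjoint, Subgroup.mem_bot, inv_mul_eq_one] at h3
  rw [h3]

/-- Two labellings by the same triple differ by an automorphism of `K_{n,n}`. -/
theorem exists_iso (hF : Labelling a b F) (hF' : Labelling a b F') :
    ∃ ψ : KK n ≃g KK n, ∀ p, ψ (F p) = F' p := by
  have key : ∀ p q, F p = F q ↔ F' p = F' q := fun p q => by rw [hF.eq_iff, hF'.eq_iff]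
  let s := Function.surjInv hF.surj
  let s' := Function.surjInv hF'.surj
  have hs : ∀ v, F (s v) = v := Function.surjInv_eq hF.surj
  have hs' : ∀ v, F' (s' v) = v := Function.surjInv_eq hF'.surj
  let e : Fin n ⊕ Fin n ≃ Fin n ⊕ Fin n :=
    { toFun := fun v => F' (s v)
      invFun := fun v => F (s' v)
      left_inv := fun v => by
        refine Eq.trans ?_ (hs v)
        rw [key, hs']
      right_inv := fun v => by
        refine Eq.trans ?_ (hs' v)
        rw [← key, hs] }
  have he : ∀ p, e (F p) = F' p := fun p => (key _ _).1 (hs _)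
  refine ⟨⟨e, ?_⟩, he⟩
  intro v w
  obtain ⟨p, rfl⟩ := hF.surj v
  obtain ⟨q, rfl⟩ := hF.surj w
  rw [he, he, hF.adj_iff, hF'.adj_iff]

theorem dartPerm_dart {hF : Labelling a b F} {hF' : Labelling a b F'} {ψ : KK n ≃g KK n}
    (hψ : ∀ p, ψ (F p) = F' p) (p : G × Bool) : dartPerm ψ (hF.dart p) = hF'.dart p :=
  dart_ext (hψ _) (hψ _)

theorem isIso (h : IsIsobicyclicTriple n a b) {hF : Labelling a b F} {hF' : Labelling a b F'}
    {M M' : OrientedMap (KK n)} (hM : hF.IsMap M) (hM' : hF'.IsMap M') {ψ : KK n ≃g KK n}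
    (hψ : ∀ p, ψ (F p) = F' p) : M.IsIso M' ψ := by
  intro d
  obtain ⟨p, rfl⟩ := hF.dart_surjective h d
  rw [← dartPerm_apply, ← dartPerm_apply, hM, dartPerm_dart (hF' := hF') hψ,
    dartPerm_dart (hF' := hF') hψ, hM']

/-- Left translation of a labelling. -/
theorem translate (hF : Labelling a b F) (g : G) :
    Labelling a b (fun p => F (g * p.1, p.2)) where
  surj v := by
    obtain ⟨p, rfl⟩ := hF.surj v
    exact ⟨(g⁻¹ * p.1, p.2), by simp⟩
  eq_iff p q := by rw [hF.eq_iff]; simp [mul_assoc]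
  adj_iff p q := hF.adj_iff _ _

theorem translate_isMap (hF : Labelling a b F) (g : G) {M : OrientedMap (KK n)}
    (hM : hF.IsMap M) : (hF.translate g).IsMap M := fun p => by
  refine (hM (g * p.1, p.2)).trans ?_
  simp only [mul_assoc]
  rfl

/-- Twisting a labelling by an automorphism that transposes `a` and `b`. -/
theorem twist (hF : Labelling a b F) {α : G ≃* G} (ha : α a = b) (hb : α b = a) :
    Labelling a b (fun p => F (α p.1, !p.2)) where
  surj v := by
    obtain ⟨p, rfl⟩ := hF.surj v
    exact ⟨(α.symm p.1, !p.2), by simp⟩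
  eq_iff := by
    rintro ⟨g, x⟩ ⟨h, y⟩
    rw [hF.eq_iff]
    refine and_congr (by simp) ?_
    have h1 : ∀ c, α g⁻¹ * α h ∈ Subgroup.zpowers (α c) ↔ g⁻¹ * h ∈ Subgroup.zpowers c := by
      intro c
      rw [← map_mul, ← MulEquiv.coe_toMonoidHom, ← MonoidHom.map_zpowers,
        Subgroup.mem_map_iff_mem α.injective]
    cases x
    · have := h1 b
      rw [hb] at this
      simpa using this
    · have := h1 a
      rw [ha] at this
      simpa using this
  adj_iff p q := by rw [hF.adj_iff]; simp

theorem twist_isMap (hF : Labelling a b F) {α : G ≃* G} (ha : α a = b) (hb : α b = a)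
    {M : OrientedMap (KK n)} (hM : hF.IsMap M) : (hF.twist ha hb).IsMap M := by
  rintro ⟨g, x⟩
  refine (hM (α g, !x)).trans ?_
  refine dart_ext ?_ ?_ <;> cases x <;> simp [dart, ha, hb]

/-- The vertices of `K_{n,n}` can be labelled by any isobicyclic triple. -/
theorem exists_labelling (hn : n ≠ 0) (h : IsIsobicyclicTriple n a b) :
    ∃ F : G × Bool → Fin n ⊕ Fin n, Labelling a b F := by
  -- The powers of `y` form a transversal for the cosets of `⟨x⟩`, so there are `n` cosets.
  have key : ∀ x y : G, orderOf y = n → (∀ g : G, ∃ s ∈ Subgroup.zpowers y,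
      ∃ t ∈ Subgroup.zpowers x, g = s * t) → Subgroup.zpowers x ⊓ Subgroup.zpowers y = ⊥ →
      Nonempty (G ⧸ Subgroup.zpowers x ≃ Fin n) := by
    intro x y hy hf hd
    have hcard : Nat.card (G ⧸ Subgroup.zpowers x) = n := by
      rw [← hy, ← Nat.card_zpowers]
      refine (Nat.card_congr (Equiv.ofBijective
        (fun s : Subgroup.zpowers y => (QuotientGroup.mk s.1 : G ⧸ Subgroup.zpowers x))
        ⟨?_, ?_⟩)).symm
      · intro s t hst
        have h1 : s.1⁻¹ * t.1 ∈ Subgroup.zpowers x ⊓ Subgroup.zpowers y :=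
          ⟨QuotientGroup.eq.1 hst, Subgroup.mul_mem _ (Subgroup.inv_mem _ s.2) t.2⟩
        rw [hd, Subgroup.mem_bot, inv_mul_eq_one] at h1
        exact Subtype.ext h1
      · intro q
        obtain ⟨g, rfl⟩ := QuotientGroup.mk_surjective q
        obtain ⟨s, hs, t, ht, rfl⟩ := hf g
        refine ⟨⟨s, hs⟩, QuotientGroup.eq.2 ?_⟩
        simpa using ht
    have : Finite (G ⧸ Subgroup.zpowers x) := Nat.finite_of_card_ne_zero (by rwa [hcard])
    exact ⟨Finite.equivFinOfCardEq hcard⟩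
  obtain ⟨L⟩ := key a b h.orderOf_right (fun g => by
    obtain ⟨x, hx, y, hy, hxy⟩ := h.factorises g⁻¹
    exact ⟨y⁻¹, Subgroup.inv_mem _ hy, x⁻¹, Subgroup.inv_mem _ hx, by
      rw [← mul_inv_rev, ← hxy, inv_inv]⟩) h.disjoint
  obtain ⟨R⟩ := key b a h.orderOf_left h.factorises (by rw [inf_comm]; exact h.disjoint)
  refine ⟨fun p => if p.2 then Sum.inl (L (QuotientGroup.mk p.1))
    else Sum.inr (R (QuotientGroup.mk p.1)), ?_, ?_, ?_⟩
  · rintro (i | i)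
    · obtain ⟨g, hg⟩ := QuotientGroup.mk_surjective (L.symm i)
      exact ⟨(g, true), by simp [hg]⟩
    · obtain ⟨g, hg⟩ := QuotientGroup.mk_surjective (R.symm i)
      exact ⟨(g, false), by simp [hg]⟩
  · rintro ⟨g, _ | _⟩ ⟨g', _ | _⟩ <;> simp [QuotientGroup.eq]
  · rintro ⟨g, _ | _⟩ ⟨g', _ | _⟩ <;> simp

/-- Right multiplication by `a` or `b` is carried from labels to darts. Its cycles are the cosets of
`⟨a⟩` and `⟨b⟩`, and these are the vertices. -/
theorem exists_isMap (h : IsIsobicyclicTriple n a b) (hF : Labelling a b F) :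
    ∃ M : OrientedMap (KK n), hF.IsMap M := by
  let r : Equiv.Perm (G × Bool) :=
    { toFun := fun p => (p.1 * (bif p.2 then a else b), p.2)
      invFun := fun p => (p.1 * (bif p.2 then a else b)⁻¹, p.2)
      left_inv := fun p => by simp
      right_inv := fun p => by simp }
  let E : G × Bool ≃ (KK n).Dart :=
    Equiv.ofBijective hF.dart ⟨hF.dart_injective h, hF.dart_surjective h⟩
  have hr : ∀ (i : ℤ) (p : G × Bool), (r ^ i) p = (p.1 * (bif p.2 then a else b) ^ i, p.2) := by
    intro i
    induction i using Int.induction_on with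
    | zero => intro p; simp
    | succ i ih =>
      intro p
      have h1 : r p = (p.1 * (bif p.2 then a else b), p.2) := rfl
      rw [zpow_add_one, Equiv.Perm.mul_apply, h1, ih, add_comm, zpow_add, zpow_one, mul_assoc]
    | pred i ih =>
      intro p
      have h1 : r⁻¹ p = (p.1 * (bif p.2 then a else b)⁻¹, p.2) := rfl
      rw [zpow_sub_one, Equiv.Perm.mul_apply, h1, ih, sub_eq_neg_add, zpow_add, zpow_neg_one,
        mul_assoc]
  have hE : ∀ p, E p = hF.dart p := fun _ => rfl
  refine ⟨⟨(E.symm.trans r).trans E, ?_, ?_⟩, ?_⟩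
  · intro d
    obtain ⟨p, rfl⟩ := E.surjective d
    rw [Equiv.trans_apply, Equiv.trans_apply, Equiv.symm_apply_apply, hE, hE]
    refine (hF.eq_iff _ _).2 ⟨rfl, ?_⟩
    refine (Subgroup.inv_mem_iff _).1 ?_
    simp [r]
  · intro d d' hd
    obtain ⟨p, rfl⟩ := E.surjective d
    obtain ⟨q, rfl⟩ := E.surjective d'
    obtain ⟨h1, i, hi⟩ := (hF.eq_iff _ _).1 hd
    refine ⟨i, ?_⟩
    have hc : (E.symm.trans r).trans E = E.permCongr r := rfl
    rw [hc, ← Equiv.permCongrHom_coe, ← map_zpow, Equiv.permCongrHom_coe, Equiv.permCongr_apply,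
      Equiv.symm_apply_apply, hr]
    congr 1
    refine Prod.ext ?_ h1
    simp only at hi
    rw [hi]; simp
  · intro p
    change E (r (E.symm (E p))) = _
    rw [Equiv.symm_apply_apply]
    rfl

/-- Left translations commute with the rotation and carry the base dart to every dart labelled `(g,
true)`; combined with the automorphism transposing `a` and `b` they reach the labels `(g, false)`.
-/
theorem isRegular (h : IsIsobicyclicTriple n a b) {hF : Labelling a b F}
    {M : OrientedMap (KK n)} (hM : hF.IsMap M) : M.IsRegular := by
  refine isRegular_of_transitive (hF.dart (1, true)) fun d => ?_
  obtain ⟨⟨g, x⟩, rfl⟩ := hF.dart_surjective h d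
  cases x
  · obtain ⟨α, ha, hb⟩ := h.transposes
    have hL := (hF.translate g).twist ha hb
    obtain ⟨ψ, hψ⟩ := hF.exists_iso hL
    refine ⟨ψ, isIso h (hF' := hL) hM
      (twist_isMap (hF.translate g) ha hb (hF.translate_isMap g hM)) hψ, ?_⟩
    rw [dartPerm_dart (hF' := hL) hψ]
    refine dart_ext ?_ ?_ <;> simp [dart]
  · obtain ⟨ψ, hψ⟩ := hF.exists_iso (hF.translate g)
    refine ⟨ψ, isIso h (hF' := hF.translate g) hM (hF.translate_isMap g hM) hψ, ?_⟩
    rw [dartPerm_dart (hF' := hF.translate g) hψ]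
    refine dart_ext ?_ ?_ <;> simp [dart]

/-- The isomorphism is the action of `G` by left translation. It is onto because an automorphism in
`Aut₀` sends the base dart to some dart `(g, true)`, and one dart determines it. -/
theorem correspondsAt (h : IsIsobicyclicTriple n a b) {hF : Labelling a b F}
    {M : OrientedMap (KK n)} (hM : hF.IsMap M) : M.CorrespondsAt (hF.dart (1, true)) a b := by
  choose ψ hψ using fun g => hF.exists_iso (hF.translate g)
  have hiso : ∀ g, ψ g ∈ M.Aut := fun g =>
    isIso h (hF' := hF.translate g) hM (hF.translate_isMap g hM) (hψ g)
  have hmem : ∀ g, ψ g ∈ M.Aut₀ := fun g => by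
    refine mem_Aut₀_of_isLeft (hiso g) (u := F (1, true)) ?_
    by_contra hne
    rw [← ne_eq, ← KK.adj_iff, hψ, hF.adj_iff] at hne
    exact hne rfl
  have hdart : ∀ g p, dartPerm (ψ g) (hF.dart p) = hF.dart (g * p.1, p.2) := fun g p =>
    dartPerm_dart (hF' := hF.translate g) (hψ g) p
  let f : G →* M.Aut₀ := MonoidHom.mk' (fun g => ⟨ψ g, hmem g⟩) fun g g' => Subtype.ext (by
    refine RelIso.ext fun v => ?_
    obtain ⟨p, rfl⟩ := hF.surj v
    change ψ _ (F p) = ψ g (ψ g' (F p))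
    simp only [hψ, mul_assoc])
  have hinj : Function.Injective f := by
    intro g g' hgg'
    have h1 : ψ g = ψ g' := congrArg Subtype.val hgg'
    have h2 := hdart g (1, true)
    rw [h1, hdart] at h2
    have h3 := hF.dart_injective h h2
    simpa using h3.symm
  have hsurj : Function.Surjective f := by
    rintro ⟨χ, hχ⟩
    obtain ⟨⟨g, x⟩, hg⟩ := hF.dart_surjective h (dartPerm χ (hF.dart (1, true)))
    have hx : x = true := by
      have h1 := hχ.2 (F (1, true))
      have h2 : F (g, x) = χ (F (1, true)) := congrArg (fun d : (KK n).Dart => d.fst) hg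
      rw [← h2] at h1
      by_contra hx
      have h3 := (hF.adj_iff (g, x) (1, true)).2 hx
      rw [KK.adj_iff] at h3
      exact h3 h1
    subst hx
    refine ⟨g, Subtype.ext (IsIso.eq_of_dart (hiso g) hχ.1 (d := hF.dart (1, true)) ?_)⟩
    refine (hdart g (1, true)).trans ?_
    rw [← hg, mul_one]
  refine ⟨MulEquiv.ofBijective f ⟨hinj, hsurj⟩, ?_, ?_⟩
  · refine (hdart a (1, true)).trans ?_
    rw [hM]; simp
  · rw [dart_symm]
    refine (hdart b (1, false)).trans ?_
    rw [hM]; simp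

end Labelling

/-! ### Regular maps and isobicyclic triples determine each other. -/

variable {n : ℕ}

/-- The regular map of an isobicyclic triple. -/
theorem exists_correspondsAt (hn : n ≠ 0) {G : Type*} [Group G] {a b : G}
    (h : IsIsobicyclicTriple n a b) :
    ∃ M : OrientedMap (KK n), M.IsRegular ∧ ∃ d, M.CorrespondsAt d a b := by
  obtain ⟨F, hF⟩ := Labelling.exists_labelling hn h
  obtain ⟨M, hM⟩ := Labelling.exists_isMap h hF
  exact ⟨M, Labelling.isRegular h hM, _, Labelling.correspondsAt h hM⟩

/-- The label `(g, c)` is the image under `g` of one end of `d`. The cosets appear because the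
stabilisers in `Aut₀` of the two ends are `⟨a⟩` and `⟨b⟩`. -/
theorem CorrespondsAt.exists_labelling {M : OrientedMap (KK n)} (hM : M.IsRegular)
    {G : Type*} [Group G] {a b : G} {d : (KK n).Dart} (h : M.CorrespondsAt d a b) :
    ∃ (F : G × Bool → Fin n ⊕ Fin n) (hF : Labelling a b F), hF.IsMap M := by
  obtain ⟨φ, h₁, h₂⟩ := h
  let F : G × Bool → Fin n ⊕ Fin n := fun p => (φ p.1).1 (bif p.2 then d.fst else d.snd)
  have hleft : ∀ p, (F p).isLeft = bif p.2 then d.fst.isLeft else !d.fst.isLeft := by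
    rintro ⟨g, x⟩
    rw [(φ g).2.2]
    cases x
    · exact KK.dart_snd_isLeft d
    · rfl
  have hadj : ∀ p q, (KK n).Adj (F p) (F q) ↔ p.2 ≠ q.2 := by
    rintro ⟨g, x⟩ ⟨g', y⟩
    rw [KK.adj_iff, hleft, hleft]
    cases x <;> cases y <;> cases d.fst.isLeft <;> simp
  have hmem : ∀ (e : (KK n).Dart) (c : G), dartPerm (φ c).1 e = M.rot e → ∀ g g' : G,
      (φ g).1 e.fst = (φ g').1 e.fst ↔ g⁻¹ * g' ∈ Subgroup.zpowers c := by
    intro e c hc g g'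
    have h3 : (φ g).1 e.fst = (φ g').1 e.fst ↔ (φ (g⁻¹ * g')).1 e.fst = e.fst := by
      rw [map_mul, map_inv]
      change _ ↔ (φ g).1.symm ((φ g').1 e.fst) = e.fst
      rw [RelIso.symm_apply_eq, eq_comm]
    rw [h3]
    constructor
    · intro h4
      obtain ⟨i, hi⟩ := exists_zpow_eq (φ c).2.1 hc (φ (g⁻¹ * g')).2.1 h4
      refine ⟨i, φ.injective (Subtype.ext ?_)⟩
      simp only [map_zpow]
      exact hi
    · rintro ⟨i, hi⟩
      simp only at hi
      rw [← hi, map_zpow]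
      exact zpow_fst (φ c).2.1 hc i
  have heq : ∀ p q, F p = F q ↔
      p.2 = q.2 ∧ p.1⁻¹ * q.1 ∈ Subgroup.zpowers (bif p.2 then a else b) := by
    intro p q
    by_cases hpq : p.2 = q.2
    · obtain ⟨g, x⟩ := p
      obtain ⟨g', y⟩ := q
      simp only at hpq
      subst hpq
      cases x
      · simpa [F] using hmem d.symm b h₂ g g'
      · simpa [F] using hmem d a h₁ g g'
    · refine iff_of_false (fun h => ?_) fun h => hpq h.1
      have := (hadj p q).2 hpq
      rw [h] at this
      exact this.ne rfl
  have hdart : ∀ e : (KK n).Dart, ∃ g : G, dartPerm (φ g).1 d = e ∨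
      dartPerm (φ g).1 d.symm = e := by
    intro e
    have key : ∀ f : (KK n).Dart, f.fst.isLeft = e.fst.isLeft →
        ∃ g : G, dartPerm (φ g).1 f = e := by
      intro f hf
      obtain ⟨χ, hχ, hχf⟩ := hM.exists_apply f e
      have hχ0 : χ ∈ M.Aut₀ := mem_Aut₀_of_isLeft hχ (u := f.fst) (by
        rw [hf, ← hχf]; rfl)
      exact ⟨φ.symm ⟨χ, hχ0⟩, by simpa using hχf⟩
    by_cases hde : d.fst.isLeft = e.fst.isLeft
    · obtain ⟨g, hg⟩ := key d hde
      exact ⟨g, Or.inl hg⟩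
    · obtain ⟨g, hg⟩ := key d.symm (by
        have := KK.dart_snd_isLeft d
        change d.snd.isLeft = _
        rw [this]
        revert hde
        cases d.fst.isLeft <;> cases e.fst.isLeft <;> simp)
      exact ⟨g, Or.inr hg⟩
  have hsurj : Function.Surjective F := by
    intro v
    obtain ⟨w, hw⟩ := KK.exists_adj v
    obtain ⟨g, hg | hg⟩ := hdart ⟨(v, w), hw⟩
    · exact ⟨(g, true), congrArg (fun e : (KK n).Dart => e.fst) hg⟩
    · exact ⟨(g, false), congrArg (fun e : (KK n).Dart => e.fst) hg⟩
  refine ⟨F, ⟨hsurj, heq, hadj⟩, ?_⟩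
  have key : ∀ (g c : G) (e : (KK n).Dart), dartPerm (φ c).1 e = M.rot e →
      M.rot (dartPerm (φ g).1 e) = dartPerm (φ (g * c)).1 e := by
    intro g c e hc
    refine ((φ g).2.1 e).symm.trans ?_
    rw [← hc, ← dartPerm_apply, ← Equiv.Perm.mul_apply, ← map_mul, map_mul φ]; rfl
  rintro ⟨g, x⟩
  cases x
  · exact key g b d.symm h₂
  · exact key g a d h₁

/-- Regular maps corresponding to the same triple are isomorphic. -/
theorem CorrespondsAt.isomorphic {M M' : OrientedMap (KK n)} (hM : M.IsRegular)
    (hM' : M'.IsRegular) {G : Type*} [Group G] {a b : G} (ht : IsIsobicyclicTriple n a b)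
    {d d' : (KK n).Dart} (h : M.CorrespondsAt d a b) (h' : M'.CorrespondsAt d' a b) :
    M.Isomorphic M' := by
  obtain ⟨F, hF, hFM⟩ := h.exists_labelling hM
  obtain ⟨F', hF', hFM'⟩ := h'.exists_labelling hM'
  obtain ⟨ψ, hψ⟩ := hF.exists_iso hF'
  exact ⟨ψ, Labelling.isIso ht hFM hFM' hψ⟩

/-- The triple to which a map corresponds through a given edge is unique. -/
theorem CorrespondsAt.exists_mulEquiv {M : OrientedMap (KK n)} {d : (KK n).Dart}
    {G H : Type*} [Group G] [Group H] {a b : G} {a' b' : H}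
    (h : M.CorrespondsAt d a b) (h' : M.CorrespondsAt d a' b') :
    ∃ f : G ≃* H, f a = a' ∧ f b = b' := by
  obtain ⟨φ, h₁, h₂⟩ := h
  obtain ⟨φ', h₁', h₂'⟩ := h'
  refine ⟨φ.trans φ'.symm, ?_, ?_⟩
  · rw [MulEquiv.trans_apply, MulEquiv.symm_apply_eq]
    exact Subtype.ext (IsIso.eq_of_dart (φ a).2.1 (φ' a').2.1 (h₁.trans h₁'.symm))
  · rw [MulEquiv.trans_apply, MulEquiv.symm_apply_eq]
    exact Subtype.ext (IsIso.eq_of_dart (φ b).2.1 (φ' b').2.1 (h₂.trans h₂'.symm))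

end OrientedMap

/-! ### Isobicyclic 2-groups -/

namespace IsIsobicyclicTriple

variable {n e : ℕ} {G : Type*} [Group G] {a b : G}

theorem symm (h : IsIsobicyclicTriple n a b) : IsIsobicyclicTriple n b a where
  orderOf_left := h.orderOf_right
  orderOf_right := h.orderOf_left
  factorises g := by
    obtain ⟨x, hx, y, hy, hxy⟩ := h.factorises g⁻¹
    exact ⟨y⁻¹, Subgroup.inv_mem _ hy, x⁻¹, Subgroup.inv_mem _ hx, by
      rw [← mul_inv_rev, ← hxy, inv_inv]⟩
  disjoint := by rw [inf_comm]; exact h.disjoint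
  transposes := by
    obtain ⟨α, ha, hb⟩ := h.transposes
    exact ⟨α, hb, ha⟩

theorem exists_eq (h : IsIsobicyclicTriple n a b) (g : G) : ∃ i j : ℤ, g = a ^ i * b ^ j := by
  obtain ⟨_, ⟨i, rfl⟩, _, ⟨j, rfl⟩, hg⟩ := h.factorises g
  exact ⟨i, j, hg⟩

theorem pow_left (h : IsIsobicyclicTriple n a b) : a ^ n = 1 := by
  rw [← h.orderOf_left, pow_orderOf_eq_one]

theorem dvd_of_eq_one (h : IsIsobicyclicTriple n a b) {i j : ℤ} (hij : a ^ i * b ^ j = 1) :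
    (n : ℤ) ∣ i ∧ (n : ℤ) ∣ j := by
  have h1 : a ^ i ∈ Subgroup.zpowers a ⊓ Subgroup.zpowers b :=
    ⟨⟨i, rfl⟩, -j, by simp only [zpow_neg]; exact (eq_inv_of_mul_eq_one_left hij).symm⟩
  rw [h.disjoint, Subgroup.mem_bot] at h1
  rw [h1, one_mul] at hij
  constructor
  · rwa [← h.orderOf_left, orderOf_dvd_iff_zpow_eq_one]
  · rwa [← h.orderOf_right, orderOf_dvd_iff_zpow_eq_one]

theorem closure_eq_top (h : IsIsobicyclicTriple n a b) : Subgroup.closure {a, b} = ⊤ := by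
  rw [eq_top_iff]
  intro g _
  obtain ⟨i, j, rfl⟩ := h.exists_eq g
  exact Subgroup.mul_mem _
    (Subgroup.zpow_mem _ (Subgroup.subset_closure (by simp)) _)
    (Subgroup.zpow_mem _ (Subgroup.subset_closure (by simp)) _)

/-- In a product of two disjoint cyclic groups of order `2 ^ (e + 1)`, the involution of each factor
is central. -/
theorem pow_mem_center (h : IsIsobicyclicTriple (2 ^ (e + 1)) a b) :
    a ^ 2 ^ e ∈ Subgroup.center G := by
  set A := Subgroup.zpowers a with hA
  have hn : 2 ≤ 2 ^ (e + 1) := by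
    rw [pow_succ]; have := Nat.one_le_two_pow (n := e); omega
  have hsurj : Function.Surjective (fun s : Fin (2 ^ (e + 1)) =>
      (QuotientGroup.mk (b ^ (s : ℕ)) : G ⧸ A)) := by
    intro q
    obtain ⟨g, rfl⟩ := QuotientGroup.mk_surjective q
    obtain ⟨i, j, rfl⟩ := h.symm.exists_eq g
    have : NeZero (2 ^ (e + 1)) := ⟨by omega⟩
    obtain ⟨k, hk, hki⟩ : ∃ k < 2 ^ (e + 1), b ^ k = b ^ i := by
      have hpos : (0 : ℤ) < orderOf b := by rw [h.orderOf_right]; positivity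
      refine ⟨(i % orderOf b).toNat, ?_, ?_⟩
      · have := Int.emod_lt_of_pos i hpos
        rw [h.orderOf_right] at this ⊢
        have h0 := Int.emod_nonneg i (b := ((2 ^ (e + 1) : ℕ) : ℤ)) (by positivity)
        omega
      · rw [← zpow_natCast, Int.toNat_of_nonneg (Int.emod_nonneg _ hpos.ne'), zpow_mod_orderOf]
    refine ⟨⟨k, hk⟩, QuotientGroup.eq.2 ?_⟩
    simp only
    rw [hki]
    simp [hA]
  have hcard : Nat.card (G ⧸ A) ≤ 2 ^ (e + 1) := by
    simpa using Nat.card_le_card_of_surjective _ hsurj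
  have hfinA : Finite (G ⧸ A) := Finite.of_surjective _ hsurj
  -- the involution `a ^ 2 ^ e` fixes all cosets of `⟨a⟩`
  have hfix : ∀ x : G ⧸ A, a ^ 2 ^ e • x = x := by
    intro x
    by_contra hx
    -- The period divides `2 ^ (e + 1)` but not `2 ^ e`, so it is the full power, and the orbit of
    -- `x` exhausts the cosets.
    have hper : MulAction.period a x = 2 ^ (e + 1) := by
      refine Function.minimalPeriod_eq_prime_pow (f := fun y : G ⧸ A => a • y) (p := 2) ?_ ?_
      · intro hp
        apply hx
        have := hp.eq
        rw [smul_iterate] at this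
        exact this
      · change _ = _
        rw [smul_iterate, h.pow_left]
        exact one_smul _ _
    have hinj : Function.Injective (fun i : Fin (2 ^ (e + 1)) => a ^ (i : ℕ) • x) := by
      intro i j hij
      have hij' : (fun y : G ⧸ A => a • y)^[i] x = (fun y : G ⧸ A => a • y)^[j] x := by
        rw [smul_iterate, smul_iterate]; exact hij
      have := Function.iterate_injOn_Iio_minimalPeriod (f := fun y : G ⧸ A => a • y) (x := x)
        (x₁ := i) (x₂ := j)
        (by change (i : ℕ) < MulAction.period a x; rw [hper]; exact i.2)
        (by change (j : ℕ) < MulAction.period a x; rw [hper]; exact j.2) hij'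
      exact Fin.ext this
    have hbij := (Nat.bijective_iff_injective_and_card _).2 ⟨hinj,
      le_antisymm (Nat.card_le_card_of_injective _ hinj) (by simpa using hcard)⟩
    -- The orbit then contains the coset `A`, which `a` fixes; so `x = A`, which is not moved.
    obtain ⟨i, hi⟩ := hbij.2 (QuotientGroup.mk 1)
    simp only at hi
    rw [smul_eq_iff_eq_inv_smul] at hi
    have h1 : x = QuotientGroup.mk 1 := by
      rw [hi, MulAction.Quotient.smul_mk]
      exact QuotientGroup.eq.2 (by simp [hA])
    apply hx
    rw [h1, MulAction.Quotient.smul_mk]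
    exact QuotientGroup.eq.2 (by simp [hA])
  have hsq : (a ^ 2 ^ e) ^ 2 = 1 := by rw [← pow_mul, ← pow_succ, h.pow_left]
  have hne : a ^ 2 ^ e ≠ 1 := by
    refine pow_ne_one_of_lt_orderOf (by positivity) ?_
    rw [h.orderOf_left, pow_succ]; have := Nat.one_le_two_pow (n := e); omega
  rw [Subgroup.mem_center_iff]
  intro g
  have h1 : (g⁻¹ * a ^ 2 ^ e * g) ∈ A := by
    have := hfix (QuotientGroup.mk g)
    rw [MulAction.Quotient.smul_mk, eq_comm, QuotientGroup.eq] at this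
    simpa [mul_assoc] using this
  obtain ⟨i, hi⟩ := h1
  simp only at hi
  have h2 : a ^ (i * 2) = 1 := by
    have h3 : g⁻¹ * a ^ 2 ^ e * g = g⁻¹ * a ^ 2 ^ e * (g⁻¹)⁻¹ := by rw [inv_inv]
    rw [zpow_mul, hi]
    norm_cast
    rw [h3, conj_pow, hsq]; simp
  rw [← orderOf_dvd_iff_zpow_eq_one, h.orderOf_left] at h2
  obtain ⟨c, hc⟩ := h2
  have hic : i = 2 ^ e * c := by
    push_cast at hc
    rw [pow_succ] at hc
    linarith
  have h4 : (g⁻¹ * a ^ 2 ^ e * g) = a ^ 2 ^ e := by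
    have h5 : g⁻¹ * a ^ 2 ^ e * g = (a ^ 2 ^ e) ^ c := by
      rw [← hi, hic, zpow_mul]; norm_cast
    -- The conjugate is a power of the involution: an even exponent would make it trivial, an odd
    -- one gives the involution itself.
    rcases Int.even_or_odd' c with ⟨k, rfl | rfl⟩
    · exfalso
      rw [zpow_mul, show (a ^ 2 ^ e) ^ (2 : ℤ) = 1 by exact_mod_cast hsq, one_zpow] at h5
      apply hne
      rw [mul_assoc, inv_mul_eq_one] at h5
      exact (mul_eq_right.1 h5.symm)
    · rw [h5, zpow_add, zpow_mul, show (a ^ 2 ^ e) ^ (2 : ℤ) = 1 by exact_mod_cast hsq, one_zpow,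
        one_mul, zpow_one]
  rw [mul_assoc, inv_mul_eq_iff_eq_mul] at h4
  exact h4.symm

/-- The subgroup generated by the involutions of the two factors. -/
theorem exists_bottom (h : IsIsobicyclicTriple (2 ^ (e + 1)) a b) :
    ∃ Z : Subgroup G, Z ≤ Subgroup.center G ∧
      ∀ x, x ∈ Z ↔ ∃ s t : ℤ, x = a ^ ((2 : ℤ) ^ e * s) * b ^ ((2 : ℤ) ^ e * t) := by
  have key : ∀ c : G, ∀ s : ℤ, c ^ ((2 : ℤ) ^ e * s) = (c ^ 2 ^ e) ^ s := by
    intro c s; rw [zpow_mul]; norm_cast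
  have hac := h.pow_mem_center
  have hbc := h.symm.pow_mem_center
  refine ⟨Subgroup.zpowers (a ^ 2 ^ e) ⊔ Subgroup.zpowers (b ^ 2 ^ e), ?_, ?_⟩
  · rw [sup_le_iff, Subgroup.zpowers_le, Subgroup.zpowers_le]
    exact ⟨hac, hbc⟩
  · intro x
    have : (Subgroup.zpowers (b ^ 2 ^ e)).Normal :=
      ⟨fun y hy g => by
        have : y ∈ Subgroup.center G := (Subgroup.zpowers_le.2 hbc) hy
        rw [Subgroup.mem_center_iff.1 this g]; simpa using hy⟩
    rw [Subgroup.mem_sup_of_normal_right]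
    constructor
    · rintro ⟨_, ⟨s, rfl⟩, _, ⟨t, rfl⟩, rfl⟩
      exact ⟨s, t, by rw [key, key]⟩
    · rintro ⟨s, t, rfl⟩
      exact ⟨_, ⟨s, rfl⟩, _, ⟨t, rfl⟩, by rw [key, key]⟩

/-- Factoring out the involutions of the two factors. -/
theorem quotient (h : IsIsobicyclicTriple (2 ^ (e + 1)) a b) {Z : Subgroup G} [Z.Normal]
    (hZ : ∀ x, x ∈ Z ↔ ∃ s t : ℤ, x = a ^ ((2 : ℤ) ^ e * s) * b ^ ((2 : ℤ) ^ e * t))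
    (hc : Z ≤ Subgroup.center G) :
    IsIsobicyclicTriple (2 ^ e) (a : G ⧸ Z) (b : G ⧸ Z) := by
  have key : ∀ i j : ℤ, (a : G ⧸ Z) ^ i * (b : G ⧸ Z) ^ j = 1 → (2 : ℤ) ^ e ∣ i ∧ (2 : ℤ) ^ e ∣ j := by
    intro i j hij
    have h1 : a ^ i * b ^ j ∈ Z := (QuotientGroup.eq_one_iff _).1 (by
      rw [QuotientGroup.mk_mul, QuotientGroup.mk_zpow, QuotientGroup.mk_zpow, hij])
    obtain ⟨s, t, hst⟩ := (hZ _).1 h1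
    have h2 : a ^ (i - 2 ^ e * s) * b ^ (j - 2 ^ e * t) = 1 := by
      rw [sub_eq_add_neg, add_comm, zpow_add, sub_eq_add_neg, zpow_add, mul_assoc, ← mul_assoc (a ^ i),
        hst]
      simp
    have h3 := h.dvd_of_eq_one h2
    push_cast at h3
    have h4 : (2 : ℤ) ^ e ∣ 2 ^ (e + 1) := pow_dvd_pow _ (by omega)
    constructor
    · have := dvd_add (h4.trans h3.1) (Dvd.intro s rfl)
      simpa using this
    · have := dvd_add (h4.trans h3.2) (Dvd.intro t rfl)
      simpa using this
  have hmem : ∀ s t : ℤ, a ^ ((2 : ℤ) ^ e * s) * b ^ ((2 : ℤ) ^ e * t) ∈ Z := fun s t =>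
    (hZ _).2 ⟨s, t, rfl⟩
  have horder : ∀ x : G, x ^ 2 ^ e ∈ Z → (∀ i : ℤ, (x : G ⧸ Z) ^ i = 1 → (2 : ℤ) ^ e ∣ i) →
      orderOf (x : G ⧸ Z) = 2 ^ e := by
    intro x hx hxi
    refine Nat.dvd_antisymm ?_ ?_
    · rw [orderOf_dvd_iff_pow_eq_one, ← QuotientGroup.mk_pow, QuotientGroup.eq_one_iff]
      exact hx
    · have := hxi (orderOf (x : G ⧸ Z)) (by rw [zpow_natCast, pow_orderOf_eq_one])
      exact_mod_cast this
  refine ⟨horder a ?_ ?_, horder b ?_ ?_, ?_, ?_, ?_⟩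
  · have := hmem 1 0
    simp only [mul_one, mul_zero, zpow_zero] at this
    exact_mod_cast this
  · intro i hi
    exact (key i 0 (by simpa using hi)).1
  · have := hmem 0 1
    simp only [mul_one, mul_zero, zpow_zero, one_mul] at this
    exact_mod_cast this
  · intro i hi
    exact (key 0 i (by simpa using hi)).2
  · intro q
    obtain ⟨g, rfl⟩ := QuotientGroup.mk_surjective q
    obtain ⟨i, j, rfl⟩ := h.exists_eq g
    exact ⟨_, ⟨i, rfl⟩, _, ⟨j, rfl⟩, rfl⟩
  · rw [eq_bot_iff]
    rintro _ ⟨⟨i, rfl⟩, ⟨j, hj⟩⟩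
    simp only at hj
    have h1 := (key i (-j) (by simp only [zpow_neg, hj, mul_inv_cancel])).1
    obtain ⟨c, rfl⟩ := h1
    rw [Subgroup.mem_bot]
    simp only
    rw [← QuotientGroup.mk_zpow, QuotientGroup.eq_one_iff]
    simpa using hmem c 0
  · obtain ⟨α, ha, hb⟩ := h.transposes
    have hαZ : Z.map (α : G →* G) = Z := by
      have h1 : ∀ x ∈ Z, α x ∈ Z := by
        intro x hx
        obtain ⟨s, t, rfl⟩ := (hZ _).1 hx
        rw [map_mul, map_zpow, map_zpow, ha, hb,
          Subgroup.mem_center_iff.1 (hc (by simpa using hmem t 0)) _]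
        exact hmem t s
      apply le_antisymm
      · rintro _ ⟨x, hx, rfl⟩
        exact h1 x hx
      · intro x hx
        obtain ⟨s, t, rfl⟩ := (hZ _).1 hx
        refine ⟨_, hmem t s, ?_⟩
        change α _ = _
        rw [map_mul, map_zpow, map_zpow, ha, hb,
          Subgroup.mem_center_iff.1 (hc (by simpa using hmem s 0)) _]
    refine ⟨QuotientGroup.congr Z Z α hαZ, ?_, ?_⟩
    · exact congrArg _ ha
    · exact congrArg _ hb

end IsIsobicyclicTriple

/-! ### The power filtration, and a criterion for metacyclicity -/

open scoped commutatorElement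

/-- The subgroups `N j = ⟨a ^ 2 ^ j⟩⟨b ^ 2 ^ j⟩` form a central series with elementary abelian
factors. -/
structure IsPowerFiltration {G : Type*} [Group G] (a b : G) (N : ℕ → Subgroup G) : Prop where
  mem_iff : ∀ j x, x ∈ N j ↔ ∃ s t : ℤ, x = a ^ ((2 : ℤ) ^ j * s) * b ^ ((2 : ℤ) ^ j * t)
  commutator_mem : ∀ j, ∀ x ∈ N j, ∀ g, ⁅x, g⁆ ∈ N (j + 1)
  sq_mem : ∀ j, ∀ x ∈ N j, x ^ 2 ∈ N (j + 1)

theorem commutatorElement_mem_iff {G : Type*} [Group G] {N : Subgroup G} [N.Normal] {x y : G} :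
    ⁅x, y⁆ ∈ N ↔ Commute (x : G ⧸ N) (y : G ⧸ N) := by
  rw [← QuotientGroup.eq_one_iff, ← commutatorElement_eq_one_iff_commute]
  exact Iff.rfl

/-- By induction on `e`: the terms are the preimages of those of the quotient by the central
involutions. -/
theorem IsIsobicyclicTriple.exists_filtration {e : ℕ} {G : Type*} [Group G] {a b : G}
    (h : IsIsobicyclicTriple (2 ^ e) a b) :
    ∃ N : ℕ → Subgroup G, (∀ j, (N j).Normal) ∧ IsPowerFiltration a b N := by
  have hbot : ∀ {e : ℕ} {G : Type _} [Group G] {a b : G}, IsIsobicyclicTriple (2 ^ e) a b →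
      ∀ j, e ≤ j → ∀ s t : ℤ, a ^ ((2 : ℤ) ^ j * s) * b ^ ((2 : ℤ) ^ j * t) = 1 := by
    intro e G _ a b h j hj s t
    have h1 : ((2 ^ e : ℕ) : ℤ) ∣ 2 ^ j := by push_cast; exact pow_dvd_pow _ hj
    have h2 : a ^ ((2 : ℤ) ^ j * s) = 1 := by
      rw [← orderOf_dvd_iff_zpow_eq_one, h.orderOf_left]; exact h1.mul_right s
    have h3 : b ^ ((2 : ℤ) ^ j * t) = 1 := by
      rw [← orderOf_dvd_iff_zpow_eq_one, h.orderOf_right]; exact h1.mul_right t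
    rw [h2, h3, one_mul]
  induction e generalizing G with
  | zero =>
    have h1 : ∀ x : G, x = 1 := by
      intro x
      obtain ⟨i, j, rfl⟩ := h.exists_eq x
      simpa using hbot h 0 le_rfl i j
    refine ⟨fun _ => ⊥, fun _ => inferInstance, ⟨fun j x => ?_, fun j x _ g => h1 _,
      fun j x _ => h1 _⟩⟩
    exact iff_of_true (h1 x) ⟨0, 0, by simpa using h1 x⟩
  | succ e ih =>
    obtain ⟨Z, hZc, hZ⟩ := h.exists_bottom
    have hZn : Z.Normal := ⟨fun x hx g => by
      rw [Subgroup.mem_center_iff.1 (hZc hx) g]; simpa using hx⟩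
    obtain ⟨N', hN', hF⟩ := ih (h.quotient hZ hZc)
    have hmem : ∀ j, j ≤ e → ∀ x : G, (x : G ⧸ Z) ∈ N' j ↔
        ∃ s t : ℤ, x = a ^ ((2 : ℤ) ^ j * s) * b ^ ((2 : ℤ) ^ j * t) := by
      intro j hj x
      rw [hF.mem_iff]
      constructor
      · rintro ⟨s, t, hst⟩
        rw [← QuotientGroup.mk_zpow, ← QuotientGroup.mk_zpow, ← QuotientGroup.mk_mul, eq_comm,
          QuotientGroup.eq] at hst
        obtain ⟨s', t', hst'⟩ := (hZ _).1 hst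
        rw [inv_mul_eq_iff_eq_mul] at hst'
        -- The correction from `Z` is central with exponents divisible by `2 ^ e`, hence by `2 ^ j`,
        -- and is absorbed.
        refine ⟨s + 2 ^ (e - j) * s', t + 2 ^ (e - j) * t', ?_⟩
        have hpow : (2 : ℤ) ^ j * 2 ^ (e - j) = 2 ^ e := by
          rw [← pow_add, Nat.add_sub_cancel' hj]
        rw [mul_add, mul_add, ← mul_assoc, ← mul_assoc, hpow, hst', zpow_add, zpow_add]
        have hca : a ^ ((2 : ℤ) ^ e * s') ∈ Subgroup.center G :=
          hZc ((hZ _).2 ⟨s', 0, by simp⟩)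
        have hcb : b ^ ((2 : ℤ) ^ j * t) * a ^ ((2 : ℤ) ^ e * s') =
          a ^ ((2 : ℤ) ^ e * s') * b ^ ((2 : ℤ) ^ j * t) := Subgroup.mem_center_iff.1 hca _
        simp only [mul_assoc]
        rw [← mul_assoc (b ^ _) (a ^ _), hcb]
        simp only [mul_assoc]
      · rintro ⟨s, t, rfl⟩
        exact ⟨s, t, rfl⟩
    -- At `j = e` the preimage is `Z`, which is central with trivial squares; this makes the step to
    -- the trivial terms beyond it legitimate.
    refine ⟨fun j => if j ≤ e then (N' j).comap (QuotientGroup.mk' Z) else ⊥, ?_, ?_, ?_, ?_⟩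
    · intro j
      have := hN' j
      dsimp only
      split_ifs <;> infer_instance
    · intro j x
      split_ifs with hj
      · exact hmem j hj x
      · rw [Subgroup.mem_bot]
        constructor
        · rintro rfl
          exact ⟨0, 0, by simp⟩
        · rintro ⟨s, t, rfl⟩
          exact hbot h j (by omega) s t
    · intro j x hx g
      split_ifs at hx with hj
      · split_ifs with hj'
        · exact hF.commutator_mem j _ hx (g : G ⧸ Z)
        · have hje : j = e := by omega
          subst hje
          have hxZ := hZc ((hZ x).2 ((hmem j le_rfl x).1 hx))
          rw [Subgroup.mem_bot, commutatorElement_eq_one_iff_mul_comm]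
          exact (Subgroup.mem_center_iff.1 hxZ g).symm
      · rw [Subgroup.mem_bot] at hx
        rw [if_neg (by omega), hx, commutatorElement_one_left]
        exact Subgroup.one_mem _
    · intro j x hx
      split_ifs at hx with hj
      · split_ifs with hj'
        · exact hF.sq_mem j _ hx
        · have hje : j = e := by omega
          subst hje
          obtain ⟨s, t, rfl⟩ := (hmem j le_rfl x).1 hx
          have hcb : b ^ ((2 : ℤ) ^ j * t) ∈ Subgroup.center G :=
            hZc ((hZ _).2 ⟨0, t, by simp⟩)
          have hcomm : Commute (a ^ ((2 : ℤ) ^ j * s)) (b ^ ((2 : ℤ) ^ j * t)) :=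
            Subgroup.mem_center_iff.1 hcb _
          rw [Subgroup.mem_bot, hcomm.mul_pow, ← zpow_natCast, ← zpow_natCast, ← zpow_mul,
            ← zpow_mul]
          have := hbot h (j + 1) le_rfl s t
          rw [pow_succ, mul_right_comm, mul_right_comm _ 2 t] at this
          exact this
      · rw [Subgroup.mem_bot] at hx
        rw [if_neg (by omega), hx, one_pow]
        exact Subgroup.one_mem _

/-- A normal subgroup containing the commutator of two generators contains all commutators. -/
theorem commutatorElement_mem_of_closure {G : Type*} [Group G] {a b : G} {S : Subgroup G}
    [S.Normal] (hab : Subgroup.closure {a, b} = ⊤) (h : ⁅a, b⁆ ∈ S) (g k : G) : ⁅g, k⁆ ∈ S := by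
  have h1 : Subgroup.closure {(a : G ⧸ S), (b : G ⧸ S)} = ⊤ := by
    have := congrArg (Subgroup.map (QuotientGroup.mk' S)) hab
    rw [MonoidHom.map_closure, Set.image_pair, ← MonoidHom.range_eq_map,
      QuotientGroup.range_mk'] at this
    exact this
  have h2 : Commute (a : G ⧸ S) b := commutatorElement_mem_iff.1 h
  have h3 := Subgroup.isMulCommutative_closure (k := {(a : G ⧸ S), (b : G ⧸ S)}) (by
    rintro x (rfl | rfl) y (rfl | rfl)
    · rfl
    · exact h2
    · exact h2.symm
    · rfl)
  rw [commutatorElement_mem_iff]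
  have hg : ∀ x : G ⧸ S, x ∈ Subgroup.closure {(a : G ⧸ S), (b : G ⧸ S)} := fun x => by
    rw [h1]; trivial
  exact congrArg Subtype.val (h3.is_comm.comm ⟨_, hg g⟩ ⟨_, hg k⟩)

/-! ### Powers and roots when `⁅a, b⁆` lies in `N 2`. -/

namespace IsPowerFiltration

variable {G : Type*} [Group G] {a b : G} {N : ℕ → Subgroup G}

theorem antitone (hF : IsPowerFiltration a b N) : Antitone N := by
  refine antitone_nat_of_succ_le fun j x hx => ?_
  obtain ⟨s, t, rfl⟩ := (hF.mem_iff _ _).1 hx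
  exact (hF.mem_iff _ _).2 ⟨2 * s, 2 * t, by rw [pow_succ, mul_assoc, mul_assoc]⟩

theorem left_mem (hF : IsPowerFiltration a b N) (j : ℕ) (s : ℤ) : a ^ ((2 : ℤ) ^ j * s) ∈ N j :=
  (hF.mem_iff _ _).2 ⟨s, 0, by simp⟩

theorem right_mem (hF : IsPowerFiltration a b N) (j : ℕ) (s : ℤ) : b ^ ((2 : ℤ) ^ j * s) ∈ N j :=
  (hF.mem_iff _ _).2 ⟨0, s, by simp⟩

theorem pow_mem (hF : IsPowerFiltration a b N) {p : ℕ} {y : G} (hy : y ∈ N p) (i : ℕ) :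
    y ^ 2 ^ i ∈ N (p + i) := by
  induction i with
  | zero => simpa using hy
  | succ i ih =>
    rw [pow_succ, pow_mul]
    exact hF.sq_mem _ _ ih

variable [∀ j, (N j).Normal]

/-- In the inductive step, `w = ⁅X, y⁆` is central of order at most 2 modulo `N (j + 3)`, so passing
from `X` to `X ^ 2` replaces it by `w ^ 2`, which is trivial there. -/
theorem commutator_pow_mem (hF : IsPowerFiltration a b N) {x y : G} (hxy : ⁅x, y⁆ ∈ N 2) (j : ℕ) :
    ⁅x ^ 2 ^ j, y⁆ ∈ N (j + 2) := by
  induction j with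
  | zero => simpa using hxy
  | succ j ih =>
    set X := x ^ 2 ^ j
    set w := ⁅X, y⁆ with hw
    have h1 : X * y = w * y * X := by rw [hw, commutatorElement_def]; group
    have h2 : Commute (w : G ⧸ N (j + 3)) (X : G ⧸ N (j + 3)) :=
      commutatorElement_mem_iff.1 (hF.commutator_mem _ _ ih _)
    have h3 : (w : G ⧸ N (j + 3)) * w = 1 := by
      rw [← sq, ← QuotientGroup.mk_pow, QuotientGroup.eq_one_iff]
      exact hF.sq_mem _ _ ih
    have h4 : (X : G ⧸ N (j + 3)) * y = w * y * X := congrArg _ h1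
    rw [show j + 1 + 2 = j + 3 by ring, commutatorElement_mem_iff, pow_succ, pow_mul, sq,
      QuotientGroup.mk_mul]
    change _ * _ = _ * _
    calc (X : G ⧸ N (j + 3)) * X * y = X * (X * y) := mul_assoc _ _ _
      _ = (X * w) * y * X := by rw [h4]; simp only [mul_assoc]
      _ = w * (X * y) * X := by rw [← h2.eq]; simp only [mul_assoc]
      _ = (w * w) * y * X * X := by rw [h4]; simp only [mul_assoc]
      _ = y * (X * X) := by rw [h3, one_mul, mul_assoc]

/-- If `a` and `b` commute modulo `N 2`, then the commutators of `N j` lie in `N (j + 2)`. -/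
theorem commutator_mem_add_two (hF : IsPowerFiltration a b N)
    (h : ∀ g : G, ∃ i j : ℤ, g = a ^ i * b ^ j) (hab : ⁅a, b⁆ ∈ N 2) {j : ℕ} {x : G}
    (hx : x ∈ N j) (g : G) : ⁅x, g⁆ ∈ N (j + 2) := by
  have h1 : Commute (a ^ 2 ^ j : G ⧸ N (j + 2)) b :=
    commutatorElement_mem_iff.1 (hF.commutator_pow_mem hab j)
  have hba : ⁅b, a⁆ ∈ N 2 := by
    rw [← commutatorElement_inv]; exact Subgroup.inv_mem _ hab
  have h2 : Commute (b ^ 2 ^ j : G ⧸ N (j + 2)) a :=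
    commutatorElement_mem_iff.1 (hF.commutator_pow_mem hba j)
  obtain ⟨s, t, rfl⟩ := (hF.mem_iff _ _).1 hx
  obtain ⟨k, l, rfl⟩ := h g
  rw [commutatorElement_mem_iff]
  have key : ∀ (c : G ⧸ N (j + 2)) (s : ℤ), c ^ ((2 : ℤ) ^ j * s) = (c ^ 2 ^ j) ^ s := by
    intro c s; rw [zpow_mul]; norm_cast
  simp only [QuotientGroup.mk_mul, QuotientGroup.mk_zpow, key]
  have ha : Commute (a ^ 2 ^ j : G ⧸ N (j + 2)) a := (Commute.refl _).pow_left _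
  have hb : Commute (b ^ 2 ^ j : G ⧸ N (j + 2)) b := (Commute.refl _).pow_left _
  exact ((ha.zpow_zpow _ _).mul_right (h1.zpow_zpow _ _)).mul_left
    ((h2.zpow_zpow _ _).mul_right (hb.zpow_zpow _ _))

/-- Powers of two are almost multiplicative. -/
theorem exists_mul_pow (hF : IsPowerFiltration a b N)
    (h : ∀ g : G, ∃ i j : ℤ, g = a ^ i * b ^ j) (hab : ⁅a, b⁆ ∈ N 2) (x : G) {p : ℕ} {y : G}
    (hy : y ∈ N p) (i : ℕ) :
    ∃ r ∈ N (p + i + 1), (x * y) ^ 2 ^ i = x ^ 2 ^ i * y ^ 2 ^ i * r := by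
  induction i with
  | zero => exact ⟨1, Subgroup.one_mem _, by simp⟩
  | succ i ih =>
    obtain ⟨r, hr, hxy⟩ := ih
    refine ⟨(x ^ 2 ^ (i + 1) * y ^ 2 ^ (i + 1))⁻¹ * (x * y) ^ 2 ^ (i + 1), ?_, by group⟩
    rw [← QuotientGroup.eq]
    rw [pow_succ, pow_mul, pow_mul, pow_mul, hxy]
    set X := x ^ 2 ^ i
    set Y := y ^ 2 ^ i with hY
    have hYm : Y ∈ N (p + i) := hF.pow_mem hy i
    have h1 : Commute (Y : G ⧸ N (p + i + 2)) X :=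
      commutatorElement_mem_iff.1 (hF.commutator_mem_add_two h hab hYm X)
    have h2 : ∀ g : G, Commute (r : G ⧸ N (p + i + 2)) g := fun g =>
      commutatorElement_mem_iff.1 (hF.commutator_mem _ _ hr g)
    have h3 : (r : G ⧸ N (p + i + 2)) ^ 2 = 1 := by
      rw [← QuotientGroup.mk_pow, QuotientGroup.eq_one_iff]
      exact hF.sq_mem _ _ hr
    change _ = ((_ : G) : G ⧸ N (p + i + 2))
    simp only [QuotientGroup.mk_mul, QuotientGroup.mk_pow]
    rw [((h2 X).mul_right (h2 Y)).symm.mul_pow, h1.symm.mul_pow, h3, mul_one]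
    rfl

/-- The root is found by dividing both exponents of `w` by `2 ^ j`; `exists_mul_pow` bounds the
error. -/
theorem exists_root (hF : IsPowerFiltration a b N)
    (h : ∀ g : G, ∃ i j : ℤ, g = a ^ i * b ^ j) (hab : ⁅a, b⁆ ∈ N 2) (p j : ℕ) {w : G}
    (hw : w ∈ N (p + j)) : ∃ y ∈ N p, ∃ r ∈ N (p + j + 1), y ^ 2 ^ j = w * r := by
  obtain ⟨s, t, rfl⟩ := (hF.mem_iff _ _).1 hw
  obtain ⟨r, hr, h1⟩ := hF.exists_mul_pow h hab (a ^ ((2 : ℤ) ^ p * s)) (hF.right_mem p t) j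
  refine ⟨_, Subgroup.mul_mem _ (hF.left_mem p s) (hF.right_mem p t), r, hr, ?_⟩
  have key : ∀ (c : G) (s : ℤ), (c ^ ((2 : ℤ) ^ p * s)) ^ 2 ^ j = c ^ ((2 : ℤ) ^ (p + j) * s) := by
    intro c s
    rw [← zpow_natCast, ← zpow_mul]
    push_cast
    rw [mul_right_comm, ← pow_add]
  rw [h1, key, key]

/-- Every element of `N j` outside `N (j + 1)` is a `2 ^ j`-th power, up to `N (j + 1 + t)`, of an
element outside `N 1`. -/
theorem exists_root_approx (hF : IsPowerFiltration a b N)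
    (h : ∀ g : G, ∃ i j : ℤ, g = a ^ i * b ^ j) (hab : ⁅a, b⁆ ∈ N 2) {j : ℕ} {c : G}
    (hc : c ∈ N j) (hc' : c ∉ N (j + 1)) (t : ℕ) :
    ∃ x ∉ N 1, ∃ r ∈ N (j + 1 + t), x ^ 2 ^ j = c * r := by
  induction t with
  | zero =>
    obtain ⟨x, -, r, hr, hx⟩ := hF.exists_root h hab 0 j (w := c) (by simpa using hc)
    rw [zero_add] at hr
    refine ⟨x, fun hx1 => hc' ?_, r, hr, hx⟩
    have := hF.pow_mem hx1 j
    rw [hx, add_comm] at this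
    exact (Subgroup.mul_mem_cancel_right _ hr).1 this
  | succ t ih =>
    obtain ⟨x, hx1, r, hr, hx⟩ := ih
    -- Successive approximation: `x` is multiplied by an approximate root of the inverse error. The
    -- factor lies in `N (t + 1) ≤ N 1`, so the product stays outside `N 1`.
    obtain ⟨y, hy, r', hr', hxy⟩ := hF.exists_root h hab (t + 1) j (w := r⁻¹)
      (Subgroup.inv_mem _ (by convert hr using 2; ring))
    obtain ⟨r'', hr'', hm⟩ := hF.exists_mul_pow h hab x hy j
    refine ⟨x * y, fun hxy1 => hx1 ?_, r' * r'', ?_, ?_⟩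
    · exact (Subgroup.mul_mem_cancel_right _ (hF.antitone (by omega) hy)).1 hxy1
    · rw [show j + 1 + (t + 1) = t + 1 + j + 1 by ring]
      exact Subgroup.mul_mem _ hr' hr''
    · rw [hm, hx, hxy]; group

/-- If `⁅a, b⁆` is a proper `2 ^ j`-th power, then modulo each term of the filtration all
commutators are powers of `⁅a, b⁆`. -/
theorem commutator_mem_sup (hF : IsPowerFiltration a b N)
    (h : ∀ g : G, ∃ i j : ℤ, g = a ^ i * b ^ j) (hab : ⁅a, b⁆ ∈ N 2) (htop : N 0 = ⊤) {j : ℕ}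
    (hj : j ≠ 0) {x : G} (hx : x ^ 2 ^ j = ⁅a, b⁆) (t : ℕ) (g k : G) :
    ⁅g, k⁆ ∈ Subgroup.zpowers ⁅a, b⁆ ⊔ N t := by
  induction t generalizing g k with
  | zero => rw [htop, sup_top_eq]; trivial
  | succ t ih =>
    have hconj : ∀ g : G, g * ⁅a, b⁆ * g⁻¹ ∈ Subgroup.zpowers ⁅a, b⁆ ⊔ N (t + 1) := by
      intro g
      -- As `⁅a, b⁆` is a power of `x`, the hypothesis for `⁅g, x⁆` makes the conjugate of `x` a
      -- power of `x` up to `N t`. Raising to the power `2 ^ j` with `j ≥ 1` pushes the error into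
      -- `N (t + 1)`.
      obtain ⟨_, ⟨s, rfl⟩, w, hw, hsw⟩ := Subgroup.mem_sup_of_normal_right.1 (ih g x)
      simp only at hsw
      have h1 : g * x * g⁻¹ = x ^ ((2 : ℤ) ^ j * s + 1) * (x⁻¹ * w * x) := by
        have h2 : g * x * g⁻¹ = ⁅g, x⁆ * x := by rw [commutatorElement_def]; group
        rw [h2, ← hsw, ← hx, zpow_add, zpow_mul, zpow_one]
        have h3 : x ^ (2 : ℤ) ^ j = x ^ 2 ^ j := by norm_cast
        rw [h3]; group
      have hw' : x⁻¹ * w * x ∈ N t := by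
        have := (inferInstance : (N t).Normal).conj_mem w hw x⁻¹
        simpa using this
      obtain ⟨r, hr, hm⟩ := hF.exists_mul_pow h hab (x ^ ((2 : ℤ) ^ j * s + 1)) hw' j
      rw [← hx, ← conj_pow, h1, hm, mul_assoc]
      refine Subgroup.mul_mem _ (Subgroup.mem_sup_left ?_) (Subgroup.mem_sup_right
        (Subgroup.mul_mem _ (hF.antitone (by omega) (hF.pow_mem hw' j))
          (hF.antitone (by omega) hr)))
      refine ⟨(2 : ℤ) ^ j * s + 1, ?_⟩
      simp only
      rw [← zpow_natCast, ← zpow_natCast, ← zpow_mul, ← zpow_mul, mul_comm]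
    have hn : (Subgroup.zpowers ⁅a, b⁆ ⊔ N (t + 1)).Normal := by
      refine ⟨fun y hy g => ?_⟩
      obtain ⟨_, ⟨s, rfl⟩, w, hw, rfl⟩ := Subgroup.mem_sup_of_normal_right.1 hy
      have : g * (⁅a, b⁆ ^ s * w) * g⁻¹ = (g * ⁅a, b⁆ * g⁻¹) ^ s * (g * w * g⁻¹) := by
        rw [conj_zpow]; group
      simp only
      rw [this]
      exact Subgroup.mul_mem _ (Subgroup.zpow_mem _ (hconj g) _)
        (Subgroup.mem_sup_right ((inferInstance : (N (t + 1)).Normal).conj_mem w hw g))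
    refine commutatorElement_mem_of_closure (a := a) (b := b) ?_
      (Subgroup.mem_sup_left (Subgroup.mem_zpowers _)) g k
    rw [eq_top_iff]
    intro g _
    obtain ⟨i, j, rfl⟩ := h g
    exact Subgroup.mul_mem _
      (Subgroup.zpow_mem _ (Subgroup.subset_closure (by simp)) _)
      (Subgroup.zpow_mem _ (Subgroup.subset_closure (by simp)) _)

end IsPowerFiltration

/-! ### The metacyclicity criterion. -/

namespace IsIsobicyclicTriple

variable {e : ℕ} {G : Type*} [Group G] {a b : G}

/-- A cyclic subgroup that contains all commutators and is generated by an element outside the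
Frattini subgroup witnesses metacyclicity. -/
theorem isMetacyclic_of_zpowers (h : IsIsobicyclicTriple (2 ^ e) a b) {s t : ℤ}
    (hst : ¬ (2 ∣ s ∧ 2 ∣ t))
    (hcomm : ∀ g k : G, ⁅g, k⁆ ∈ Subgroup.zpowers (a ^ s * b ^ t)) : IsMetacyclic G := by
  set X := Subgroup.zpowers (a ^ s * b ^ t) with hX
  have hn : X.Normal := ⟨fun y hy g => by
    have : g * y * g⁻¹ = ⁅g, y⁆ * y := by rw [commutatorElement_def]; group
    rw [this]
    exact X.mul_mem (hcomm g y) hy⟩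
  refine ⟨X, hn, inferInstance, ?_⟩
  have hab : (a : G ⧸ X) ^ s * (b : G ⧸ X) ^ t = 1 :=
    (QuotientGroup.eq_one_iff _).2 (Subgroup.mem_zpowers _)
  have hc : ∀ x y : G ⧸ X, Commute x y := by
    intro x y
    obtain ⟨x, rfl⟩ := QuotientGroup.mk_surjective x
    obtain ⟨y, rfl⟩ := QuotientGroup.mk_surjective y
    exact commutatorElement_mem_iff.1 (hcomm x y)
  -- one of the generators is a power of the other one
  have key : ∀ (c d : G ⧸ X) (s t : ℤ), c ^ 2 ^ e = 1 → c ^ s * d ^ t = 1 → ¬ 2 ∣ s →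
      (∀ q, ∃ i j : ℤ, q = c ^ i * d ^ j) → IsCyclic (G ⧸ X) := by
    intro c d s t hc' hcd hs hq
    -- An odd `s` is invertible modulo `2 ^ e`, so `c ^ s * d ^ t = 1` can be solved for `c`.
    have hcop : IsCoprime s ((2 : ℤ) ^ e) := by
      refine IsCoprime.pow_right ?_
      exact (Int.prime_two.coprime_iff_not_dvd.2 hs).symm
    obtain ⟨u, v, huv⟩ := hcop
    have h1 : c = d ^ (-t * u) := by
      have h2 : c ^ s = d ^ (-t) := by
        rw [zpow_neg]; exact eq_inv_of_mul_eq_one_left hcd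
      have h3 : c ^ ((2 : ℤ) ^ e) = 1 := by exact_mod_cast hc'
      calc c = c ^ (u * s + v * 2 ^ e) := by rw [huv, zpow_one]
        _ = d ^ (-t * u) := by
          rw [zpow_add, mul_comm u, mul_comm v, zpow_mul, zpow_mul c (2 ^ e), h3, one_zpow, mul_one,
            h2, zpow_mul]
    refine ⟨⟨d, fun q => ?_⟩⟩
    obtain ⟨i, j, rfl⟩ := hq q
    rw [h1]
    refine ⟨-t * u * i + j, ?_⟩
    simp only [zpow_add, zpow_mul]
  have hq : ∀ q : G ⧸ X, ∃ i j : ℤ, q = (a : G ⧸ X) ^ i * (b : G ⧸ X) ^ j := by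
    intro q
    obtain ⟨g, rfl⟩ := QuotientGroup.mk_surjective q
    obtain ⟨i, j, rfl⟩ := h.exists_eq g
    exact ⟨i, j, rfl⟩
  by_cases hs : 2 ∣ s
  · refine key b a t s ?_ ?_ (fun ht => hst ⟨hs, ht⟩) ?_
    · rw [← QuotientGroup.mk_pow, h.symm.pow_left]; rfl
    · rw [(hc _ _).eq, hab]
    · intro q
      obtain ⟨i, j, rfl⟩ := hq q
      exact ⟨j, i, hc _ _⟩
  · refine key a b s t ?_ hab hs hq
    rw [← QuotientGroup.mk_pow, h.pow_left]; rfl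

/-- If `a` and `b` commute modulo `⟨a ^ 4⟩⟨b ^ 4⟩`, the group is metacyclic. -/
theorem isMetacyclic (h : IsIsobicyclicTriple (2 ^ e) a b) {s t : ℤ}
    (hab : b * a = a * b * (a ^ (4 * s) * b ^ (4 * t))) : IsMetacyclic G := by
  obtain ⟨N, hN, hF⟩ := h.exists_filtration
  have hc2 : ⁅a, b⁆ ∈ N 2 := by
    rw [commutatorElement_mem_iff]
    change ((a * b : G) : G ⧸ N 2) = ((b * a : G) : G ⧸ N 2)
    rw [hab, QuotientGroup.eq, inv_mul_cancel_left]
    exact (hF.mem_iff _ _).2 ⟨s, t, by norm_num⟩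
  have htop : N 0 = ⊤ := by
    rw [eq_top_iff]
    intro g _
    obtain ⟨i, j, rfl⟩ := h.exists_eq g
    exact (hF.mem_iff _ _).2 ⟨i, j, by simp⟩
  have hbot : N e = ⊥ := by
    rw [eq_bot_iff]
    intro x hx
    obtain ⟨s, t, rfl⟩ := (hF.mem_iff _ _).1 hx
    have h1 : a ^ (2 : ℤ) ^ e = 1 := by exact_mod_cast h.pow_left
    have h2 : b ^ (2 : ℤ) ^ e = 1 := by exact_mod_cast h.symm.pow_left
    rw [Subgroup.mem_bot, zpow_mul, zpow_mul, h1, h2, one_zpow, one_zpow, one_mul]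
  by_cases hc1 : ⁅a, b⁆ = 1
  · refine h.isMetacyclic_of_zpowers (s := 1) (t := 0) (by norm_num) fun g k => ?_
    have := commutatorElement_mem_of_closure (S := (⊥ : Subgroup G)) h.closure_eq_top
      (by simp [hc1]) g k
    rw [Subgroup.mem_bot] at this
    rw [this]
    exact Subgroup.one_mem _
  · have hex : ∃ j, ⁅a, b⁆ ∉ N j := ⟨e, by rw [hbot, Subgroup.mem_bot]; exact hc1⟩
    classical
    obtain ⟨j, hj⟩ : ∃ j, Nat.find hex = j + 1 := Nat.exists_eq_succ_of_ne_zero fun h0 => by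
      have := Nat.find_spec hex
      rw [h0, htop] at this
      exact this trivial
    have hj' : ⁅a, b⁆ ∉ N (j + 1) := hj ▸ Nat.find_spec hex
    have hjm : ⁅a, b⁆ ∈ N j := not_not.1 (Nat.find_min hex (by omega))
    have hj0 : j ≠ 0 := by
      rintro rfl
      exact hj' (hF.antitone (by norm_num) hc2)
    -- With `e` rounds of approximation the error lies in `N e = ⊥`, so the root is exact.
    obtain ⟨x, hx1, r, hr, hx⟩ := hF.exists_root_approx h.exists_eq hc2 hjm hj' e
    have hr1 : r = 1 := by
      have := hF.antitone (show e ≤ j + 1 + e by omega) hr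
      rwa [hbot, Subgroup.mem_bot] at this
    rw [hr1, mul_one] at hx
    obtain ⟨s, t, rfl⟩ := h.exists_eq x
    refine h.isMetacyclic_of_zpowers (s := s) (t := t) ?_ fun g k => ?_
    · rintro ⟨⟨s, rfl⟩, ⟨t, rfl⟩⟩
      exact hx1 ((hF.mem_iff _ _).2 ⟨s, t, by norm_num⟩)
    · have := hF.commutator_mem_sup h.exists_eq hc2 htop hj0 hx e g k
      rw [hbot, sup_bot_eq] at this
      refine (Subgroup.zpowers_le.2 ?_) this
      rw [← hx]
      exact Subgroup.pow_mem _ (Subgroup.mem_zpowers _) _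

end IsIsobicyclicTriple

/-! ### The relations of `G₂(e; k, l)` in isobicyclic 2-groups -/

/-- The defining relations of `G₂(e; k, l)`, as relations between two elements of a group. -/
structure SatisfiesG2 (e k l : ℕ) {G : Type*} [Group G] (a b : G) : Prop where
  pow_left : a ^ 2 ^ e = 1
  pow_right : b ^ 2 ^ e = 1
  comm : Commute (b ^ 2) (a ^ 2)
  mul_eq : b * a = a * b * (a ^ 2 * (b ^ 2)⁻¹ * (a ^ (2 ^ e / 2) * b ^ (2 ^ e / 2)) ^ k)
  sq_mul_left : b ^ 2 * a = a * ((b ^ 2)⁻¹ * (a ^ (2 ^ e / 2) * b ^ (2 ^ e / 2)) ^ l)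
  sq_mul_right : a ^ 2 * b = b * ((a ^ 2)⁻¹ * (a ^ (2 ^ e / 2) * b ^ (2 ^ e / 2)) ^ l)

/-- If conjugation by `a` inverted `v = b ^ 2` up to a noncentral twist, the central involutions of
the two factors would coincide. -/
theorem twist_eq_one {G : Type*} [Group G] {u v a : G} {τ : G →* G} {r : ℕ} (hτu : τ u = v)
    (hτv : τ v = u) (hu : u = a ^ 2) (hα : u ^ (4 * r) ∈ Subgroup.center G)
    (hβ : v ^ (4 * r) ∈ Subgroup.center G) (hα2 : (u ^ (4 * r)) ^ 2 = 1)
    (hβ2 : (v ^ (4 * r)) ^ 2 = 1) {ζ δ : G} (hζ : ζ ∈ Subgroup.center G) (hζ2 : ζ ^ 2 = 1)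
    (hv : v * a = a * (v⁻¹ * (u ^ (2 * r) * v ^ (2 * r)) * ζ)) (hδ : δ ∈ Subgroup.center G)
    (hδ2 : δ ^ 2 = 1) (huv : v * u = u * v * δ) : u ^ (4 * r) * v ^ (4 * r) = 1 := by
  have hcen : ∀ {x : G}, x ∈ Subgroup.center G → ∀ y, Commute x y := fun hx y =>
    (Subgroup.mem_center_iff.1 hx y).symm
  rw [sq] at hδ2
  have h1 : Commute (u ^ 2) v := by
    have : v * (u * u) = u * u * v := by
      calc v * (u * u) = (v * u) * u := (mul_assoc _ _ _).symm
        _ = u * v * u * δ := by rw [huv, mul_assoc, (hcen hδ u).eq]; simp only [mul_assoc]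
        _ = u * u * v * (δ * δ) := by rw [mul_assoc u v u, huv]; simp only [mul_assoc]
        _ = u * u * v := by rw [hδ2, mul_one]
    rw [sq]; exact this.symm
  have h2 : Commute (v ^ 2) u := by
    have : (v * v) * u = u * (v * v) := by
      calc (v * v) * u = v * (v * u) := mul_assoc _ _ _
        _ = v * (u * v * δ) := by rw [huv]
        _ = (v * u) * (v * δ) := by simp only [mul_assoc]
        _ = u * v * (δ * v) * δ := by rw [huv]; simp only [mul_assoc]
        _ = u * (v * v) * (δ * δ) := by rw [(hcen hδ v).eq]; simp only [mul_assoc]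
        _ = u * (v * v) := by rw [hδ2, mul_one]
    rw [sq]; exact this
  set U := u ^ (2 * r) with hU
  set V := v ^ (2 * r) with hV
  have hUU : u ^ (4 * r) = U ^ 2 := by rw [hU, ← pow_mul]; congr 1; ring
  have hVV : v ^ (4 * r) = V ^ 2 := by rw [hV, ← pow_mul]; congr 1; ring
  rw [hUU] at hα hα2 ⊢
  rw [hVV] at hβ hβ2 ⊢
  have hUv : Commute U v := by rw [hU, pow_mul]; exact h1.pow_left _
  have hUV : Commute U V := hUv.pow_right _
  have hVv : Commute V v := (Commute.refl v).pow_left _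
  have hzv : Commute (U * V) v := hUv.mul_left hVv
  have hz2 : (U * V) ^ 2 = U ^ 2 * V ^ 2 := hUV.mul_pow 2
  set w := (U ^ 2 * V ^ 2) ^ r with hw
  have hwc : w ∈ Subgroup.center G := Subgroup.pow_mem _ (Subgroup.mul_mem _ hα hβ) _
  -- Conjugation by `a` fixes `u = a ^ 2`, and its square is conjugation by `u`; computing `f (f v)`
  -- both ways gives `e1`.
  let f : G →* G := (MulAut.conj a⁻¹).toMonoidHom
  have hf : ∀ x, f x = a⁻¹ * x * a := fun x => by simp [f]
  have hfc : ∀ {x}, x ∈ Subgroup.center G → f x = x := fun hx => by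
    rw [hf, mul_assoc, (hcen hx a).eq, inv_mul_cancel_left]
  have hfv : f v = v⁻¹ * (U * V) * ζ := by rw [hf, mul_assoc, hv, inv_mul_cancel_left]
  have hfu : f u = u := by rw [hf, hu, sq]; group
  have hfV : f V = V⁻¹ * w := by
    have h3 : Commute (v⁻¹ * (U * V)) ζ := (hcen hζ _).symm
    rw [hV, map_pow, hfv, h3.mul_pow, (hzv.symm.inv_left).mul_pow, pow_mul (U * V), hz2, pow_mul ζ,
      hζ2, one_pow, mul_one, inv_pow]
  have hffv : f (f v) = v * ((V ^ 2)⁻¹ * w) := by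
    rw [hfv, map_mul, map_mul, map_mul, map_inv, hfv, hfV, hfc hζ, hU, map_pow, hfu, ← hU]
    have h4 : (U * V)⁻¹ * v = v * (U * V)⁻¹ := hzv.inv_left
    have h5 : (v⁻¹ * (U * V) * ζ)⁻¹ = v * (U * V)⁻¹ * ζ⁻¹ := by
      rw [← h4, ← (hcen hζ _).eq]; group
    calc (v⁻¹ * (U * V) * ζ)⁻¹ * (U * (V⁻¹ * w)) * ζ
        = v * (U * V)⁻¹ * (ζ⁻¹ * ((U * (V⁻¹ * w)) * ζ)) := by rw [h5]; simp only [mul_assoc]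
      _ = v * (U * V)⁻¹ * (U * (V⁻¹ * w)) := by rw [← (hcen hζ _).eq, inv_mul_cancel_left]
      _ = v * ((V ^ 2)⁻¹ * w) := by group
  have hffv' : f (f v) = u⁻¹ * v * u := by
    rw [hf, hf, hu, sq]; simp only [mul_inv_rev, mul_assoc]
  have e1 : v * u = u * (v * ((V ^ 2)⁻¹ * w)) := by
    rw [← hffv, hffv']; group
  have hτU : τ U = V := by rw [hU, map_pow, hτu]
  have hτV : τ V = U := by rw [hV, map_pow, hτv]
  have hτw : τ w = w := by
    rw [hw, map_pow, map_mul, map_pow _ U, map_pow _ V, hτU, hτV, (hcen hβ _).eq]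
  -- The mirror image of `e1` under `τ`. Together they give `(V ^ 2)⁻¹ * w * ((U ^ 2)⁻¹ * w) = 1`,
  -- and `w * w = 1`.
  have e2 : u * v = v * (u * ((U ^ 2)⁻¹ * w)) := by
    have := congrArg τ e1
    simpa only [map_mul, map_inv, map_pow, hτu, hτv, hτU, hτV, hτw] using this
  have hww : w * w = 1 := by
    rw [hw, ← sq, ← pow_mul, mul_comm, pow_mul, (hcen hα _).mul_pow, hα2, hβ2, one_mul, one_pow]
  have e3 : (V ^ 2)⁻¹ * w * ((U ^ 2)⁻¹ * w) = 1 := by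
    have h6 : u * v = u * v * ((V ^ 2)⁻¹ * w * ((U ^ 2)⁻¹ * w)) := by
      calc u * v = v * u * ((U ^ 2)⁻¹ * w) := by rw [mul_assoc]; exact e2
        _ = _ := by rw [e1]; simp only [mul_assoc]
    exact (mul_eq_left.1 h6.symm)
  have e4 : (V ^ 2)⁻¹ * w * ((U ^ 2)⁻¹ * w) = (U ^ 2 * V ^ 2)⁻¹ := by
    rw [mul_assoc, ← mul_assoc w, (hcen hwc _).eq, mul_assoc, hww, mul_one, mul_inv_rev]
  rw [e4, inv_eq_one] at e3
  exact e3

/-- For `n = 4` the squares are central, and `⁅b, a⁆` has the form `a ^ (2 * s) * b ^ (2 * t)` up to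
convention. The transposition forces `s ≡ t` modulo 2: both even gives the first alternative, both
odd the second. -/
theorem IsIsobicyclicTriple.satisfiesG2_two {G : Type*} [Group G] {a b : G}
    (h : IsIsobicyclicTriple (2 ^ 2) a b) :
    (∃ s t : ℤ, b * a = a * b * (a ^ (4 * s) * b ^ (4 * t))) ∨ SatisfiesG2 2 0 0 a b := by
  have hα : a ^ 2 ∈ Subgroup.center G := h.pow_mem_center (e := 1)
  have hβ : b ^ 2 ∈ Subgroup.center G := h.symm.pow_mem_center (e := 1)
  have hab : ∃ s t : ℤ, b * a = a * b * ((a ^ 2) ^ s * (b ^ 2) ^ t) := by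
    obtain ⟨Z, hZc, hZ⟩ := IsIsobicyclicTriple.exists_bottom (e := 1) h
    have hZn : Z.Normal := ⟨fun x hx g => by
      rw [Subgroup.mem_center_iff.1 (hZc hx) g]; simpa using hx⟩
    -- The quotient triple has `n = 2`, where `a` is itself the central involution.
    have hq := (IsIsobicyclicTriple.quotient (e := 1) h hZ hZc).pow_mem_center (e := 0)
    have h1 := Subgroup.mem_center_iff.1 hq b
    simp only [pow_zero, pow_one] at h1
    have h2 : ((a * b : G) : G ⧸ Z) = ((b * a : G) : G ⧸ Z) := h1.symm
    rw [QuotientGroup.eq] at h2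
    obtain ⟨s, t, hst⟩ := (hZ _).1 h2
    refine ⟨s, t, ?_⟩
    rw [inv_mul_eq_iff_eq_mul] at hst
    rw [hst, ← zpow_natCast, ← zpow_natCast, ← zpow_mul, ← zpow_mul]
    norm_num
  obtain ⟨s, t, hst⟩ := hab
  have ha4 : (a ^ 2) ^ (2 : ℤ) = 1 := by
    have := h.pow_left
    norm_cast
    rw [← pow_mul]; simpa using this
  have hb4 : (b ^ 2) ^ (2 : ℤ) = 1 := by
    have := h.symm.pow_left
    norm_cast
    rw [← pow_mul]; simpa using this
  have hpar : Even (s + t) := by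
    obtain ⟨τ, ha, hb⟩ := h.transposes
    have h1 := congrArg τ hst
    simp only [map_mul, map_zpow, map_pow, ha, hb] at h1
    have h2 : (a ^ 2) ^ s * (b ^ 2) ^ t * ((b ^ 2) ^ s * (a ^ 2) ^ t) = 1 := by
      rw [hst, mul_assoc, mul_assoc, eq_comm] at h1
      have := mul_left_cancel h1
      exact mul_eq_left.1 this
    have h3 : (a ^ 2) ^ s * (b ^ 2) ^ t * ((b ^ 2) ^ s * (a ^ 2) ^ t) =
        a ^ (2 * (s + t)) * b ^ (2 * (s + t)) := by
      rw [← mul_assoc, mul_assoc _ ((b ^ 2) ^ t), ← zpow_add,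
        mul_assoc, Subgroup.mem_center_iff.1 (Subgroup.zpow_mem _ hα t) ((b ^ 2) ^ (t + s)),
        ← mul_assoc, ← zpow_add, zpow_mul, zpow_mul, add_comm t s]
      norm_cast
    have h4 := (h.dvd_of_eq_one (h3.symm.trans h2)).1
    push_cast at h4
    rw [Int.even_iff]
    omega
  have hpow : ∀ (c : G) (s : ℤ), c ^ (4 * s) = (c ^ 2) ^ (2 * s) := by
    intro c s
    rw [show (4 : ℤ) * s = 2 * (2 * s) by ring, zpow_mul]
    norm_cast
  have ha2 : a ^ 2 = (a ^ 2)⁻¹ := by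
    rw [eq_inv_iff_mul_eq_one, ← sq]; exact_mod_cast ha4
  have hb2 : b ^ 2 = (b ^ 2)⁻¹ := by
    rw [eq_inv_iff_mul_eq_one, ← sq]; exact_mod_cast hb4
  rcases Int.even_or_odd' s with ⟨s', rfl | rfl⟩
  · rcases Int.even_or_odd' t with ⟨t', rfl | rfl⟩
    · exact Or.inl ⟨s', t', by rw [hpow, hpow, hst]⟩
    · rw [Int.even_iff] at hpar; omega
  · rcases Int.even_or_odd' t with ⟨t', rfl | rfl⟩
    · rw [Int.even_iff] at hpar; omega
    · refine Or.inr ⟨h.pow_left, h.symm.pow_left, (Subgroup.mem_center_iff.1 hα _), ?_, ?_, ?_⟩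
      · rw [zpow_add, zpow_add, zpow_mul, zpow_mul, ha4, hb4, one_zpow, one_zpow, one_mul, one_mul,
          zpow_one, zpow_one] at hst
        rw [pow_zero, mul_one, ← hb2, hst]
      · rw [pow_zero, mul_one, ← hb2]; exact (Subgroup.mem_center_iff.1 hβ a).symm
      · rw [pow_zero, mul_one, ← ha2]; exact (Subgroup.mem_center_iff.1 hα b).symm

namespace IsIsobicyclicTriple

variable {e : ℕ} {G : Type*} [Group G] {a b : G}

/-- When `a ^ 2` and `b ^ 2` commute, the structure of the group is determined modulo the central
involutions. -/
theorem satisfiesG2_of_commute (h : IsIsobicyclicTriple (2 ^ (e + 3)) a b)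
    (huv : Commute (a ^ 2) (b ^ 2)) {k s t p q : ℤ} (hk : 2 ∣ (2 : ℤ) ^ e ∨ k = 0)
    (hmul : b * a = a * b * ((a ^ 2) ^ (1 + 2 ^ e * k + 2 * 2 ^ e * s) *
      (b ^ 2) ^ (-1 + 2 ^ e * k + 2 * 2 ^ e * t)))
    (hsq : b ^ 2 * a = a * ((a ^ 2) ^ (2 * 2 ^ e * p) * (b ^ 2) ^ (-1 + 2 * 2 ^ e * q))) :
    ∃ k l : ℕ, k ≤ 1 ∧ l ≤ 1 ∧ SatisfiesG2 (e + 3) k l a b := by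
  obtain ⟨τ, hτa, hτb⟩ := h.transposes
  set u := a ^ 2 with hu
  set v := b ^ 2 with hv
  have hτu : τ u = v := by rw [hu, map_pow, hτa]
  have hτv : τ v = u := by rw [hv, map_pow, hτb]
  set r : ℤ := 2 ^ e with hr
  have hr0 : r ≠ 0 := by positivity
  let P : ℤ → ℤ → G := fun i j => u ^ i * v ^ j
  have hPdef : ∀ i j, u ^ i * v ^ j = P i j := fun _ _ => rfl
  have hPmul : ∀ i j i' j', P i j * P i' j' = P (i + i') (j + j') := by
    intro i j i' j'
    simp only [P]
    rw [zpow_add, zpow_add, mul_assoc, mul_assoc, ← mul_assoc (v ^ j), ← mul_assoc (u ^ i'),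
      (huv.zpow_zpow i' j).eq]
  have hPpow : ∀ i j (m : ℤ), P i j ^ m = P (i * m) (j * m) := by
    intro i j m
    simp only [P]
    rw [(huv.zpow_zpow i j).mul_zpow, zpow_mul, zpow_mul]
  have hPu : u = P 1 0 := by simp [P]
  have hPv : v = P 0 1 := by simp [P]
  -- The generators have order `8 * r`, so exponents of `u` and `v` count modulo `4 * r`.
  have hPone : ∀ i j, P i j = 1 ↔ 4 * r ∣ i ∧ 4 * r ∣ j := by
    have hrr : ((2 ^ (e + 3) : ℕ) : ℤ) = 2 * (4 * r) := by rw [hr]; push_cast; ring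
    have hP2 : ∀ i j, P i j = a ^ (2 * i) * b ^ (2 * j) := by
      intro i j
      simp only [P, hu, hv, zpow_mul]
      norm_cast
    intro i j
    rw [hP2]
    constructor
    · intro hij
      have := h.dvd_of_eq_one hij
      rw [hrr] at this
      exact ⟨(mul_dvd_mul_iff_left two_ne_zero).1 this.1,
        (mul_dvd_mul_iff_left two_ne_zero).1 this.2⟩
    · rintro ⟨hi, hj⟩
      have h1 : a ^ (2 * i) = 1 := by
        rw [← orderOf_dvd_iff_zpow_eq_one, h.orderOf_left, hrr]
        exact mul_dvd_mul_left _ hi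
      have h2 : b ^ (2 * j) = 1 := by
        rw [← orderOf_dvd_iff_zpow_eq_one, h.orderOf_right, hrr]
        exact mul_dvd_mul_left _ hj
      rw [h1, h2, one_mul]
  have hPeq : ∀ i j i' j', P i j = P i' j' ↔ 4 * r ∣ i - i' ∧ 4 * r ∣ j - j' := by
    intro i j i' j'
    rw [← hPone, sub_eq_add_neg, sub_eq_add_neg, ← hPmul, ← mul_inv_eq_one]
    have : P (-i') (-j') = (P i' j')⁻¹ := by
      rw [← zpow_neg_one, hPpow]; simp
    rw [this]
  have hτP : ∀ i j, τ (P i j) = P j i := by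
    intro i j
    simp only [P, map_mul, map_zpow, hτu, hτv]
    exact ((huv.zpow_zpow _ _).eq).symm
  rw [hPdef] at hmul hsq
  -- conjugation by `b`
  have hsq' : u * b = b * P (-1 + 2 * r * q) (2 * r * p) := by
    have := congrArg τ hsq
    rwa [map_mul, map_mul, hτP, hτa, hτv] at this
  have hconj : ∀ i j, P i j * b = b * P (i * (-1 + 2 * r * q)) (i * (2 * r * p) + j) := by
    intro i j
    have h1 : P i j = u ^ i * v ^ j := rfl
    have h2 : v * b = b * v := by rw [hv]; exact ((Commute.refl b).pow_left 2).eq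
    have h3 : SemiconjBy b v v := h2.symm
    have h4 : SemiconjBy b (P (-1 + 2 * r * q) (2 * r * p)) u := hsq'.symm
    have h5 := (h4.zpow_right i).mul_right (h3.zpow_right j)
    rw [h1, ← h5.eq, hPpow]
    have h6 : v ^ j = P 0 j := by simp [P]
    rw [h6, hPmul]
    congr 2 <;> ring
  -- Applying `τ` to `hmul` and substituting `hmul` back yields `P i j * P j i = 1` for its
  -- exponents.
  have hcomp : 4 * r ∣ (1 + r * k + 2 * r * s) + (-1 + r * k + 2 * r * t) := by
    have h1 := congrArg τ hmul
    rw [map_mul, map_mul, map_mul, hτa, hτb, hτP, hmul, mul_assoc, hPmul] at h1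
    have h2 := (hPone _ _).1 (mul_eq_left.1 h1.symm)
    exact h2.1
  -- Carrying `b ^ 2` past `a` one factor at a time must agree with `hsq`.
  have hb2 : 4 * r ∣ 2 * r * p - ((1 + r * k + 2 * r * s) * (-1 + 2 * r * q) +
        (1 + r * k + 2 * r * s)) ∧
      4 * r ∣ (-1 + 2 * r * q) - (1 + ((1 + r * k + 2 * r * s) * (2 * r * p) +
        (-1 + r * k + 2 * r * t)) + (-1 + r * k + 2 * r * t)) := by
    have h1 : b ^ 2 * a = a * P ((1 + r * k + 2 * r * s) * (-1 + 2 * r * q) +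
        (1 + r * k + 2 * r * s)) (1 + ((1 + r * k + 2 * r * s) * (2 * r * p) +
        (-1 + r * k + 2 * r * t)) + (-1 + r * k + 2 * r * t)) := by
      calc b ^ 2 * a = b * (b * a) := by rw [sq, mul_assoc]
        _ = b * (a * b * P (1 + r * k + 2 * r * s) (-1 + r * k + 2 * r * t)) := by rw [hmul]
        _ = (b * a) * b * P (1 + r * k + 2 * r * s) (-1 + r * k + 2 * r * t) := by
          simp only [mul_assoc]
        _ = a * b * (P (1 + r * k + 2 * r * s) (-1 + r * k + 2 * r * t) * b) *
            P (1 + r * k + 2 * r * s) (-1 + r * k + 2 * r * t) := by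
          rw [hmul]; simp only [mul_assoc]
        _ = a * (b * b) * (P ((1 + r * k + 2 * r * s) * (-1 + 2 * r * q))
            ((1 + r * k + 2 * r * s) * (2 * r * p) + (-1 + r * k + 2 * r * t)) *
            P (1 + r * k + 2 * r * s) (-1 + r * k + 2 * r * t)) := by
          rw [hconj]; simp only [mul_assoc]
        _ = _ := by
          rw [hPmul, ← sq, ← hv, hPv, mul_assoc, hPmul]
          congr 2 <;> ring
    rw [← hv, hsq] at h1
    exact (hPeq _ _ _ _).1 (mul_left_cancel h1)
  have h2r : ∀ {x y : ℤ}, 4 * r ∣ x → x = 2 * r * y → 2 ∣ y := by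
    rintro x y hx rfl
    rw [show 4 * r = 2 * r * 2 by ring] at hx
    exact (mul_dvd_mul_iff_left (by positivity)).1 hx
  -- parities of the exponents
  have p1 : 2 ∣ k + s + t := h2r hcomp (by ring)
  have p2 : 2 ∣ p - (1 + r * k + 2 * r * s) * q := h2r hb2.1 (by ring)
  have p3 : 2 ∣ q - ((1 + r * k + 2 * r * s) * p + k + 2 * t) := h2r hb2.2 (by ring)
  have hodd : 2 ∣ r * k := by
    rcases hk with hk | hk
    · exact hk.mul_right k
    · rw [hk, mul_zero]; exact dvd_zero 2
  obtain ⟨c, hc⟩ := hodd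
  have q1 : 2 ∣ p - q := by
    obtain ⟨x, hx⟩ := p2
    exact ⟨x + (c + r * s) * q, by linear_combination hx + q * hc⟩
  -- `p3` says `q ≡ p + k` modulo 2, while `q1` says `p ≡ q`.
  have q2 : 2 ∣ k := by
    have h1 : 2 ∣ q - (p + k) := by
      obtain ⟨x, hx⟩ := p3
      exact ⟨x + (c + r * s) * p + t, by linear_combination hx + p * hc⟩
    omega
  obtain ⟨k', rfl⟩ := q2
  have hz : a ^ (2 ^ (e + 3) / 2) * b ^ (2 ^ (e + 3) / 2) = P (2 * r) (2 * r) := by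
    have h1 : 2 ^ (e + 3) / 2 = 2 * (2 * 2 ^ e) := by
      rw [pow_succ, Nat.mul_div_cancel _ (by norm_num)]; ring
    rw [h1, pow_mul a, pow_mul b, ← hu, ← hv]
    simp only [P, hr]
    norm_cast
  have hzpow : ∀ m : ℕ, P (2 * r) (2 * r) ^ m = P (2 * r * m) (2 * r * m) := fun m => by
    rw [← zpow_natCast, hPpow]
  have hvi : v⁻¹ = P 0 (-1) := by simp [P]
  have hui : u⁻¹ = P (-1) 0 := by simp [P]
  have hmod : ∀ x y : ℤ, 2 ∣ x - y → 4 * r ∣ 2 * r * x - 2 * r * y := by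
    rintro x y ⟨d, hd⟩
    exact ⟨d, by rw [← mul_sub, hd]; ring⟩
  -- The new parameters are the residues of `p` and of `k' + s` modulo 2; by `q1` and `p1`, the
  -- exponents `q` and `k' + t` of `v` give the same residues.
  obtain ⟨l, hl1, hl2⟩ : ∃ l : ℕ, l ≤ 1 ∧ (2 : ℤ) ∣ p - l :=
    ⟨(p % 2).toNat, by omega, by omega⟩
  obtain ⟨m, hm1, hm2⟩ : ∃ m : ℕ, m ≤ 1 ∧ (2 : ℤ) ∣ (k' + s) - m :=
    ⟨((k' + s) % 2).toNat, by omega, by omega⟩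
  have hl3 : (2 : ℤ) ∣ q - l := by omega
  have hm3 : (2 : ℤ) ∣ (k' + t) - m := by omega
  refine ⟨m, l, hm1, hl1, h.pow_left, h.symm.pow_left, huv.symm, ?_, ?_, ?_⟩
  · rw [hz, hzpow, ← hv, ← hu, hmul, hvi, hPu, hPmul, hPmul]
    congr 1
    rw [hPeq]
    constructor
    · convert hmod _ _ hm2 using 1; ring
    · convert hmod _ _ hm3 using 1; ring
  · rw [hz, hzpow, ← hv, hsq, hvi, hPmul]
    congr 1
    rw [hPeq]
    constructor
    · convert hmod _ _ hl2 using 1; ring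
    · convert hmod _ _ hl3 using 1; ring
  · rw [hz, hzpow, ← hu, hsq', hui, hPmul]
    congr 1
    rw [hPeq]
    constructor
    · convert hmod _ _ hl3 using 1; ring
    · convert hmod _ _ hl2 using 1; ring

end IsIsobicyclicTriple

theorem Commute.zpow_mul_zpow_mul {G : Type*} [Group G] {u v : G} (h : Commute u v)
    (i j i' j' : ℤ) : u ^ i * v ^ j * (u ^ i' * v ^ j') = u ^ (i + i') * v ^ (j + j') := by
  rw [zpow_add, zpow_add, mul_assoc, mul_assoc, ← mul_assoc (v ^ j), ← mul_assoc (u ^ i'),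
    (h.zpow_zpow i' j).eq]

/-! ### Lifting the relations through central quotients. -/

namespace IsIsobicyclicTriple

/-- An isobicyclic 2-group either is abelian modulo `⟨a ^ 4⟩⟨b ^ 4⟩` or satisfies the relations of
some `G₂(e; k, l)`. -/
theorem commute_or_satisfiesG2 (e : ℕ) {G : Type*} [Group G] {a b : G}
    (h : IsIsobicyclicTriple (2 ^ (e + 2)) a b) :
    (∃ s t : ℤ, b * a = a * b * (a ^ (4 * s) * b ^ (4 * t))) ∨
      ∃ k l : ℕ, k ≤ 1 ∧ l ≤ 1 ∧ (e = 0 → k = 0 ∧ l = 0) ∧ SatisfiesG2 (e + 2) k l a b := by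
  induction e generalizing G with
  | zero =>
    refine h.satisfiesG2_two.imp_right fun h2 => ⟨0, 0, by norm_num, by norm_num, fun _ => ⟨rfl, rfl⟩, h2⟩
  | succ e ih =>
    obtain ⟨Z, hZc, hZ⟩ := IsIsobicyclicTriple.exists_bottom (e := e + 2) h
    have hZn : Z.Normal := ⟨fun x hx g => by
      rw [Subgroup.mem_center_iff.1 (hZc hx) g]; simpa using hx⟩
    have hcen : ∀ {x : G}, x ∈ Subgroup.center G → ∀ y, Commute x y := fun hx y =>
      (Subgroup.mem_center_iff.1 hx y).symm
    have lift : ∀ x y : G, (x : G ⧸ Z) = y → ∃ ζ ∈ Z, x = y * ζ := by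
      intro x y hxy
      exact ⟨y⁻¹ * x, QuotientGroup.eq.1 hxy.symm, by group⟩
    rcases ih (h.quotient hZ hZc) with ⟨s, t, hst⟩ | ⟨k, l, hk, hl, hkl, hQ⟩
    · refine Or.inl ?_
      obtain ⟨ζ, hζ, hba⟩ := lift (b * a) (a * b * (a ^ (4 * s) * b ^ (4 * t))) hst
      obtain ⟨s', t', rfl⟩ := (hZ _).1 hζ
      refine ⟨s + 2 ^ e * s', t + 2 ^ e * t', ?_⟩
      have h1 : ∀ x : ℤ, 4 * ((2 : ℤ) ^ e * x) = 2 ^ (e + 2) * x := by intro x; ring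
      have h2 : a ^ ((2 : ℤ) ^ (e + 2) * s') ∈ Subgroup.center G :=
        hZc ((hZ _).2 ⟨s', 0, by simp⟩)
      rw [hba, mul_add, mul_add, h1, h1, zpow_add, zpow_add, mul_assoc (a * b)]
      congr 1
      rw [mul_assoc, mul_assoc, ← mul_assoc (b ^ _) (a ^ _), ← (hcen h2 _).eq]
      simp only [mul_assoc]
    · refine Or.inr ?_
      set u := a ^ 2 with hu
      set v := b ^ 2 with hv
      have hm : 2 ^ (e + 2) / 2 = 2 * 2 ^ e := by
        rw [pow_succ, Nat.mul_div_cancel _ (by norm_num)]; ring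
      have hz : ∀ c : G, c ^ (2 ^ (e + 2) / 2) = (c ^ 2) ^ 2 ^ e := by
        intro c; rw [hm, pow_mul]
      obtain ⟨δ, hδ, h1⟩ := lift (v * u) (u * v) hQ.comm
      obtain ⟨ζ, hζ, h2⟩ := lift (b * a) (a * b * (u * v⁻¹ * (u ^ 2 ^ e * v ^ 2 ^ e) ^ k)) (by
        rw [hu, hv, ← hz, ← hz]; exact hQ.mul_eq)
      obtain ⟨ξ, hξ, h3⟩ := lift (v * a) (a * (v⁻¹ * (u ^ 2 ^ e * v ^ 2 ^ e) ^ l)) (by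
        rw [hu, hv, ← hz, ← hz]; exact hQ.sq_mul_left)
      have hsq : ∀ x ∈ Z, x ^ 2 = 1 := by
        intro x hx
        obtain ⟨s, t, rfl⟩ := (hZ _).1 hx
        have h4 : b ^ ((2 : ℤ) ^ (e + 2) * t) ∈ Subgroup.center G :=
          hZc ((hZ _).2 ⟨0, t, by simp⟩)
        have h5 : ∀ (c : G) (s : ℤ), (c ^ ((2 : ℤ) ^ (e + 2) * s)) ^ 2 = (c ^ 2 ^ (e + 3)) ^ s := by
          intro c s
          rw [← zpow_natCast, ← zpow_mul, ← zpow_natCast, ← zpow_mul]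
          congr 1
          push_cast
          ring
        rw [(hcen h4 _).symm.mul_pow, h5, h5, h.pow_left, h.symm.pow_left, one_zpow, one_zpow,
          one_mul]
      -- For `l = 1`, `twist_eq_one` would make the product of the two central involutions trivial,
      -- against `⟨a⟩ ∩ ⟨b⟩ = 1`.
      have hl0 : l = 0 := by
        by_contra hl0
        obtain rfl : l = 1 := by omega
        obtain ⟨e, rfl⟩ : ∃ e', e = e' + 1 := Nat.exists_eq_succ_of_ne_zero fun he =>
          hl0 (hkl he).2
        obtain ⟨τ, hτa, hτb⟩ := h.transposes
        have hpow : ∀ c : G, (c ^ 2) ^ (4 * 2 ^ e) = c ^ 2 ^ (e + 3) := by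
          intro c; rw [← pow_mul]; congr 1; ring
        have hpow2 : ∀ c : G, ((c ^ 2) ^ (4 * 2 ^ e)) ^ 2 = c ^ 2 ^ (e + 4) := by
          intro c; rw [hpow, ← pow_mul, ← pow_succ]
        have h4 := twist_eq_one (τ := τ.toMonoidHom) (r := 2 ^ e) (u := u) (v := v) (a := a)
          (ζ := ξ) (δ := δ) (by simp [hu, hv, hτa]) (by simp [hu, hv, hτb]) hu
          (by rw [hu, hpow]; exact h.pow_mem_center (e := e + 3))
          (by rw [hv, hpow]; exact h.symm.pow_mem_center (e := e + 3))
          (by rw [hu, hpow2]; exact h.pow_left) (by rw [hv, hpow2]; exact h.symm.pow_left)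
          (hZc hξ) (hsq _ hξ) (by
            rw [pow_one, pow_succ, mul_comm (2 ^ e) 2] at h3
            rw [h3]; simp only [mul_assoc]) (hZc hδ) (hsq _ hδ) h1
        have h5 : a ^ (2 ^ (e + 3) : ℤ) * b ^ (2 ^ (e + 3) : ℤ) = 1 := by
          rw [hu, hv, hpow, hpow] at h4
          exact_mod_cast h4
        have h6 := (h.dvd_of_eq_one h5).1
        have h7 := Int.le_of_dvd (by positivity) h6
        push_cast at h7
        rw [show e + 1 + 1 + 2 = (e + 3) + 1 by ring, pow_succ] at h7
        have : (0 : ℤ) < 2 ^ (e + 3) := by positivity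
        linarith
      subst hl0
      rw [pow_zero, mul_one] at h3
      -- Conjugation by `a` inverts `v` up to the central `ξ`, so applying it twice, which is
      -- conjugation by `u`, fixes `v`.
      have huv : Commute u v := by
        let f : G →* G := (MulAut.conj a⁻¹).toMonoidHom
        have hf : ∀ x, f x = a⁻¹ * x * a := fun x => by simp [f]
        have hfv : f v = v⁻¹ * ξ := by
          rw [hf, mul_assoc, h3, mul_assoc, inv_mul_cancel_left]
        have hfξ : f ξ = ξ := by
          rw [hf, mul_assoc, (hcen (hZc hξ) a).eq, inv_mul_cancel_left]
        have hffv : f (f v) = v := by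
          rw [hfv, map_mul, map_inv, hfv, hfξ, mul_inv_rev, inv_inv, mul_assoc,
            ← (hcen (hZc hξ) v).eq, inv_mul_cancel_left]
        rw [hf, hf] at hffv
        have h4 : u⁻¹ * v * u = v := by
          conv_rhs => rw [← hffv]
          rw [hu, sq]; simp only [mul_inv_rev, mul_assoc]
        rw [mul_assoc, inv_mul_eq_iff_eq_mul] at h4
        exact h4.symm
      obtain ⟨s, t, rfl⟩ := (hZ _).1 hζ
      obtain ⟨p, q, rfl⟩ := (hZ _).1 hξ
      have hpow : ∀ (c : G) (s : ℤ), c ^ ((2 : ℤ) ^ (e + 2) * s) = (c ^ 2) ^ (2 * 2 ^ e * s) := by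
        intro c s
        rw [show (2 : ℤ) ^ (e + 2) * s = 2 * (2 * 2 ^ e * s) by ring, zpow_mul]
        norm_cast
      rw [hpow, hpow, ← hu, ← hv] at h2 h3
      have h4 : (u ^ 2 ^ e * v ^ 2 ^ e) ^ k = u ^ ((2 : ℤ) ^ e * k) * v ^ ((2 : ℤ) ^ e * k) := by
        rw [(huv.pow_pow _ _).mul_pow, ← pow_mul u, ← pow_mul v]
        norm_cast
      have h5 := huv.zpow_mul_zpow_mul 1 (-1) (2 ^ e * k) (2 ^ e * k)
      rw [zpow_one, zpow_neg_one, ← h4] at h5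
      have h6 := huv.zpow_mul_zpow_mul 0 (-1) (2 * 2 ^ e * p) (2 * 2 ^ e * q)
      rw [zpow_zero, one_mul, zpow_neg_one, zero_add] at h6
      obtain ⟨k', l', hk', hl', hG⟩ := h.satisfiesG2_of_commute huv (k := k) (s := s) (t := t)
        (p := p) (q := q) (by
          rcases Nat.eq_zero_or_pos e with he | he
          · exact Or.inr (by exact_mod_cast (hkl he).1)
          · exact Or.inl (dvd_pow_self 2 he.ne'))
        (by rw [h2, h5, mul_assoc (a * b), huv.zpow_mul_zpow_mul])
        (by rw [← h6, ← mul_assoc]; exact h3)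
      exact ⟨k', l', hk', hl', fun he => absurd he (Nat.succ_ne_zero e), hG⟩

end IsIsobicyclicTriple

/-! ### Metacyclic groups -/

theorem IsMetacyclic.of_surjective {G H : Type*} [Group G] [Group H] (hG : IsMetacyclic G)
    (f : G →* H) (hf : Function.Surjective f) : IsMetacyclic H := by
  obtain ⟨N, hN, hc, hq⟩ := hG
  have hM : (N.map f).Normal := hN.map f hf
  refine ⟨N.map f, hM, ?_, ?_⟩
  · exact isCyclic_of_surjective (f.subgroupMap N) (f.subgroupMap_surjective N)
  · refine isCyclic_of_surjective (QuotientGroup.map N (N.map f) f (Subgroup.le_comap_map f N)) ?_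
    intro q
    obtain ⟨x, rfl⟩ := QuotientGroup.mk_surjective q
    obtain ⟨g, rfl⟩ := hf x
    exact ⟨g, rfl⟩

/-- A cyclic group has at most one involution. -/
theorem IsCyclic.eq_one_of_sq_eq_one {C : Type*} [Group C] [IsCyclic C] {x y : C}
    (hx : x ^ 2 = 1) (hy : y ^ 2 = 1) : x = 1 ∨ y = 1 ∨ x * y = 1 := by
  obtain ⟨g, hg⟩ := IsCyclic.exists_generator (α := C)
  obtain ⟨i, rfl⟩ := hg x
  obtain ⟨j, rfl⟩ := hg y
  simp only at *
  have hx' : g ^ (i * 2) = 1 := by rw [zpow_mul]; exact_mod_cast hx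
  have hy' : g ^ (j * 2) = 1 := by rw [zpow_mul]; exact_mod_cast hy
  rw [← zpow_add]
  simp only [← orderOf_dvd_iff_zpow_eq_one] at *
  obtain ⟨c, hc⟩ := hx'
  obtain ⟨d, hd⟩ := hy'
  rcases Int.even_or_odd' c with ⟨c, rfl | rfl⟩
  · exact Or.inl ⟨c, by linarith⟩
  · rcases Int.even_or_odd' d with ⟨d, rfl | rfl⟩
    · exact Or.inr (Or.inl ⟨d, by linarith⟩)
    · exact Or.inr (Or.inr ⟨c + d + 1, by linarith⟩)

/-- A metacyclic group contains no elementary abelian subgroup of order 8. -/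
theorem IsMetacyclic.eq_one_of_sq_eq_one {G : Type*} [Group G] (hG : IsMetacyclic G) {x y w : G}
    (hx : x ^ 2 = 1) (hy : y ^ 2 = 1) (hw : w ^ 2 = 1) (hxy : Commute x y) (hxw : Commute x w)
    (hyw : Commute y w) :
    x = 1 ∨ y = 1 ∨ x * y = 1 ∨ w = 1 ∨ x * w = 1 ∨ y * w = 1 ∨ x * y * w = 1 := by
  obtain ⟨N, hN, hc, hq⟩ := hG
  have hQ : ∀ {s t : G}, s ^ 2 = 1 → t ^ 2 = 1 → s ∈ N ∨ t ∈ N ∨ s * t ∈ N := by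
    intro s t hs ht
    have := IsCyclic.eq_one_of_sq_eq_one (C := G ⧸ N) (x := s) (y := t)
      (by rw [← QuotientGroup.mk_pow, hs]; rfl) (by rw [← QuotientGroup.mk_pow, ht]; rfl)
    simpa only [← QuotientGroup.mk_mul, QuotientGroup.eq_one_iff] using this
  have hC : ∀ {s t : G}, s ∈ N → t ∈ N → s ^ 2 = 1 → t ^ 2 = 1 → s = 1 ∨ t = 1 ∨ s * t = 1 := by
    intro s t hs ht hs2 ht2
    have := IsCyclic.eq_one_of_sq_eq_one (C := N) (x := ⟨s, hs⟩) (y := ⟨t, ht⟩)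
      (Subtype.ext hs2) (Subtype.ext ht2)
    exact this.imp (congrArg Subtype.val) (Or.imp (congrArg Subtype.val) (congrArg Subtype.val))
  have hxy2 : (x * y) ^ 2 = 1 := by rw [hxy.mul_pow, hx, hy, one_mul]
  have hxw2 : (x * w) ^ 2 = 1 := by rw [hxw.mul_pow, hx, hw, one_mul]
  have hyw2 : (y * w) ^ 2 = 1 := by rw [hyw.mul_pow, hy, hw, one_mul]
  have hxx : x * x = 1 := by rw [← sq, hx]
  have e1 : y * x = x * y := hxy.eq.symm
  have e2 : y * (x * w) = x * y * w := by rw [← mul_assoc, e1]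
  have e3 : x * y * x = y := by rw [mul_assoc, e1, ← mul_assoc, hxx, one_mul]
  have e4 : x * y * (x * w) = y * w := by rw [← mul_assoc, e3]
  have e5 : x * (y * w) = x * y * w := (mul_assoc _ _ _).symm
  rcases hQ hx hy with hp | hp | hp
  · rcases hQ hy hw with hq | hq | hq
    · have := hC hp hq hx hy; tauto
    · have := hC hp hq hx hw; tauto
    · have := hC hp hq hx hyw2; rw [e5] at this; tauto
  · rcases hQ hx hw with hq | hq | hq
    · have := hC hp hq hy hx; rw [e1] at this; tauto
    · have := hC hp hq hy hw; tauto
    · have := hC hp hq hy hxw2; rw [e2] at this; tauto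
  · rcases hQ hx hw with hq | hq | hq
    · have := hC hp hq hxy2 hx; rw [e3] at this; tauto
    · have := hC hp hq hxy2 hw; tauto
    · have := hC hp hq hxy2 hxw2; rw [e4] at this; tauto

/-! ### The groups `G₂(e; k, l)` -/

namespace SatisfiesG2

variable {e k l : ℕ} {G : Type*} [Group G] {a b : G}

theorem map (h : SatisfiesG2 e k l a b) {H : Type*} [Group H] (f : G →* H) :
    SatisfiesG2 e k l (f a) (f b) where
  pow_left := by rw [← map_pow, h.pow_left, map_one]
  pow_right := by rw [← map_pow, h.pow_right, map_one]
  comm := by rw [← map_pow, ← map_pow]; exact h.comm.map f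
  mul_eq := by simpa only [map_mul, map_pow, map_inv] using congrArg f h.mul_eq
  sq_mul_left := by simpa only [map_mul, map_pow, map_inv] using congrArg f h.sq_mul_left
  sq_mul_right := by simpa only [map_mul, map_pow, map_inv] using congrArg f h.sq_mul_right

theorem lift_eq_one (h : SatisfiesG2 e k l a b) :
    ∀ r ∈ G2Rels e k l, FreeGroup.lift ![a, b] r = 1 := by
  rintro r (rfl | rfl | rfl | rfl | rfl | rfl)
  · simpa using h.pow_left
  · simpa using h.pow_right
  · simp only [comm', map_mul, map_inv, map_pow, FreeGroup.lift_apply_of, Matrix.cons_val_zero,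
      Matrix.cons_val_one]
    rw [mul_assoc, h.comm.eq]
    group
  · simp only [comm', map_mul, map_inv, map_pow, FreeGroup.lift_apply_of, Matrix.cons_val_zero,
      Matrix.cons_val_one]
    rw [mul_assoc (b⁻¹ * a⁻¹), h.mul_eq]
    group
  · simp only [conj', map_mul, map_inv, map_pow, FreeGroup.lift_apply_of, Matrix.cons_val_zero,
      Matrix.cons_val_one]
    rw [mul_assoc a⁻¹, h.sq_mul_left, inv_mul_cancel_left, mul_inv_cancel]
  · simp only [conj', map_mul, map_inv, map_pow, FreeGroup.lift_apply_of, Matrix.cons_val_zero,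
      Matrix.cons_val_one]
    rw [mul_assoc b⁻¹, h.sq_mul_right, inv_mul_cancel_left, mul_inv_cancel]

/-- The homomorphism from `G₂(e; k, l)` given by two elements satisfying its relations. -/
def lift (h : SatisfiesG2 e k l a b) : G2 e k l →* G := PresentedGroup.toGroup h.lift_eq_one

@[simp] theorem lift_a (h : SatisfiesG2 e k l a b) : h.lift (G2.a e k l) = a :=
  PresentedGroup.toGroup.of h.lift_eq_one

@[simp] theorem lift_b (h : SatisfiesG2 e k l a b) : h.lift (G2.b e k l) = b :=
  PresentedGroup.toGroup.of h.lift_eq_one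

end SatisfiesG2

theorem G2.satisfiesG2 (e k l : ℕ) : SatisfiesG2 e k l (G2.a e k l) (G2.b e k l) := by
  have key : ∀ r ∈ G2Rels e k l, FreeGroup.lift ![G2.a e k l, G2.b e k l] r = 1 := by
    intro r hr
    have h1 : FreeGroup.lift ![G2.a e k l, G2.b e k l] = PresentedGroup.mk (G2Rels e k l) := by
      ext i
      fin_cases i <;> rfl
    rw [h1]
    exact PresentedGroup.one_of_mem hr
  have r1 := key _ (Or.inl rfl)
  have r2 := key _ (Or.inr (Or.inl rfl))
  have r3 := key _ (Or.inr (Or.inr (Or.inl rfl)))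
  have r4 := key _ (Or.inr (Or.inr (Or.inr (Or.inl rfl))))
  have r5 := key _ (Or.inr (Or.inr (Or.inr (Or.inr (Or.inl rfl)))))
  have r6 := key _ (Or.inr (Or.inr (Or.inr (Or.inr (Or.inr rfl)))))
  simp only [comm', conj', map_mul, map_inv, map_pow, FreeGroup.lift_apply_of,
    Matrix.cons_val_zero, Matrix.cons_val_one, mul_inv_eq_one] at r1 r2 r3 r4 r5 r6
  refine ⟨r1, r2, ?_, ?_, ?_, ?_⟩
  · rw [mul_assoc, ← mul_inv_rev, inv_mul_eq_one] at r3
    exact r3.symm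
  · rw [← r4]; group
  · rw [← r5]; group
  · rw [← r6]; group

theorem G2.closure_eq_top (e k l : ℕ) : Subgroup.closure {G2.a e k l, G2.b e k l} = ⊤ := by
  rw [← PresentedGroup.closure_range_of]
  congr 1
  ext x
  simp only [Set.mem_insert_iff, Set.mem_singleton_iff, Set.mem_range, Fin.exists_fin_two]
  exact or_congr eq_comm eq_comm

theorem G2.hom_ext {e k l : ℕ} {H : Type*} [Group H] {f g : G2 e k l →* H}
    (ha : f (G2.a e k l) = g (G2.a e k l)) (hb : f (G2.b e k l) = g (G2.b e k l)) : f = g := by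
  refine PresentedGroup.ext fun i => ?_
  fin_cases i
  · exact ha
  · exact hb

/-! ### Symmetry of the relations and normal forms. -/

namespace SatisfiesG2

variable {e k l : ℕ} {G : Type*} [Group G] {a b : G}

theorem half_eq (e : ℕ) : 2 ^ (e + 2) / 2 = 2 * 2 ^ e := by
  rw [pow_succ, Nat.mul_div_cancel _ (by norm_num)]; ring

theorem commute_z_right (huv : Commute (b ^ 2) (a ^ 2)) :
    Commute (a ^ (2 ^ (e + 2) / 2) * b ^ (2 ^ (e + 2) / 2)) (b ^ 2) := by
  rw [half_eq, pow_mul, pow_mul]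
  exact (huv.symm.pow_left _).mul_left ((Commute.refl _).pow_left _)

theorem commute_z_left (huv : Commute (b ^ 2) (a ^ 2)) :
    Commute (a ^ (2 ^ (e + 2) / 2) * b ^ (2 ^ (e + 2) / 2)) (a ^ 2) := by
  rw [half_eq, pow_mul, pow_mul]
  exact ((Commute.refl _).pow_left _).mul_left (huv.pow_left _)

theorem z_sq (h : SatisfiesG2 (e + 2) k l a b) :
    (a ^ (2 ^ (e + 2) / 2) * b ^ (2 ^ (e + 2) / 2)) ^ 2 = 1 := by
  have hc : Commute (a ^ (2 ^ (e + 2) / 2)) (b ^ (2 ^ (e + 2) / 2)) := by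
    rw [half_eq, pow_mul, pow_mul]
    exact h.comm.symm.pow_pow _ _
  have he : 2 ^ (e + 2) / 2 * 2 = 2 ^ (e + 2) := by rw [half_eq]; ring
  rw [hc.mul_pow, ← pow_mul, ← pow_mul, he, h.pow_left, h.pow_right, one_mul]

/-- Raising the relation to the power `2 ^ e` kills `z ^ l` (for `e = 0` only because `l = 0`), and
what remains of `y` has square 1, so its inversion is invisible. -/
theorem pow_commute_of_semiconjBy {x y z : G} (h : SemiconjBy x ((y ^ 2)⁻¹ * z ^ l) (y ^ 2))
    (hzy : Commute z (y ^ 2)) (hz : z ^ 2 = 1) (hy : y ^ 2 ^ (e + 2) = 1) (hl : e = 0 → l = 0) :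
    Commute (y ^ (2 ^ (e + 2) / 2)) x := by
  have h2 := h.pow_right (2 ^ e)
  have h3 : Commute (y ^ 2)⁻¹ (z ^ l) := ((hzy.pow_left l).symm).inv_left
  have h4 : (z ^ l) ^ 2 ^ e = 1 := by
    rcases Nat.eq_zero_or_pos e with he | he
    · rw [hl he]; simp
    · obtain ⟨c, hc⟩ := dvd_pow_self 2 he.ne'
      rw [hc, ← pow_mul, mul_comm, mul_assoc, pow_mul, hz, one_pow]
  have h5 : ((y ^ 2)⁻¹) ^ 2 ^ e = (y ^ 2) ^ 2 ^ e := by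
    rw [inv_pow, inv_eq_iff_mul_eq_one, ← pow_add, ← pow_mul, ← hy]
    congr 1; ring
  rw [h3.mul_pow, h4, mul_one, h5, ← pow_mul, ← half_eq] at h2
  exact h2.symm

theorem right_pow_commute (h : SatisfiesG2 (e + 2) k l a b) (hl : e = 0 → l = 0) :
    Commute (b ^ (2 ^ (e + 2) / 2)) a :=
  pow_commute_of_semiconjBy h.sq_mul_left.symm (commute_z_right h.comm) h.z_sq h.pow_right hl

theorem left_pow_commute (h : SatisfiesG2 (e + 2) k l a b) (hl : e = 0 → l = 0) :
    Commute (a ^ (2 ^ (e + 2) / 2)) b :=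
  pow_commute_of_semiconjBy h.sq_mul_right.symm (commute_z_left h.comm) h.z_sq h.pow_left hl

/-- The relations are symmetric in the two generators. -/
theorem swap (h : SatisfiesG2 (e + 2) k l a b) (hl : e = 0 → l = 0) :
    SatisfiesG2 (e + 2) k l b a := by
  have hca := h.left_pow_commute hl
  have hcb := h.right_pow_commute hl
  have hz : b ^ (2 ^ (e + 2) / 2) * a ^ (2 ^ (e + 2) / 2) =
      a ^ (2 ^ (e + 2) / 2) * b ^ (2 ^ (e + 2) / 2) := (hca.pow_right _).eq.symm
  refine ⟨h.pow_right, h.pow_left, h.comm.symm, ?_, ?_, ?_⟩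
  · have hm := h.mul_eq
    have hzv := commute_z_right (e := e) h.comm
    have hzu := commute_z_left (e := e) h.comm
    have hz2 := h.z_sq
    rw [hz]
    generalize a ^ (2 ^ (e + 2) / 2) * b ^ (2 ^ (e + 2) / 2) = z at *
    have h1 : (a ^ 2 * (b ^ 2)⁻¹ * z ^ k) * (b ^ 2 * (a ^ 2)⁻¹ * z ^ k) = 1 := by
      have hc : Commute (a ^ 2 * (b ^ 2)⁻¹) (z ^ k) :=
        ((hzu.mul_right hzv.inv_right).pow_left k).symm
      have h2 : z ^ k * z ^ k = 1 := by rw [← pow_add, ← two_mul, pow_mul, hz2, one_pow]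
      rw [hc.eq, mul_assoc, ← mul_assoc (a ^ 2 * (b ^ 2)⁻¹) (b ^ 2 * (a ^ 2)⁻¹)]
      rw [show a ^ 2 * (b ^ 2)⁻¹ * (b ^ 2 * (a ^ 2)⁻¹) = 1 by group, one_mul, h2]
    rw [hm, mul_assoc, h1, mul_one]
  · rw [hz]; exact h.sq_mul_right
  · rw [hz]; exact h.sq_mul_left

/-- Two generators satisfying the relations give a factorisation into cyclic groups. -/
theorem exists_eq (h : SatisfiesG2 (e + 2) k l a b) (hl : e = 0 → l = 0)
    (htop : Subgroup.closure {a, b} = ⊤) (g : G) : ∃ i j : ℤ, g = a ^ i * b ^ j := by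
  have hca := h.left_pow_commute hl
  have hcb := h.right_pow_commute hl
  set N := 2 ^ (e + 2) / 2 with hN
  set z := a ^ N * b ^ N with hz
  have hza : Commute z a := ((Commute.refl a).pow_left N).mul_left hcb
  have hzb : Commute z b := hca.mul_left ((Commute.refl b).pow_left N)
  have key_z : ∀ (m i j : ℤ), ∃ i' j' : ℤ, z ^ m * (a ^ i * b ^ j) = a ^ i' * b ^ j' := by
    intro m i j
    refine ⟨N * m + i, N * m + j, ?_⟩
    have h1 : Commute (a ^ N) (b ^ N) := hca.pow_right N
    rw [hz, h1.mul_zpow, zpow_add, zpow_add, zpow_mul, zpow_mul, zpow_natCast, zpow_natCast]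
    have h2 : (b ^ N) ^ m * a ^ i = a ^ i * (b ^ N) ^ m := (hcb.zpow_zpow m i).eq
    rw [mul_assoc, ← mul_assoc ((b ^ N) ^ m), h2]
    simp only [mul_assoc]
  -- moving `b` across even powers of `a`
  have hbu : SemiconjBy b (a ^ 2) ((a ^ 2)⁻¹ * z ^ l) := by
    have h1 : SemiconjBy b ((a ^ 2)⁻¹ * z ^ l) (a ^ 2) := h.sq_mul_right.symm
    have h2 : SemiconjBy b (z ^ l) (z ^ l) := (hzb.pow_left l).symm
    have h3 := h1.inv_right.mul_right h2
    have h4 : ((a ^ 2)⁻¹ * z ^ l)⁻¹ * z ^ l = a ^ 2 := by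
      have : Commute (a ^ 2)⁻¹ (z ^ l) := ((hza.pow_pow l 2).symm).inv_left
      rw [this.eq]; group
    rwa [h4] at h3
  have key_even : ∀ i j : ℤ, ∃ i' j' : ℤ, b * ((a ^ 2) ^ i * b ^ j) = a ^ i' * b ^ j' := by
    intro i j
    have h1 := (hbu.zpow_right i).eq
    have h2 : Commute (a ^ 2)⁻¹ (z ^ l) := ((hza.pow_pow l 2).symm).inv_left
    rw [h2.mul_zpow] at h1
    obtain ⟨i', j', hij⟩ := key_z (l * i) (2 * (-i)) (1 + j)
    refine ⟨i', j', ?_⟩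
    rw [← hij, ← mul_assoc, h1, zpow_add, zpow_one, zpow_mul, zpow_mul, zpow_natCast,
      (h2.zpow_zpow i i).eq, inv_zpow, zpow_neg]
    norm_cast
    simp only [mul_assoc]
  have key_b : ∀ i j : ℤ, ∃ i' j' : ℤ, b * (a ^ i * b ^ j) = a ^ i' * b ^ j' := by
    intro i j
    rcases Int.even_or_odd' i with ⟨i, rfl | rfl⟩
    · obtain ⟨i', j', hij⟩ := key_even i j
      refine ⟨i', j', ?_⟩
      rw [← hij, zpow_mul]; norm_cast
    -- Rewriting `b * a` brings one `a` to the front; as the squares commute, `b * (a ^ 2) ^ (i + 1)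
    -- * b ^ (j - 2)` remains, up to a power of the central `z`.
    · obtain ⟨i', j', hij⟩ := key_even (i + 1) (-2 + j)
      obtain ⟨i'', j'', hij'⟩ := key_z k (1 + i') j'
      refine ⟨i'', j'', ?_⟩
      have h1 : (b ^ 2)⁻¹ * (a ^ 2) ^ i = (a ^ 2) ^ i * (b ^ 2)⁻¹ :=
        (h.comm.inv_left.zpow_right i).eq
      have h2 : Commute (z ^ (k : ℤ)) (a * b * (a ^ 2 * (b ^ 2)⁻¹)) :=
        ((hza.mul_right hzb).mul_right
          ((hza.pow_right 2).mul_right (hzb.pow_right 2).inv_right)).zpow_left _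
      rw [← hij', zpow_add a 1 i', zpow_one, mul_assoc a, ← hij, add_comm (2 * i), zpow_add a,
        zpow_one, zpow_mul, zpow_add (a ^ 2), zpow_add b, zpow_one, zpow_neg]
      calc b * (a * (a ^ (2 : ℤ)) ^ i * b ^ j)
          = (b * a) * ((a ^ 2) ^ i * b ^ j) := by norm_cast; simp only [mul_assoc]
        _ = (a * b * (a ^ 2 * (b ^ 2)⁻¹)) * z ^ (k : ℤ) * ((a ^ 2) ^ i * b ^ j) := by
          rw [h.mul_eq, zpow_natCast, ← hN, ← hz]; simp only [mul_assoc]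
        _ = z ^ (k : ℤ) * (a * (b * (a ^ 2 * ((b ^ 2)⁻¹ * (a ^ 2) ^ i) * b ^ j))) := by
          rw [← h2.eq]; simp only [mul_assoc]
        _ = z ^ (k : ℤ) * (a * (b * ((a ^ 2) ^ i * a ^ 2 * ((b ^ (2 : ℤ))⁻¹ * b ^ j)))) := by
          rw [h1, ← mul_assoc (a ^ 2) ((a ^ 2) ^ i), (Commute.refl (a ^ 2)).zpow_right i |>.eq]
          norm_cast
          simp only [mul_assoc]
  have key_pow : ∀ (m : ℕ) (i j : ℤ), ∃ i' j' : ℤ, b ^ m * (a ^ i * b ^ j) = a ^ i' * b ^ j' := by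
    intro m
    induction m with
    | zero => intro i j; exact ⟨i, j, by simp⟩
    | succ m ih =>
      intro i j
      obtain ⟨i', j', hij⟩ := key_b i j
      obtain ⟨i'', j'', hij'⟩ := ih i' j'
      exact ⟨i'', j'', by rw [pow_succ, mul_assoc, hij, hij']⟩
  have hg : g ∈ Subgroup.closure {a, b} := by rw [htop]; trivial
  induction hg using Subgroup.closure_induction_left with
  | one => exact ⟨0, 0, by simp⟩
  | mul_left x hx y _ ih =>
    obtain ⟨i, j, rfl⟩ := ih
    rcases hx with rfl | rfl
    · exact ⟨1 + i, j, by rw [zpow_add, zpow_one, mul_assoc]⟩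
    · exact key_b i j
  | inv_mul_cancel x hx y _ ih =>
    obtain ⟨i, j, rfl⟩ := ih
    rcases hx with rfl | rfl
    · exact ⟨-1 + i, j, by rw [zpow_add, zpow_neg_one, mul_assoc]⟩
    -- Finite order turns the inverse into a positive power, so `key_b` can be iterated.
    · have h1 : x⁻¹ = x ^ (2 ^ (e + 2) - 1) := by
        rw [inv_eq_iff_mul_eq_one, ← pow_succ', Nat.sub_add_cancel Nat.one_le_two_pow, h.pow_right]
      rw [h1]
      exact key_pow _ i j

end SatisfiesG2

/-! ### A faithful permutation representation of `G₂(e; k, l)` -/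

/-- These forms of the relations contain no inverses, so permutations can be tested by forward
evaluation; `z` commutes with both squares, which allows the rearrangement. -/
theorem SatisfiesG2.mk_of_mul {e k l : ℕ} {G : Type*} [Group G] {a b : G}
    (ha : a ^ 2 ^ (e + 2) = 1) (hb : b ^ 2 ^ (e + 2) = 1) (hc : Commute (b ^ 2) (a ^ 2))
    (h₁ : b * a * b ^ 2 =
      a * b * a ^ 2 * (a ^ (2 ^ (e + 2) / 2) * b ^ (2 ^ (e + 2) / 2)) ^ k)
    (h₂ : b ^ 2 * a * b ^ 2 = a * (a ^ (2 ^ (e + 2) / 2) * b ^ (2 ^ (e + 2) / 2)) ^ l)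
    (h₃ : a ^ 2 * b * a ^ 2 = b * (a ^ (2 ^ (e + 2) / 2) * b ^ (2 ^ (e + 2) / 2)) ^ l) :
    SatisfiesG2 (e + 2) k l a b := by
  have hzv := SatisfiesG2.commute_z_right (e := e) hc
  have hzu := SatisfiesG2.commute_z_left (e := e) hc
  refine ⟨ha, hb, hc, ?_, ?_, ?_⟩
  · rw [mul_assoc (a ^ 2), ← (hzv.pow_left k).inv_right.eq, ← mul_assoc, ← mul_assoc, ← h₁,
      mul_inv_cancel_right]
  · rw [← (hzv.pow_left l).inv_right.eq, ← mul_assoc, ← h₂, mul_inv_cancel_right]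
  · rw [← (hzu.pow_left l).inv_right.eq, ← mul_assoc, ← h₃, mul_inv_cancel_right]

namespace G2

/-- The twist in the action of `b`, which depends on the exponent of `a` modulo 4. -/
def twist (e k l : ℕ) : ZMod 4 → ZMod (2 ^ (e + 2)) :=
  ![0, (l + k) * 2 ^ (e + 1), l * 2 ^ (e + 1), k * 2 ^ (e + 1)]

/-- The parity sign. -/
def sign (e : ℕ) : ZMod 4 → ZMod (2 ^ (e + 2)) := ![1, -1, 1, -1]

/-- Reduction modulo 4. -/
def red (e : ℕ) : ZMod (2 ^ (e + 2)) →+* ZMod 4 :=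
  ZMod.castHom (show 4 ∣ 2 ^ (e + 2) from ⟨2 ^ e, by ring⟩) _

/-- Left multiplication by `a` on the normal forms `a ^ i * b ^ j`. -/
def permA (e : ℕ) : Equiv.Perm (ZMod (2 ^ (e + 2)) × ZMod (2 ^ (e + 2))) where
  toFun p := (p.1 + 1, p.2)
  invFun p := (p.1 - 1, p.2)
  left_inv p := by simp
  right_inv p := by simp

variable {e k l : ℕ}

theorem zmod_four_cases : ∀ x : ZMod 4, x = 0 ∨ x = 1 ∨ x = 2 ∨ x = 3 := by decide

theorem half_add_half : (2 : ZMod (2 ^ (e + 2))) ^ (e + 1) + 2 ^ (e + 1) = 0 := by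
  have h : ((2 ^ (e + 2) : ℕ) : ZMod (2 ^ (e + 2))) = 0 := ZMod.natCast_self _
  push_cast at h
  rw [← h]; ring

theorem twist_zero : twist e k l 0 = 0 := rfl

theorem twist_one : twist e k l 1 = (l + k) * 2 ^ (e + 1) := rfl

theorem twist_two : twist e k l 2 = l * 2 ^ (e + 1) := rfl

theorem twist_three : twist e k l 3 = k * 2 ^ (e + 1) := rfl

theorem twist_add_self (x : ZMod 4) : twist e k l x + twist e k l x = 0 := by
  have h := half_add_half (e := e)
  rcases zmod_four_cases x with rfl | rfl | rfl | rfl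
  · rw [twist_zero, add_zero]
  · rw [twist_one, ← mul_add, h, mul_zero]
  · rw [twist_two, ← mul_add, h, mul_zero]
  · rw [twist_three, ← mul_add, h, mul_zero]

theorem sign_neg (x : ZMod 4) : sign e (-x) = sign e x := by
  rcases zmod_four_cases x with rfl | rfl | rfl | rfl <;> rfl

theorem sign_add_one (x : ZMod 4) : sign e (x + 1) = -sign e x := by
  rcases zmod_four_cases x with rfl | rfl | rfl | rfl
  · rfl
  · exact (neg_neg (1 : ZMod (2 ^ (e + 2)))).symm
  · rfl
  · exact (neg_neg (1 : ZMod (2 ^ (e + 2)))).symm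

theorem sign_add_two (x : ZMod 4) : sign e (x + 2) = sign e x := by
  rcases zmod_four_cases x with rfl | rfl | rfl | rfl <;> rfl

theorem sign_eq (x : ZMod 4) : sign e x = 1 ∨ sign e x = -1 := by
  rcases zmod_four_cases x with rfl | rfl | rfl | rfl
  · exact Or.inl rfl
  · exact Or.inr rfl
  · exact Or.inl rfl
  · exact Or.inr rfl

theorem twist_add_two (x : ZMod 4) :
    twist e k l (x + 2) = twist e k l x + l * 2 ^ (e + 1) := by
  have h := half_add_half (e := e)
  rcases zmod_four_cases x with rfl | rfl | rfl | rfl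
  · change twist e k l 2 = twist e k l 0 + _
    rw [twist_zero, twist_two, zero_add]
  · change twist e k l 3 = twist e k l 1 + _
    rw [twist_one, twist_three]
    linear_combination -(l : ZMod (2 ^ (e + 2))) * h
  · change twist e k l 0 = twist e k l 2 + _
    rw [twist_zero, twist_two]
    linear_combination -(l : ZMod (2 ^ (e + 2))) * h
  · change twist e k l 1 = twist e k l 3 + _
    rw [twist_one, twist_three]
    ring

/-- The sum of the twists of an exponent and its negative vanishes for even exponents. -/
def dbl (e k l : ℕ) (x : ZMod 4) : ZMod (2 ^ (e + 2)) := twist e k l x + twist e k l (-x)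

theorem dbl_eq (x : ZMod 4) : dbl e k l x = 0 ∨ dbl e k l x = l * 2 ^ (e + 1) := by
  have h := half_add_half (e := e)
  rcases zmod_four_cases x with rfl | rfl | rfl | rfl
  · refine Or.inl ?_
    change twist e k l 0 + twist e k l 0 = _
    rw [twist_zero, add_zero]
  · refine Or.inr ?_
    change twist e k l 1 + twist e k l 3 = _
    rw [twist_one, twist_three]
    linear_combination (k : ZMod (2 ^ (e + 2))) * h
  · refine Or.inl ?_
    exact twist_add_self 2
  · refine Or.inr ?_
    change twist e k l 3 + twist e k l 1 = _
    rw [twist_one, twist_three]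
    linear_combination (k : ZMod (2 ^ (e + 2))) * h

theorem dbl_add_dbl (x : ZMod 4) : dbl e k l x + dbl e k l (x + 1) = l * 2 ^ (e + 1) := by
  have h := half_add_half (e := e)
  have h0 : dbl e k l 0 = 0 := twist_add_self 0
  have h2 : dbl e k l 2 = 0 := twist_add_self 2
  have h1 : dbl e k l 1 = l * 2 ^ (e + 1) := by
    change twist e k l 1 + twist e k l 3 = _
    rw [twist_one, twist_three]
    linear_combination (k : ZMod (2 ^ (e + 2))) * h
  have h3 : dbl e k l 3 = l * 2 ^ (e + 1) := by
    rw [← h1]; exact add_comm _ _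
  rcases zmod_four_cases x with rfl | rfl | rfl | rfl
  · change dbl e k l 0 + dbl e k l 1 = _
    rw [h0, h1, zero_add]
  · change dbl e k l 1 + dbl e k l 2 = _
    rw [h2, h1, add_zero]
  · change dbl e k l 2 + dbl e k l 3 = _
    rw [h2, h3, zero_add]
  · change dbl e k l 3 + dbl e k l 0 = _
    rw [h0, h3, add_zero]

theorem dbl_add_two (x : ZMod 4) : dbl e k l (x + 2) = dbl e k l x := by
  have h1 := dbl_add_dbl (e := e) (k := k) (l := l) x
  have h2 := dbl_add_dbl (e := e) (k := k) (l := l) (x + 1)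
  rw [add_assoc, show (1 + 1 : ZMod 4) = 2 from rfl] at h2
  linear_combination h2 - h1

theorem dbl_add_self (x : ZMod 4) : dbl e k l x + dbl e k l x = 0 := by
  have h1 := twist_add_self (e := e) (k := k) (l := l) x
  have h2 := twist_add_self (e := e) (k := k) (l := l) (-x)
  rw [dbl]
  linear_combination h1 + h2

theorem dbl_add_twist (x : ZMod 4) :
    dbl e k l x + twist e k l (x + 1) = k * 2 ^ (e + 1) + twist e k l (x + 2) := by
  have h := half_add_half (e := e)
  rw [twist_add_two]
  have h13 : twist e k l 1 + twist e k l 3 = l * 2 ^ (e + 1) := by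
    rw [twist_one, twist_three]
    linear_combination (k : ZMod (2 ^ (e + 2))) * h
  rcases zmod_four_cases x with rfl | rfl | rfl | rfl
  · change twist e k l 0 + twist e k l 0 + twist e k l 1 = _
    rw [twist_zero, twist_one]; ring
  · change twist e k l 1 + twist e k l 3 + twist e k l 2 = _
    rw [h13, twist_one, twist_two]
    linear_combination -(k : ZMod (2 ^ (e + 2))) * h
  · change twist e k l 2 + twist e k l 2 + twist e k l 3 = _
    rw [twist_two, twist_three]; ring
  · change twist e k l 3 + twist e k l 1 + twist e k l 0 = _
    rw [add_comm (twist e k l 3), h13, twist_zero, twist_three]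
    linear_combination -(k : ZMod (2 ^ (e + 2))) * h

/-- Twists must vanish modulo 4, because `sign` and `twist` are read off an exponent modulo 4. Half
the modulus is divisible by 4 only for `e ≥ 1`, whence the condition at `e = 0`. -/
theorem cast_mul_half {c : ℕ} (hc : e = 0 → c = 0) : (c : ZMod 4) * 2 ^ (e + 1) = 0 := by
  rcases Nat.eq_zero_or_pos e with he | he
  · rw [hc he]; simp
  · obtain ⟨e, rfl⟩ : ∃ e', e = e' + 1 := Nat.exists_eq_succ_of_ne_zero he.ne'
    rw [pow_succ, pow_succ, mul_assoc (2 ^ e), show (2 * 2 : ZMod 4) = 0 from rfl]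
    simp

theorem red_mul_half {c : ℕ} (hc : e = 0 → c = 0) :
    red e ((c : ZMod (2 ^ (e + 2))) * 2 ^ (e + 1)) = 0 := by
  rw [map_mul, map_pow, map_natCast, map_ofNat, cast_mul_half hc]

theorem red_twist (hk : e = 0 → k = 0) (hl : e = 0 → l = 0) (x : ZMod 4) :
    red e (twist e k l x) = 0 := by
  rcases zmod_four_cases x with rfl | rfl | rfl | rfl
  · rw [twist_zero, map_zero]
  · rw [twist_one, add_mul, map_add, red_mul_half hk, red_mul_half hl, add_zero]
  · rw [twist_two, red_mul_half hl]
  · rw [twist_three, red_mul_half hk]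

theorem red_dbl (hk : e = 0 → k = 0) (hl : e = 0 → l = 0) (x : ZMod 4) :
    red e (dbl e k l x) = 0 := by
  rw [dbl, map_add, red_twist hk hl, red_twist hk hl, add_zero]

/-- Left multiplication by `b` on the normal forms `a ^ i * b ^ j`. -/
def permB (e k l : ℕ) (hk : e = 0 → k = 0) (hl : e = 0 → l = 0) :
    Equiv.Perm (ZMod (2 ^ (e + 2)) × ZMod (2 ^ (e + 2))) where
  toFun p := (-p.1 + twist e k l (red e p.1),
    p.2 + sign e (red e p.1) + twist e k l (red e p.1))
  invFun p := (-p.1 + twist e k l (-red e p.1),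
    p.2 - sign e (-red e p.1) - twist e k l (-red e p.1))
  left_inv p := by
    ext
    · simp [red_twist hk hl]
    · simp only [map_add, map_neg, red_twist hk hl, add_zero, neg_neg]
      ring
  right_inv p := by
    ext
    · simp [red_twist hk hl]
    · simp only [map_add, map_neg, red_twist hk hl, add_zero]
      ring

section Action

variable (hk : e = 0 → k = 0) (hl : e = 0 → l = 0)

theorem permA_apply (p : ZMod (2 ^ (e + 2)) × ZMod (2 ^ (e + 2))) :
    permA e p = (p.1 + 1, p.2) := rfl

theorem permB_apply (p : ZMod (2 ^ (e + 2)) × ZMod (2 ^ (e + 2))) :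
    permB e k l hk hl p = (-p.1 + twist e k l (red e p.1),
      p.2 + sign e (red e p.1) + twist e k l (red e p.1)) := rfl

theorem permA_pow_apply (m : ℕ) (p : ZMod (2 ^ (e + 2)) × ZMod (2 ^ (e + 2))) :
    (permA e ^ m) p = (p.1 + m, p.2) := by
  induction m generalizing p with
  | zero => simp
  | succ m ih =>
    rw [pow_succ (permA e), Equiv.Perm.mul_apply, ih, permA_apply]
    ext
    · push_cast; ring
    · rfl

theorem permB_sq_apply (p : ZMod (2 ^ (e + 2)) × ZMod (2 ^ (e + 2))) :
    (permB e k l hk hl ^ 2) p = (p.1 + dbl e k l (red e p.1),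
      p.2 + 2 * sign e (red e p.1) + dbl e k l (red e p.1)) := by
  rw [sq, Equiv.Perm.mul_apply, permB_apply, permB_apply]
  have h := twist_add_self (e := e) (k := k) (l := l) (red e p.1)
  simp only [map_add, map_neg, red_twist hk hl, add_zero, sign_neg, dbl]
  ext
  · linear_combination -h
  · ring

theorem permB_sq_pow_apply (m : ℕ) (p : ZMod (2 ^ (e + 2)) × ZMod (2 ^ (e + 2))) :
    ((permB e k l hk hl ^ 2) ^ m) p = (p.1 + m * dbl e k l (red e p.1),
      p.2 + 2 * m * sign e (red e p.1) + m * dbl e k l (red e p.1)) := by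
  induction m generalizing p with
  | zero => simp
  | succ m ih =>
    rw [pow_succ (permB e k l hk hl ^ 2), Equiv.Perm.mul_apply, ih, permB_sq_apply]
    simp only [map_add, red_dbl hk hl, add_zero]
    ext
    · push_cast; ring
    · push_cast; ring

theorem permB_half_apply (p : ZMod (2 ^ (e + 2)) × ZMod (2 ^ (e + 2))) :
    (permB e k l hk hl ^ (2 ^ (e + 2) / 2)) p = (p.1, p.2 + 2 ^ (e + 1)) := by
  have h := half_add_half (e := e)
  -- Even multiples of `dbl` vanish; for `e = 0` the multiplier is 1 and `l = 0` is what helps.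
  have hd : ((2 ^ e : ℕ) : ZMod (2 ^ (e + 2))) * dbl e k l (red e p.1) = 0 := by
    rcases Nat.eq_zero_or_pos e with he | he
    · rcases dbl_eq (e := e) (k := k) (l := l) (red e p.1) with h0 | h0
      · rw [h0, mul_zero]
      · rw [h0, hl he]; simp
    · obtain ⟨e, rfl⟩ : ∃ e', e = e' + 1 := Nat.exists_eq_succ_of_ne_zero he.ne'
      have := dbl_add_self (e := e + 1) (k := k) (l := l) (red (e + 1) p.1)
      push_cast
      linear_combination (2 : ZMod (2 ^ (e + 1 + 2))) ^ e * this
  have hs : (2 : ZMod (2 ^ (e + 2))) ^ (e + 1) * sign e (red e p.1) = 2 ^ (e + 1) := by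
    rcases sign_eq (e := e) (red e p.1) with h0 | h0
    · rw [h0, mul_one]
    · rw [h0]; linear_combination -h
  rw [SatisfiesG2.half_eq, pow_mul, permB_sq_pow_apply, hd]
  ext
  · simp
  · push_cast
    simp only [add_zero]
    rw [← pow_succ', hs]

theorem z_pow_apply (m : ℕ) (p : ZMod (2 ^ (e + 2)) × ZMod (2 ^ (e + 2))) :
    ((permA e ^ (2 ^ (e + 2) / 2) * permB e k l hk hl ^ (2 ^ (e + 2) / 2)) ^ m) p =
      (p.1 + m * 2 ^ (e + 1), p.2 + m * 2 ^ (e + 1)) := by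
  induction m generalizing p with
  | zero => simp
  | succ m ih =>
    rw [pow_succ (permA e ^ (2 ^ (e + 2) / 2) * permB e k l hk hl ^ (2 ^ (e + 2) / 2)) m, Equiv.Perm.mul_apply, Equiv.Perm.mul_apply, permB_half_apply, permA_pow_apply, ih,
      SatisfiesG2.half_eq]
    ext
    · push_cast; ring
    · push_cast; ring

/-- The values of `twist` are chosen so that `dbl_add_twist`, `dbl_add_dbl` and `twist_add_two` are
the last three relations read on exponents. -/
theorem satisfiesG2_perm : SatisfiesG2 (e + 2) k l (permA e) (permB e k l hk hl) := by
  have h := half_add_half (e := e)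
  have h2 : ∀ c : Equiv.Perm (ZMod (2 ^ (e + 2)) × ZMod (2 ^ (e + 2))),
      c ^ 2 ^ (e + 2) = c ^ (2 ^ (e + 2) / 2) * c ^ (2 ^ (e + 2) / 2) := by
    intro c
    rw [← pow_add, SatisfiesG2.half_eq]; congr 1; ring
  have h11 : ∀ x : ZMod 4, x + 1 + 1 = x + 2 := fun x => by
    rw [add_assoc]; rfl
  refine SatisfiesG2.mk_of_mul ?_ ?_ ?_ ?_ ?_ ?_
  · ext p : 1
    rw [permA_pow_apply]
    simp
  · ext p : 1
    rw [h2, Equiv.Perm.mul_apply, permB_half_apply, permB_half_apply]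
    ext
    · rfl
    · change _ + _ + _ = _
      rw [add_assoc, h, add_zero]; rfl
  · ext p : 1
    simp only [Equiv.Perm.mul_apply, permB_sq_apply, permA_pow_apply, map_add, Nat.cast_ofNat,
      map_ofNat, dbl_add_two, sign_add_two]
    ext
    · ring
    · rfl
  · ext p : 1
    have h1 := dbl_add_twist (e := e) (k := k) (l := l) (red e p.1)
    simp only [Equiv.Perm.mul_apply, z_pow_apply, permB_sq_apply, permA_pow_apply, permA_apply,
      permB_apply, map_add, map_one, Nat.cast_ofNat, map_ofNat, red_dbl hk hl, red_mul_half hk,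
      add_zero, sign_add_two, sign_add_one]
    have hd := dbl_add_self (e := e) (k := k) (l := l) (red e p.1)
    ext
    · linear_combination h1 - hd + (k : ZMod (2 ^ (e + 2))) * h
    · linear_combination h1
  · ext p : 1
    have h1 := dbl_add_dbl (e := e) (k := k) (l := l) (red e p.1)
    simp only [Equiv.Perm.mul_apply, z_pow_apply, permB_sq_apply, permA_apply,
      map_add, map_one, red_dbl hk hl, add_zero, sign_add_one]
    ext
    · linear_combination h1
    · linear_combination h1
  · ext p : 1
    simp only [Equiv.Perm.mul_apply, z_pow_apply, permA_pow_apply, permB_apply,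
      map_add, Nat.cast_ofNat, map_ofNat, red_mul_half hl, add_zero, sign_add_two, twist_add_two]
    ext
    · linear_combination (l : ZMod (2 ^ (e + 2))) * h
    · ring

theorem permA_zpow_apply_zero (i : ℤ) : (permA e ^ i) (0, 0) = ((i : ZMod (2 ^ (e + 2))), 0) := by
  have h1 : ∀ j, permA e (j, 0) = (j + 1, 0) := fun _ => rfl
  induction i using Int.induction_on with
  | zero => simp
  | succ i ih => rw [add_comm (i : ℤ) 1, zpow_one_add, Equiv.Perm.mul_apply, ih, h1]; push_cast; ring_nf
  | pred i ih =>
    rw [sub_eq_neg_add, zpow_add, Equiv.Perm.mul_apply, ih, zpow_neg_one,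
      Equiv.Perm.inv_eq_iff_eq, h1]
    push_cast; ring_nf

theorem permB_zpow_apply_zero (i : ℤ) :
    (permB e k l hk hl ^ i) (0, 0) = (0, (i : ZMod (2 ^ (e + 2)))) := by
  have h1 : ∀ j, permB e k l hk hl (0, j) = (0, j + 1) := by
    intro j
    rw [permB_apply]
    simp [twist_zero, show sign e 0 = 1 from rfl]
  induction i using Int.induction_on with
  | zero => simp
  | succ i ih => rw [add_comm (i : ℤ) 1, zpow_one_add, Equiv.Perm.mul_apply, ih, h1]; push_cast; ring_nf
  | pred i ih =>
    rw [sub_eq_neg_add, zpow_add, Equiv.Perm.mul_apply, ih, zpow_neg_one,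
      Equiv.Perm.inv_eq_iff_eq, h1]
    push_cast; ring_nf

end Action

/-- The groups `G₂(e; k, l)` form isobicyclic triples with their generators. -/
theorem isIsobicyclicTriple (hk : e = 0 → k = 0) (hl : e = 0 → l = 0) :
    IsIsobicyclicTriple (2 ^ (e + 2)) (a (e + 2) k l) (b (e + 2) k l) := by
  have hG := satisfiesG2 (e + 2) k l
  set f := (satisfiesG2_perm hk hl).lift
  have hfa : f (a (e + 2) k l) = permA e := SatisfiesG2.lift_a _
  have hfb : f (b (e + 2) k l) = permB e k l hk hl := SatisfiesG2.lift_b _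
  -- From the origin, powers of `a` move along the first axis and powers of `b` along the second;
  -- orders and disjointness can be read off there.
  have hpowa : ∀ i : ℤ, f (a (e + 2) k l ^ i) (0, 0) = ((i : ZMod (2 ^ (e + 2))), 0) := by
    intro i
    rw [map_zpow, hfa, permA_zpow_apply_zero]
  have hpowb : ∀ i : ℤ, f (b (e + 2) k l ^ i) (0, 0) = (0, (i : ZMod (2 ^ (e + 2)))) := by
    intro i
    rw [map_zpow, hfb, permB_zpow_apply_zero]
  refine ⟨?_, ?_, ?_, ?_, ?_⟩
  · refine Nat.dvd_antisymm (orderOf_dvd_of_pow_eq_one hG.pow_left) ?_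
    have h1 := hpowa (orderOf (a (e + 2) k l))
    rw [zpow_natCast, pow_orderOf_eq_one, map_one] at h1
    have h2 := congrArg Prod.fst h1
    simp only [Equiv.Perm.one_apply, Int.cast_natCast] at h2
    exact (ZMod.natCast_eq_zero_iff _ _).1 h2.symm
  · refine Nat.dvd_antisymm (orderOf_dvd_of_pow_eq_one hG.pow_right) ?_
    have h1 := hpowb (orderOf (b (e + 2) k l))
    rw [zpow_natCast, pow_orderOf_eq_one, map_one] at h1
    have h2 := congrArg Prod.snd h1
    simp only [Equiv.Perm.one_apply, Int.cast_natCast] at h2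
    exact (ZMod.natCast_eq_zero_iff _ _).1 h2.symm
  · intro g
    obtain ⟨i, j, hg⟩ := hG.exists_eq hl (closure_eq_top _ _ _) g
    exact ⟨_, ⟨i, rfl⟩, _, ⟨j, rfl⟩, hg⟩
  · rw [eq_bot_iff]
    rintro _ ⟨⟨i, rfl⟩, ⟨j, hj⟩⟩
    simp only at hj
    have h1 := hpowa i
    rw [← hj, hpowb] at h1
    have h2 := congrArg Prod.snd h1
    simp only at h2
    rw [Subgroup.mem_bot]
    simp only
    rw [← hj]
    obtain ⟨c, rfl⟩ := (ZMod.intCast_zmod_eq_zero_iff_dvd _ _).1 h2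
    rw [zpow_mul, zpow_natCast, hG.pow_right, one_zpow]
  -- By symmetry of the relations there is an endomorphism exchanging the generators; its square
  -- fixes them, so it is an automorphism.
  · have h2 : (hG.swap hl).lift.comp (hG.swap hl).lift = MonoidHom.id _ :=
      hom_ext (by simp) (by simp)
    exact ⟨MonoidHom.toMulEquiv (hG.swap hl).lift (hG.swap hl).lift h2 h2,
      (hG.swap hl).lift_a, (hG.swap hl).lift_b⟩

end G2

/-! ### The classification -/

/-- For `n ≥ 8` the exponent `n / 2` is divisible by 4, so `z` becomes trivial in a group where `a ^
4 = b ^ 4 = 1`, and the parameters no longer matter. -/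
theorem SatisfiesG2.of_two {G : Type*} [Group G] {a b : G} (h : SatisfiesG2 2 0 0 a b)
    (e k l : ℕ) : SatisfiesG2 (e + 3) k l a b := by
  have h1 : 2 ^ (e + 3) / 2 = 2 ^ 2 * 2 ^ e := by
    rw [SatisfiesG2.half_eq]; ring
  have hm := h.mul_eq
  have hl := h.sq_mul_left
  have hr := h.sq_mul_right
  rw [pow_zero, mul_one] at hm hl hr
  refine ⟨?_, ?_, h.comm, ?_, ?_, ?_⟩
  · rw [show 2 ^ (e + 3) = 2 ^ 2 * 2 ^ (e + 1) by ring, pow_mul, h.pow_left, one_pow]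
  · rw [show 2 ^ (e + 3) = 2 ^ 2 * 2 ^ (e + 1) by ring, pow_mul, h.pow_right, one_pow]
  all_goals
    rw [h1, pow_mul, pow_mul, h.pow_left, h.pow_right, one_pow, one_mul, one_pow, mul_one]
    assumption

namespace G2

/-- `x ^ 2`, `y ^ 2` and `x * y` are commuting involutions generating a group of order 8: each of
their seven products is some `x ^ i * y ^ j` with exponents not both divisible by 4. -/
theorem not_isMetacyclic_two : ¬ IsMetacyclic (G2 2 0 0) := by
  intro hG
  have h := satisfiesG2 2 0 0
  have ht := isIsobicyclicTriple (e := 0) (k := 0) (l := 0) (fun _ => rfl) fun _ => rfl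
  simp only [zero_add] at ht
  set x := a 2 0 0
  set y := b 2 0 0
  have ha := h.pow_left
  have hb := h.pow_right
  have hm := h.mul_eq
  have hl := h.sq_mul_left
  have hr := h.sq_mul_right
  rw [pow_zero, mul_one] at hm hl hr
  have hx2 : (x ^ 2) ^ 2 = 1 := by rw [← pow_mul]; exact ha
  have hy2 : (y ^ 2) ^ 2 = 1 := by rw [← pow_mul]; exact hb
  rw [inv_eq_of_mul_eq_one_left (by rw [← sq, hy2])] at hl hm
  rw [inv_eq_of_mul_eq_one_left (by rw [← sq, hx2])] at hr
  have hxy : Commute (x ^ 2) y := hr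
  have hyx : Commute (y ^ 2) x := hl
  have hw : (x * y) ^ 2 = 1 := by
    calc (x * y) ^ 2 = x * (y * x) * y := by rw [sq]; simp only [mul_assoc]
      _ = x * x * (y * x ^ 2) * y ^ 2 * y := by rw [hm]; simp only [mul_assoc]
      _ = (x ^ 2) ^ 2 * (y ^ 2) ^ 2 := by rw [← hxy.eq]; simp only [sq, mul_assoc]
      _ = 1 := by rw [hx2, hy2, one_mul]
  have key : ∀ i j : ℕ, (i % 4 ≠ 0) → x ^ i * y ^ j ≠ 1 := by
    intro i j hi hij
    have h1 := (ht.dvd_of_eq_one (i := i) (j := j) (by exact_mod_cast hij)).1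
    norm_num at h1
    omega
  have key' : ∀ j : ℕ, (j % 4 ≠ 0) → y ^ j ≠ 1 := by
    intro j hj hij
    have h1 := (ht.dvd_of_eq_one (i := 0) (j := j) (by simpa using hij)).2
    norm_num at h1
    omega
  have hxx : Commute (x ^ 2) x := (Commute.refl x).pow_left 2
  have hyy : Commute (y ^ 2) y := (Commute.refl y).pow_left 2
  rcases hG.eq_one_of_sq_eq_one hx2 hy2 hw h.comm.symm (hxx.mul_right hxy) (hyx.mul_right hyy) with
    h1 | h1 | h1 | h1 | h1 | h1 | h1
  · exact key 2 0 (by norm_num) (by simpa using h1)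
  · exact key' 2 (by norm_num) h1
  · exact key 2 2 (by norm_num) h1
  · exact key 1 1 (by norm_num) (by simpa using h1)
  · exact key 3 1 (by norm_num) (by rw [← h1, pow_succ x 2, pow_one, mul_assoc])
  · refine key 1 3 (by norm_num) ?_
    rw [← h1, ← mul_assoc, hyx.eq, pow_succ y 2, pow_one, mul_assoc]
  · refine key 3 3 (by norm_num) ?_
    rw [← h1, pow_succ x 2, pow_succ y 2, mul_assoc (x ^ 2) (y ^ 2), ← mul_assoc (y ^ 2) x, hyx.eq]
    simp only [mul_assoc]

theorem not_isMetacyclic {e k l : ℕ} (hk : e = 0 → k = 0) (hl : e = 0 → l = 0) :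
    ¬ IsMetacyclic (G2 (e + 2) k l) := by
  rcases Nat.eq_zero_or_pos e with he | he
  · obtain rfl := hk he
    obtain rfl := hl he
    subst he
    exact not_isMetacyclic_two
  · obtain ⟨e, rfl⟩ : ∃ e', e = e' + 1 := Nat.exists_eq_succ_of_ne_zero he.ne'
    intro h
    have h1 := (satisfiesG2 2 0 0).of_two e k l
    refine not_isMetacyclic_two (h.of_surjective h1.lift ?_)
    rw [← MonoidHom.range_eq_top, eq_top_iff, ← closure_eq_top 2 0 0, Subgroup.closure_le]
    rintro x (rfl | rfl)
    · exact ⟨_, h1.lift_a⟩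
    · exact ⟨_, h1.lift_b⟩

/-- The parameters are determined by the triple. -/
theorem param_unique {e k l k' l' : ℕ} {G : Type*} [Group G] {a b : G}
    (ht : IsIsobicyclicTriple (2 ^ (e + 2)) a b) (h : SatisfiesG2 (e + 2) k l a b)
    (h' : SatisfiesG2 (e + 2) k' l' a b) (hk : k ≤ 1) (hl : l ≤ 1) (hk' : k' ≤ 1) (hl' : l' ≤ 1) :
    k = k' ∧ l = l' := by
  have hz : a ^ (2 ^ (e + 2) / 2) * b ^ (2 ^ (e + 2) / 2) ≠ 1 := by
    intro hz
    have h1 := (ht.dvd_of_eq_one (i := (2 ^ (e + 2) / 2 : ℕ)) (j := (2 ^ (e + 2) / 2 : ℕ))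
      (by simpa only [zpow_natCast] using hz)).1
    have h2 := Nat.le_of_dvd (Nat.div_pos (Nat.le_self_pow (by omega) 2) (by norm_num))
      (Int.natCast_dvd_natCast.1 h1)
    have h3 := Nat.div_lt_self (show 0 < 2 ^ (e + 2) by positivity) (le_refl 2)
    omega
  have key : ∀ {z : G} {i j : ℕ}, z ≠ 1 → i ≤ 1 → j ≤ 1 → z ^ i = z ^ j → i = j := by
    intro z i j hz hi hj hij
    interval_cases i <;> interval_cases j
    · rfl
    · exact absurd hij.symm (by simpa using hz)
    · exact absurd hij (by simpa using hz)
    · rfl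
  constructor
  · exact key hz hk hk' (mul_left_cancel (mul_left_cancel (h.mul_eq.symm.trans h'.mul_eq)))
  · exact key hz hl hl'
      (mul_left_cancel (mul_left_cancel (h.sq_mul_left.symm.trans h'.sq_mul_left)))

end G2

namespace OrientedMap

/-- A regular embedding with non-metacyclic `Aut₀` corresponds to some `G₂(e; k, l)`. -/
theorem IsRegular.exists_correspondsAt_G2 {e : ℕ} {M : OrientedMap (KK (2 ^ (e + 2)))}
    (hM : M.IsRegular) (hmc : ¬ IsMetacyclic M.Aut₀) (d : (KK (2 ^ (e + 2))).Dart) :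
    ∃ k l : ℕ, k ≤ 1 ∧ l ≤ 1 ∧ (e = 0 → k = 0 ∧ l = 0) ∧
      M.CorrespondsAt d (G2.a (e + 2) k l) (G2.b (e + 2) k l) := by
  obtain ⟨a, b, ht, φ, h₁, h₂⟩ := hM.exists_triple d
  rcases IsIsobicyclicTriple.commute_or_satisfiesG2 e ht with ⟨s, t, hst⟩ | ⟨k, l, hk, hl, h0, hG⟩
  · exact absurd (ht.isMetacyclic hst) hmc
  · have hG2 := G2.satisfiesG2 (e + 2) k l
    -- A normal form mapping to 1 has both exponents divisible by `n`, since the target is a triple;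
    -- so it is already trivial.
    have hinj : Function.Injective hG.lift := by
      rw [injective_iff_map_eq_one]
      intro g hg
      obtain ⟨i, j, rfl⟩ := hG2.exists_eq (fun he => (h0 he).2) (G2.closure_eq_top _ _ _) g
      rw [map_mul, map_zpow, map_zpow, hG.lift_a, hG.lift_b] at hg
      obtain ⟨⟨i, rfl⟩, ⟨j, rfl⟩⟩ := ht.dvd_of_eq_one hg
      rw [zpow_mul, zpow_mul, zpow_natCast, zpow_natCast, hG2.pow_left, hG2.pow_right, one_zpow,
        one_zpow, one_mul]
    have hsurj : Function.Surjective hG.lift := by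
      intro g
      obtain ⟨i, j, rfl⟩ := ht.exists_eq g
      exact ⟨G2.a (e + 2) k l ^ i * G2.b (e + 2) k l ^ j, by
        rw [map_mul, map_zpow, map_zpow, hG.lift_a, hG.lift_b]⟩
    refine ⟨k, l, hk, hl, h0, (MulEquiv.ofBijective hG.lift ⟨hinj, hsurj⟩).trans φ, ?_, ?_⟩
    · change (φ (hG.lift (G2.a (e + 2) k l))).1.toHom.mapDart d = _
      rw [hG.lift_a, h₁]
    · change (φ (hG.lift (G2.b (e + 2) k l))).1.toHom.mapDart d.symm = _
      rw [hG.lift_b, h₂]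

/-- The regular embeddings with non-metacyclic `Aut₀`, for a family of admissible parameters without
repetition. -/
theorem classification {e n : ℕ} (hn : n = 2 ^ (e + 2)) {ι : Type*} (k l : ι → ℕ)
    (hk : ∀ i, k i ≤ 1) (hl : ∀ i, l i ≤ 1) (hk0 : ∀ i, e = 0 → k i = 0)
    (hl0 : ∀ i, e = 0 → l i = 0) (hinj : ∀ i j, k i = k j → l i = l j → i = j)
    (hsurj : ∀ k' l' : ℕ, k' ≤ 1 → l' ≤ 1 → (e = 0 → k' = 0 ∧ l' = 0) → ∃ i, k i = k' ∧ l i = l') :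
    {c : Quotient (isoSetoid (KK n)) | ∃ M : OrientedMap (KK n), M.IsRegular ∧
      ¬ IsMetacyclic M.Aut₀ ∧ Quotient.mk (isoSetoid (KK n)) M = c}.ncard = Nat.card ι ∧
    ∃ M : ι → OrientedMap (KK n),
      (∀ i, (M i).IsRegular ∧ ¬ IsMetacyclic (M i).Aut₀ ∧
        IsIsobicyclicTriple n (G2.a (e + 2) (k i) (l i)) (G2.b (e + 2) (k i) (l i))) ∧
      (∀ i j, (M i).Isomorphic (M j) → i = j) ∧
      (∀ M' : OrientedMap (KK n), M'.IsRegular → ¬ IsMetacyclic M'.Aut₀ →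
        ∃ i, M'.Isomorphic (M i)) ∧
      (∀ M' : OrientedMap (KK n), M'.IsRegular → ∀ (d : (KK n).Dart) (i : ι),
        M'.CorrespondsAt d (G2.a (e + 2) (k i) (l i)) (G2.b (e + 2) (k i) (l i)) ↔
          M'.Isomorphic (M i)) := by
  subst hn
  have ht : ∀ i, IsIsobicyclicTriple (2 ^ (e + 2)) (G2.a (e + 2) (k i) (l i))
      (G2.b (e + 2) (k i) (l i)) := fun i => G2.isIsobicyclicTriple (hk0 i) (hl0 i)
  choose M hM d hd using fun i => exists_correspondsAt (by positivity) (ht i)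
  have hmc : ∀ i, ¬ IsMetacyclic (M i).Aut₀ := by
    intro i h
    obtain ⟨φ, -⟩ := hd i
    exact G2.not_isMetacyclic (hk0 i) (hl0 i) (h.of_surjective φ.symm.toMonoidHom φ.symm.surjective)
  have hiff : ∀ M' : OrientedMap (KK (2 ^ (e + 2))), M'.IsRegular →
      ∀ (d : (KK (2 ^ (e + 2))).Dart) (i : ι),
        M'.CorrespondsAt d (G2.a (e + 2) (k i) (l i)) (G2.b (e + 2) (k i) (l i)) ↔
          M'.Isomorphic (M i) := by
    intro M' hM' d' i
    constructor
    · intro h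
      exact h.isomorphic hM' (hM i) (ht i) (hd i)
    · rintro ⟨ψ, hψ⟩
      exact ((hd i).of_isIso hψ.inv).all_darts hM' d'
  -- Isomorphic maps would make one map correspond to both triples at the same dart, so the groups
  -- would be identified generator by generator and `param_unique` applies.
  have hne : ∀ i j, (M i).Isomorphic (M j) → i = j := by
    intro i j hij
    have h1 := (hiff (M i) (hM i) (d i) j).2 hij
    obtain ⟨f, hfa, hfb⟩ := (hd i).exists_mulEquiv h1
    have h2 := (G2.satisfiesG2 (e + 2) (k i) (l i)).map f.toMonoidHom
    have hfa' : f.toMonoidHom (G2.a (e + 2) (k i) (l i)) = _ := hfa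
    have hfb' : f.toMonoidHom (G2.b (e + 2) (k i) (l i)) = _ := hfb
    rw [hfa', hfb'] at h2
    have h3 := G2.param_unique (ht j) h2 (G2.satisfiesG2 (e + 2) (k j) (l j)) (hk i) (hl i) (hk j)
      (hl j)
    exact hinj i j h3.1 h3.2
  have hall : ∀ M' : OrientedMap (KK (2 ^ (e + 2))), M'.IsRegular → ¬ IsMetacyclic M'.Aut₀ →
      ∃ i, M'.Isomorphic (M i) := by
    intro M' hM' hmc'
    have hpos : 0 < 2 ^ (e + 2) := by positivity
    obtain ⟨w, hw⟩ := KK.exists_adj (Sum.inl (⟨0, hpos⟩ : Fin (2 ^ (e + 2))))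
    obtain ⟨k', l', hk', hl', h0, h⟩ := hM'.exists_correspondsAt_G2 hmc' ⟨(_, w), hw⟩
    obtain ⟨i, rfl, rfl⟩ := hsurj k' l' hk' hl' h0
    exact ⟨i, (hiff M' hM' _ i).1 h⟩
  refine ⟨?_, M, fun i => ⟨hM i, hmc i, ht i⟩, hne, hall, hiff⟩
  rw [← Set.ncard_univ, ← Set.ncard_image_of_injective (f := fun i : ι =>
    Quotient.mk (isoSetoid (KK (2 ^ (e + 2)))) (M i)) Set.univ
    fun i j hij => hne i j (Quotient.exact hij)]
  congr 1
  ext c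
  constructor
  · rintro ⟨M', hM', hmc', rfl⟩
    obtain ⟨i, hi⟩ := hall M' hM' hmc'
    exact ⟨i, trivial, (Quotient.sound hi).symm⟩
  · rintro ⟨i, -, rfl⟩
    exact ⟨M i, hM i, hmc i, rfl⟩

end OrientedMap

theorem theorem5p1 :
    (∀ e : ℕ, 3 ≤ e →
      {c : Quotient (OrientedMap.isoSetoid (KK (2 ^ e))) |
        ∃ M : OrientedMap (KK (2 ^ e)), M.IsRegular ∧ ¬ IsMetacyclic M.Aut₀ ∧
          Quotient.mk (OrientedMap.isoSetoid (KK (2 ^ e))) M = c}.ncard = 4 ∧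
      ∃ M : Fin 2 → Fin 2 → OrientedMap (KK (2 ^ e)),
        (∀ k l : Fin 2, (M k l).IsRegular ∧ ¬ IsMetacyclic (M k l).Aut₀ ∧
          IsIsobicyclicTriple (2 ^ e) (G2.a e k l) (G2.b e k l)) ∧
        (∀ k l k' l' : Fin 2, (M k l).Isomorphic (M k' l') → k = k' ∧ l = l') ∧
        (∀ M' : OrientedMap (KK (2 ^ e)), M'.IsRegular → ¬ IsMetacyclic M'.Aut₀ →
          ∃ k l : Fin 2, M'.Isomorphic (M k l)) ∧
        (∀ M' : OrientedMap (KK (2 ^ e)), M'.IsRegular →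
          ∀ (d : (KK (2 ^ e)).Dart) (k l : Fin 2),
            M'.CorrespondsAt d (G2.a e k l) (G2.b e k l) ↔ M'.Isomorphic (M k l))) ∧
    ({c : Quotient (OrientedMap.isoSetoid (KK 4)) |
        ∃ M : OrientedMap (KK 4), M.IsRegular ∧ ¬ IsMetacyclic M.Aut₀ ∧
          Quotient.mk (OrientedMap.isoSetoid (KK 4)) M = c}.ncard = 1 ∧
      ∃ M : OrientedMap (KK 4),
        (M.IsRegular ∧ ¬ IsMetacyclic M.Aut₀ ∧
          IsIsobicyclicTriple 4 (G2.a 2 0 0) (G2.b 2 0 0)) ∧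
        (∀ M' : OrientedMap (KK 4), M'.IsRegular → ¬ IsMetacyclic M'.Aut₀ → M'.Isomorphic M) ∧
        (∀ M' : OrientedMap (KK 4), M'.IsRegular →
          ∀ d : (KK 4).Dart,
            M'.CorrespondsAt d (G2.a 2 0 0) (G2.b 2 0 0) ↔ M'.Isomorphic M)) := by
  refine ⟨fun e he => ?_, ?_⟩
  -- The classification is used with `e + 1` in place of `e`, which is nonzero, so all four
  -- parameter pairs are admissible; for `n = 4` only one is.
  · obtain ⟨e, rfl⟩ : ∃ e', e = e' + 3 := ⟨e - 3, by omega⟩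
    obtain ⟨hcard, M, h₁, h₂, h₃, h₄⟩ := OrientedMap.classification (e := e + 1)
      (n := 2 ^ (e + 3)) rfl (ι := Fin 2 × Fin 2) (fun i => i.1) (fun i => i.2)
      (fun i => by have := i.1.2; omega) (fun i => by have := i.2.2; omega)
      (fun _ h => absurd h (Nat.succ_ne_zero e)) (fun _ h => absurd h (Nat.succ_ne_zero e))
      (fun i j hi hj => Prod.ext (Fin.ext hi) (Fin.ext hj))
      (fun k l hk hl _ => ⟨(⟨k, by omega⟩, ⟨l, by omega⟩), rfl, rfl⟩)
    refine ⟨by rw [hcard]; simp, fun k l => M (k, l), fun k l => h₁ (k, l),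
      fun k l k' l' h => Prod.mk.inj (h₂ _ _ h), fun M' hM' hmc => ?_,
      fun M' hM' d k l => h₄ M' hM' d (k, l)⟩
    obtain ⟨i, hi⟩ := h₃ M' hM' hmc
    exact ⟨i.1, i.2, hi⟩
  · obtain ⟨hcard, M, h₁, h₂, h₃, h₄⟩ := OrientedMap.classification (e := 0) (n := 4) rfl
      (ι := Unit) (fun _ => 0) (fun _ => 0) (by simp) (by simp) (by simp) (by simp) (by simp)
      (fun k l _ _ h => ⟨(), (h rfl).1.symm, (h rfl).2.symm⟩)
    refine ⟨by rw [hcard]; simp, M (), h₁ (), fun M' hM' hmc => ?_,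
      fun M' hM' d => h₄ M' hM' d ()⟩
    obtain ⟨_, hi⟩ := h₃ M' hM' hmc
    exact hi
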